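/- Throughout, scalars are $\mathbb F=\mathbb R$ or $\mathbb C$, index sets are countable, and sums over index sets converge unconditionally. A family $(x_j)_{j\in J}$ in a quasi-Banach space $\mathbb X$ is an *unconditional basic sequence* if every $f$ in its closed linear span $[x_j\colon j\in J]$ has a unique expansion $f=\sum_{j\in J}a_jx_j$ (unconditionally convergent); it is an *unconditional basis* of $\mathbb X$ if moreover $[x_j\colon j\in J]=\mathbb X$. It is *complemented* if $[x_j\colon j\in J]$ is the range of a bounded linear projection of $\mathbb X$, and *semi-normalized* if $\inf_j\Vert x_j\Vert>0$ and $\sup_j\Vert x_j\Vert<\infty$. Families $(x_j)_{j\in J}$ and $(y_i)_{i\in I}$ in quasi-Banach spaces are *permutatively equivalent*, written $(x_j)_{j\in J}\sim(y_i)_{i\in I}$, if there are a bijection $\pi\colon J\to I$ and a linear isomorphism (homeomorphism) $T\colon[x_j\colon j\in J]\to[y_i\colon i\in I]$ with $T(x_j)=y_{\pi(j)}$ for all $j$; they are *equivalent* if $I=J$ and $\pi$ can be taken to be the identity. The *Banach envelope* of $\mathbb X$ is a Banach space $\widehat{\mathbb X}$ with a linear contraction $J_{\mathbb X}\colon\mathbb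 X\to\widehat{\mathbb X}$ such that every linear contraction $T$ from $\mathbb X$ into a Banach space factors as $T=\widehat T\circ J_{\mathbb X}$ for a unique linear contraction $\widehat T$ on $\widehat{\mathbb X}$. A Banach space $\mathbb Y$ is *anti-Euclidean* if there is no constant $C$ such that for every $n\in\mathbb N$ there are bounded linear maps $I_n\colon\ell_2^n\to\mathbb Y$ and $P_n\colon\mathbb Y\to\ell_2^n$ with $P_n\circ I_n=\mathrm{Id}_{\ell_2^n}$ and $\Vert I_n\Vert\,\Vert P_n\Vert\le C$. Let $\mathcal B=(x_j)_{j\in J}$ be an unconditional basis of $\mathbb X$. The support of $f=\sum_j a_jx_j$ is $\operatorname{supp}(f)=\{j\colon a_j\ne0\}$, and that of $f^*\in\mathbb X^*$ is $\operatorname{supp}(f^*)=\{j\colon f^*(x_j)\neq0\}$. A *well complemented block basic sequence* of $\mathcal B$ is a family $(u_i)_{i\in I}$ of nonzero vectors with pairwise disjoint finite supports for which there are $u_i^*\in\mathbb X^*$ with $u_i^*(u_k)=\delta_{i,k}$ and $\operatorname{supp}(u_i^*)\subseteq\operatorname{supp}(u_i)$ for all $i,k\in I$, and such that $\sum_{i\in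 I}u_i^*(f)\,u_i$ converges for every $f\in\mathbb X$. The basis $\mathcal B$ is *universal for well complemented block basic sequences* if it is semi-normalized and for every semi-normalized well complemented block basic sequence $(u_i)_{i\in I}$ of $\mathcal B$ there is a one-to-one map $\pi\colon I\to J$ such that $\pi(i)\in\operatorname{supp}(u_i)$ for all $i\in I$ and $(u_i)_{i\in I}$ is equivalent to $(x_{\pi(i)})_{i\in I}$. The lattice structure induced by $\mathcal B$ (the order being that of real coefficients) is *L-convex* if there is $0<\varepsilon<1$ such that $\max_{1\le i\le n}\Vert g_i\Vert\ge\varepsilon\Vert f\Vert$ whenever $n\ge1$, $0\le g_i\le f$ for $i=1,\dots,n$, and $\frac1n\sum_{i=1}^ng_i\ge(1-\varepsilon)f$. Finally, $\mathcal B^2$ denotes the basis of $\mathbb X\oplus\mathbb X$ formed by the vectors $(x_j,0)$ and $(0,x_j)$, $j\in J$. **Theorem.** Let $\mathbb X$ be a quasi-Banach space whose Banach envelope is anti-Euclidean. Suppose $\mathcal B=(x_j)_{j\in J}$ is an unconditional basis of $\mathbb X$ such that 1. the lattice structure induced by $\mathcal B$ in $\mathbb X$ is L-convex; 2. $\mathcal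 B$ is universal for well complemented block basic sequences; and 3. $\mathcal B\sim\mathcal B^2$. Then every semi-normalized complemented unconditional basic sequence of $\mathbb X$ is permutatively equivalent to a subbasis $(x_j)_{j\in A}$, $A\subseteq J$, of $\mathcal B$. -/

import Mathlib

open Topology

universe u v w

namespace QuasiBanach



/-- `X` is a quasi-Banach space: its topology is a complete vector topology
induced by the quasi-norm `‖·‖`. -/
class QuasiBanachSpace (𝕜 : Type v) (X : Type u) [RCLike 𝕜] [AddCommGroup X] [Module 𝕜 X]
    [UniformSpace X] [IsUniformAddGroup X] [ContinuousSMul 𝕜 X] [Norm X] : Prop where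
  norm_nonneg : ∀ x : X, 0 ≤ ‖x‖
  norm_eq_zero_iff : ∀ x : X, ‖x‖ = 0 ↔ x = 0
  norm_smul : ∀ (c : 𝕜) (x : X), ‖c • x‖ = ‖c‖ * ‖x‖
  quasi_triangle : ∃ κ : ℝ, 1 ≤ κ ∧ ∀ x y : X, ‖x + y‖ ≤ κ * (‖x‖ + ‖y‖)
  nhds_zero_basis : (𝓝 (0 : X)).HasBasis (fun ε : ℝ => 0 < ε) (fun ε => {x | ‖x‖ < ε})
  complete : CompleteSpace X

section Envelope

/-- The linear map `J : X → Y` into the Banach space `Y` is a Banach envelope of `X`: it is a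
contraction, and every linear contraction from `X` into a Banach space factors through `J` by a
unique linear contraction. (The explicit envelope, a completion of a quotient of `X`, lives in the
universe of `X`, so test spaces in that universe determine the envelope up to isometry.) -/
def IsBanachEnvelope {𝕜 : Type v} [RCLike 𝕜] {X Y : Type u} [AddCommGroup X] [Module 𝕜 X] [Norm X]
    [NormedAddCommGroup Y] [NormedSpace 𝕜 Y] [CompleteSpace Y] (J : X →ₗ[𝕜] Y) : Prop :=
  (∀ x, ‖J x‖ ≤ ‖x‖) ∧
  ∀ (Z : Type u) [NormedAddCommGroup Z] [NormedSpace 𝕜 Z] [CompleteSpace Z] (T : X →ₗ[𝕜] Z),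
    (∀ x, ‖T x‖ ≤ ‖x‖) →
      ∃! S : Y →ₗ[𝕜] Z, (∀ y, ‖S y‖ ≤ ‖y‖) ∧ S ∘ₗ J = T

/-- `ℓ₂` is crudely finitely representable in `Y` as a complemented subspace. -/
def SufficientlyEuclidean (𝕜 : Type v) (Y : Type u) [RCLike 𝕜] [NormedAddCommGroup Y]
    [NormedSpace 𝕜 Y] : Prop :=
  ∃ C : ℝ, 0 < C ∧ ∀ n : ℕ,
    ∃ (I : EuclideanSpace 𝕜 (Fin n) →L[𝕜] Y) (P : Y →L[𝕜] EuclideanSpace 𝕜 (Fin n)),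
      P ∘L I = ContinuousLinearMap.id 𝕜 (EuclideanSpace 𝕜 (Fin n)) ∧ ‖I‖ * ‖P‖ ≤ C

def AntiEuclidean (𝕜 : Type v) (Y : Type u) [RCLike 𝕜] [NormedAddCommGroup Y]
    [NormedSpace 𝕜 Y] : Prop :=
  ¬ SufficientlyEuclidean 𝕜 Y

end Envelope

section Sequences

variable (𝕜 : Type v) [RCLike 𝕜] {X : Type u} [AddCommGroup X] [Module 𝕜 X]
  [UniformSpace X] [IsUniformAddGroup X] [ContinuousSMul 𝕜 X]
  {Y : Type w} [AddCommGroup Y] [Module 𝕜 Y]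
  [UniformSpace Y] [IsUniformAddGroup Y] [ContinuousSMul 𝕜 Y]
  {J : Type*} {I : Type*}

/-- The closed linear span `[x_j : j ∈ J]`. -/
def closedSpan (x : J → X) : Submodule 𝕜 X :=
  (Submodule.span 𝕜 (Set.range x)).topologicalClosure

theorem mem_closedSpan (x : J → X) (j : J) : x j ∈ closedSpan 𝕜 x :=
  Submodule.le_topologicalClosure _ (Submodule.subset_span ⟨j, rfl⟩)

/-- Every vector of the closed span has a unique expansion as an unconditionally convergent series
(`HasSum` is unconditional convergence). -/
def IsUnconditionalBasicSeq (x : J → X) : Prop :=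
  ∀ f ∈ closedSpan 𝕜 x, ∃! a : J → 𝕜, HasSum (fun j => a j • x j) f

def IsUnconditionalBasis (x : J → X) : Prop :=
  IsUnconditionalBasicSeq 𝕜 x ∧ closedSpan 𝕜 x = ⊤

/-- `inf ‖x_j‖ > 0` and `sup ‖x_j‖ < ∞`. -/
def SemiNormalized [Norm X] (x : J → X) : Prop :=
  ∃ a b : ℝ, 0 < a ∧ ∀ j, a ≤ ‖x j‖ ∧ ‖x j‖ ≤ b

/-- The closed linear span is the range of a bounded linear projection. -/
def IsComplementedSeq (x : J → X) : Prop :=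
  (closedSpan 𝕜 x).ClosedComplemented

/-- Permutative equivalence, also written `x ∼ y`. -/
def PermutativelyEquivalent (x : J → X) (y : I → Y) : Prop :=
  ∃ (π : J ≃ I) (T : closedSpan 𝕜 x ≃L[𝕜] closedSpan 𝕜 y),
    ∀ j, (T ⟨x j, mem_closedSpan 𝕜 x j⟩ : Y) = y (π j)

/-- Equivalence of two families with the same index set. -/
def EquivalentSeq (x : J → X) (y : J → Y) : Prop :=
  ∃ T : closedSpan 𝕜 x ≃L[𝕜] closedSpan 𝕜 y,
    ∀ j, (T ⟨x j, mem_closedSpan 𝕜 x j⟩ : Y) = y j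

/-- The square of a family `x` in `X`, a family in `X × X`. -/
def squareSeq (x : J → X) : J ⊕ J → X × X :=
  Sum.elim (fun j => (x j, 0)) (fun j => (0, x j))

/-- The coefficients of `f` with respect to a basis `x` (the family `a` with `f = ∑ a_j x_j`). -/
noncomputable def basisCoeff (x : J → X) (f : X) : J → 𝕜 :=
  Classical.epsilon fun a : J → 𝕜 => HasSum (fun j => a j • x j) f

/-- The support of a vector with respect to a basis `x`. -/
def vecSupport (x : J → X) (f : X) : Set J :=
  {j | basisCoeff 𝕜 x f j ≠ 0}

variable {𝕜} in
/-- The support of a functional with respect to a basis `x`. -/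
def functionalSupport (x : J → X) (φ : X →L[𝕜] 𝕜) : Set J :=
  {j | φ (x j) ≠ 0}

/-- Block basic sequence with respect to `x`: pairwise disjoint finite supports, nonzero terms. -/
def IsBlockBasicSeq (x : J → X) (b : I → X) : Prop :=
  (∀ i, b i ≠ 0) ∧ (∀ i, (vecSupport 𝕜 x (b i)).Finite) ∧
  Pairwise fun i k => Disjoint (vecSupport 𝕜 x (b i)) (vecSupport 𝕜 x (b k))

variable {𝕜} in
/-- `φ` is a family of projecting functionals for `b`: it is biorthogonal to `b` and
`f ↦ ∑ φ_i(f) b_i` is well defined on `X`. -/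
def IsProjectingFunctionals (b : I → X) (φ : I → X →L[𝕜] 𝕜) : Prop :=
  (∀ i, φ i (b i) = 1) ∧ (Pairwise fun i k => φ i (b k) = 0) ∧
  ∀ f : X, Summable fun i => φ i f • b i

/-- The block basic sequence `b` of the basis `x` admits good projecting functionals. -/
def IsWellComplementedBlockBasicSeq (x : J → X) (b : I → X) : Prop :=
  IsBlockBasicSeq 𝕜 x b ∧
  ∃ φ : I → X →L[𝕜] 𝕜, IsProjectingFunctionals b φ ∧
    ∀ i, functionalSupport x (φ i) ⊆ vecSupport 𝕜 x (b i)

/-- `x` is a semi-normalized unconditional basis such that every semi-normalized well complemented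
block basic sequence of it is equivalent to a rearranged subbasis picked from the supports. -/
def IsUniversalForWellComplementedBlocks [Norm X] (x : J → X) : Prop :=
  IsUnconditionalBasis 𝕜 x ∧ SemiNormalized x ∧
  ∀ (I : Type) [Countable I] (b : I → X), SemiNormalized b →
    IsWellComplementedBlockBasicSeq 𝕜 x b →
      ∃ π : I → J, Function.Injective π ∧ (∀ i, π i ∈ vecSupport 𝕜 x (b i)) ∧
        EquivalentSeq 𝕜 b (fun i => x (π i))

/-- Kalton's L-convexity of the lattice structure induced by the unconditional basis `x`, in which
order is the order of (real) coefficients: for some `0 < ε < 1`, whenever `0 ≤ g_i ≤ f` for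
`1 ≤ i ≤ n` and `(g_1 + ⋯ + g_n) / n ≥ (1 - ε) f`, then `max ‖g_i‖ ≥ ε ‖f‖`. Replacing `‖·‖` by an
equivalent quasi-norm, such as the lattice quasi-norm for which `x` is `1`-unconditional, only
changes the value of `ε`. -/
def IsLConvexBasis [Norm X] (x : J → X) : Prop :=
  ∃ ε : ℝ, 0 < ε ∧ ε < 1 ∧
    ∀ (n : ℕ), 0 < n → ∀ (f : X) (g : Fin n → X) (a : J → ℝ) (b : Fin n → J → ℝ),
      HasSum (fun j => (a j : 𝕜) • x j) f →
      (∀ i, HasSum (fun j => (b i j : 𝕜) • x j) (g i)) →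
      (∀ i j, 0 ≤ b i j ∧ b i j ≤ a j) →
      (∀ j, (1 - ε) * a j ≤ (∑ i, b i j) / (n : ℝ)) →
        ∃ i, ε * ‖f‖ ≤ ‖g i‖

end Sequences

end QuasiBanach

/-!
Write `u` for the complemented sequence, `φ` for its coordinate functionals composed with the
projection, and `e` for the coordinate functionals of the basis `x`. The numbers
`w i j = |e j (u i)| |φ i (x j)|` have row sums between `1` and a constant, since
`φ i (u i) = 1` and both systems are unconditional. Three ideas turn them into a subbasis.

*The rows of `w` can be kept apart.* If `∑ j, max i, p i * w i j` could be arbitrarily small for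
probabilities `p`, the Banach envelope would contain uniformly complemented copies of `ℓ₂ⁿ`
(`IsBanachEnvelope.exists_euclidean_factor`). Indeed, Lozanovskii factorization writes `p = α β`
with `∑ α i u i` in the unit ball of the envelope and `∑ ± β i φ i` in a multiple of the dual
ball (`exists_lozanovskii`). For random sign vectors `r i ∈ {±1}ⁿ` the maps
`ξ ↦ ∑ α i ⟨r i, ξ⟩ u i` and `f ↦ ∑ β i φ i (f) r i` are bounded because, column by column,
their square functions are those of `∑ α i u i` and `∑ β i φ i` up to a constant
(`exists_random_signs`, where smallness of the maxima makes every column a sum of many small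
terms), and their composition is `∑ p i (r i) (r i)ᵀ`, which is close to the identity. As the
envelope is anti-Euclidean, the maxima carry a fixed part of every weight
(`IsBanachEnvelope.exists_column_bound`). By linear programming duality and rounding there are
finite sets `A i` of bounded multiplicity with `∑ j ∈ A i, w i j` bounded below
(`exists_coloring`).

*L-convexity replaces local convexity.* A vector of an L-convex lattice is controlled by any family
of vectors of bounded norm that dominates each of its coordinates for a fixed proportion of indices
(`exists_lconvex_const`). Since polynomials of degree at most two in random signs exceed a fixed
multiple of their `L₂` norm with fixed probability (`exists_quad_large`), two averaging arguments
that are immediate in Banach lattices survive. One may select at each coordinate `j` a single term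
of `∑ a i u i` (`exists_selection_bound`), and one may pass to the diagonal of an operator
`f ↦ ∑ φ i (f) u i` (`exists_diagonal_bound`).

*The overlaps of the sets `A i` are resolved in copies of the basis.* The basis is equivalent to its
square, so it contains disjoint copies `x ∘ σ k` of itself (`exists_copies`). Colouring the sets
`A i` with finitely many colours `k i j` that separate overlaps gives disjoint blocks
`v i = ∑ j ∈ A i, e j (u i) x (σ (k i j) j)`. The selection bound shows that `u` dominates `v`,
and the diagonal bound that `v` dominates `u` and has projecting functionals
(`exists_equivalent_blocks`). Universality turns `v` into a subbasis of `x`.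

As quasi-norms admit no Hahn–Banach theorem, functionals on `X` come only from the two unconditional
systems, whose continuity rests on a Baire category argument (`exists_gauge_bound`,
`exists_coordinates`).
-/


namespace QuasiBanach

/-! ### Quasi-norms -/

section QuasiNorm

open Filter

variable (𝕜 : Type v) [RCLike 𝕜] {X : Type u} [AddCommGroup X] [Module 𝕜 X]
  [UniformSpace X] [IsUniformAddGroup X] [ContinuousSMul 𝕜 X] [Norm X]
  [QuasiBanachSpace 𝕜 X]

variable (X) in
/-- A constant `κ ≥ 1` in the quasi-triangle inequality of `X`. -/
noncomputable def quasiConst : ℝ :=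
  Classical.choose (QuasiBanachSpace.quasi_triangle (𝕜 := 𝕜) (X := X))

variable (X) in
theorem one_le_quasiConst : 1 ≤ quasiConst 𝕜 X :=
  (Classical.choose_spec (QuasiBanachSpace.quasi_triangle (𝕜 := 𝕜) (X := X))).1

variable (X) in
theorem quasiConst_pos : 0 < quasiConst 𝕜 X :=
  lt_of_lt_of_le one_pos (one_le_quasiConst 𝕜 X)

theorem qnorm_add_le (x y : X) : ‖x + y‖ ≤ quasiConst 𝕜 X * (‖x‖ + ‖y‖) :=
  (Classical.choose_spec (QuasiBanachSpace.quasi_triangle (𝕜 := 𝕜) (X := X))).2 x y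

include 𝕜

theorem qnorm_nonneg (x : X) : 0 ≤ ‖x‖ := QuasiBanachSpace.norm_nonneg 𝕜 x

theorem qnorm_zero : ‖(0 : X)‖ = 0 := (QuasiBanachSpace.norm_eq_zero_iff 𝕜 (0 : X)).2 rfl

theorem qnorm_pos {x : X} (h : x ≠ 0) : 0 < ‖x‖ :=
  lt_of_le_of_ne (qnorm_nonneg 𝕜 x) fun h' =>
    h ((QuasiBanachSpace.norm_eq_zero_iff 𝕜 x).1 h'.symm)

theorem qnorm_smul (c : 𝕜) (x : X) : ‖c • x‖ = ‖c‖ * ‖x‖ := QuasiBanachSpace.norm_smul c x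

theorem qnorm_neg (x : X) : ‖-x‖ = ‖x‖ := by
  have := qnorm_smul 𝕜 (-1 : 𝕜) x
  simpa using this

theorem qnorm_sub_le (x y : X) : ‖x - y‖ ≤ quasiConst 𝕜 X * (‖x‖ + ‖y‖) := by
  have := qnorm_add_le 𝕜 x (-y)
  rwa [qnorm_neg 𝕜, ← sub_eq_add_neg] at this

theorem qnorm_sub_comm (x y : X) : ‖x - y‖ = ‖y - x‖ := by
  rw [← qnorm_neg 𝕜 (x - y), neg_sub]

theorem qnorm_sum_le {ι : Type*} (s : Finset ι) (f : ι → X) :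
    ‖∑ i ∈ s, f i‖ ≤ quasiConst 𝕜 X ^ s.card * ∑ i ∈ s, ‖f i‖ := by
  classical
  have h1 := one_le_quasiConst 𝕜 X
  induction s using Finset.induction_on with
  | empty => simp [qnorm_zero 𝕜]
  | insert a s ha ih =>
    rw [Finset.sum_insert ha, Finset.sum_insert ha, Finset.card_insert_of_notMem ha]
    have h2 : (1 : ℝ) ≤ quasiConst 𝕜 X ^ s.card := one_le_pow₀ h1
    calc ‖f a + ∑ i ∈ s, f i‖ ≤ quasiConst 𝕜 X * (‖f a‖ + ‖∑ i ∈ s, f i‖) := qnorm_add_le 𝕜 _ _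
      _ ≤ quasiConst 𝕜 X * (quasiConst 𝕜 X ^ s.card * ‖f a‖
            + quasiConst 𝕜 X ^ s.card * ∑ i ∈ s, ‖f i‖) := by
          have := qnorm_nonneg 𝕜 (f a)
          gcongr
          nlinarith
      _ = _ := by ring

/-- A sum of `n` terms with norms at most `C`. -/
theorem qnorm_sum_le_of_le {ι : Type*} (s : Finset ι) (f : ι → X) {C : ℝ}
    (h : ∀ i ∈ s, ‖f i‖ ≤ C) :
    ‖∑ i ∈ s, f i‖ ≤ quasiConst 𝕜 X ^ s.card * (s.card * C) := by
  refine (qnorm_sum_le 𝕜 s f).trans ?_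
  have h1 := quasiConst_pos 𝕜 X
  gcongr
  simpa using Finset.sum_le_sum h

/-- Partial sums of a series whose terms decay like `(2κ)⁻ᵏ`. -/
theorem qnorm_sum_range_le (f : ℕ → X) {C : ℝ} (m : ℕ)
    (h : ∀ k, ‖f k‖ ≤ C * (2 * quasiConst 𝕜 X)⁻¹ ^ (m + k)) (n : ℕ) :
    ‖∑ k ∈ Finset.range n, f k‖ ≤ 2 * C * quasiConst 𝕜 X * (2 * quasiConst 𝕜 X)⁻¹ ^ m := by
  have h1 := one_le_quasiConst 𝕜 X
  have h0 := quasiConst_pos 𝕜 X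
  have hC : 0 ≤ C := by
    have := (qnorm_nonneg 𝕜 _).trans (h 0)
    exact nonneg_of_mul_nonneg_left this (by positivity)
  induction n generalizing f m with
  | zero => simp only [Finset.range_zero, Finset.sum_empty, qnorm_zero 𝕜]; positivity
  | succ n ih =>
    rw [Finset.sum_range_succ', add_comm]
    have ih' := ih (fun k => f (k + 1)) (m + 1) (fun k => by
      have := h (k + 1)
      rwa [show m + (k + 1) = m + 1 + k by ring] at this)
    have h3 := h 0
    rw [add_zero] at h3
    calc _ ≤ quasiConst 𝕜 X * (‖f 0‖ + ‖∑ k ∈ Finset.range n, f (k + 1)‖) := qnorm_add_le 𝕜 _ _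
      _ ≤ quasiConst 𝕜 X * (C * (2 * quasiConst 𝕜 X)⁻¹ ^ m
          + 2 * C * quasiConst 𝕜 X * (2 * quasiConst 𝕜 X)⁻¹ ^ (m + 1)) := by gcongr
      _ = _ := by rw [pow_succ]; field_simp; ring

theorem eventually_qnorm_sub_lt {ι : Type*} {l : Filter ι} {F : ι → X} {f : X}
    (h : Tendsto F l (𝓝 f)) {ε : ℝ} (hε : 0 < ε) : ∀ᶠ i in l, ‖F i - f‖ < ε := by
  have h1 : Tendsto (fun i => F i - f) l (𝓝 0) := by
    simpa using h.sub_const f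
  exact h1.eventually ((QuasiBanachSpace.nhds_zero_basis (𝕜 := 𝕜) (X := X)).mem_of_mem hε)

theorem tendsto_of_qnorm_sub {ι : Type*} {l : Filter ι} {F : ι → X} {f : X}
    (h : ∀ ε > 0, ∀ᶠ i in l, ‖F i - f‖ < ε) : Tendsto F l (𝓝 f) := by
  have h1 : Tendsto (fun i => F i - f) l (𝓝 0) :=
    (QuasiBanachSpace.nhds_zero_basis (𝕜 := 𝕜) (X := X)).tendsto_right_iff.2 fun ε hε => h ε hε
  simpa using h1.add_const f

/-- The quasi-norm need not be continuous, so a bound passes to a limit up to the factor `κ`. -/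
theorem qnorm_le_of_tendsto {ι : Type*} {l : Filter ι} [l.NeBot] {F : ι → X} {f : X} {C : ℝ}
    (h : Tendsto F l (𝓝 f)) (hC : ∀ᶠ i in l, ‖F i‖ ≤ C) : ‖f‖ ≤ quasiConst 𝕜 X * C := by
  have h0 := quasiConst_pos 𝕜 X
  refine le_of_forall_pos_le_add fun ε hε => ?_
  obtain ⟨i, hi1, hi2⟩ :=
    ((eventually_qnorm_sub_lt 𝕜 h (ε := ε / quasiConst 𝕜 X) (by positivity)).and hC).exists
  have h3 := qnorm_sub_le 𝕜 (F i) (F i - f)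
  rw [sub_sub_cancel] at h3
  calc ‖f‖ ≤ quasiConst 𝕜 X * (C + ε / quasiConst 𝕜 X) := h3.trans (by gcongr)
    _ = _ := by field_simp

theorem t2Space : T2Space X := by
  have : T1Space X := by
    refine ⟨fun x => ?_⟩
    rw [← isOpen_compl_iff, isOpen_iff_mem_nhds]
    intro y hy
    have hp : 0 < ‖y - x‖ := qnorm_pos 𝕜 (sub_ne_zero.2 hy)
    have h1 : Tendsto (fun z : X => y - z) (𝓝 y) (𝓝 0) := by
      simpa using (tendsto_const_nhds (x := y)).sub (tendsto_id (x := 𝓝 y))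
    have h2 : ∀ᶠ z in 𝓝 y, ‖y - z‖ < ‖y - x‖ :=
      h1.eventually ((QuasiBanachSpace.nhds_zero_basis (𝕜 := 𝕜) (X := X)).mem_of_mem hp)
    filter_upwards [h2] with z hz hzx
    rw [Set.mem_singleton_iff.1 hzx] at hz
    exact lt_irrefl _ hz
  infer_instance

theorem baireSpace : BaireSpace X := by
  have hb := QuasiBanachSpace.nhds_zero_basis (𝕜 := 𝕜) (X := X)
  have : CompleteSpace X := QuasiBanachSpace.complete 𝕜
  have h1 : (𝓝 (0 : X)).IsCountablyGenerated := by
    have h2 : (𝓝 (0 : X)).HasBasis (fun _ : ℕ => True)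
        (fun n => {x | ‖x‖ < 1 / ((n : ℝ) + 1)}) := by
      refine hb.to_hasBasis (fun ε hε => ?_)
        (fun n _ => ⟨1 / ((n : ℝ) + 1), by positivity, subset_rfl⟩)
      obtain ⟨n, hn⟩ := exists_nat_one_div_lt hε
      exact ⟨n, trivial, fun x hx => lt_trans hx hn⟩
    exact h2.isCountablyGenerated
  have : (uniformity X).IsCountablyGenerated := IsUniformAddGroup.uniformity_countably_generated
  infer_instance

/-- The uniform boundedness principle, in a form that also covers families `q` that are not known
to be continuous. The hypothesis `hσ` replaces continuity: a series dominated by `(2κ)⁻ᵏ` in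
all the gauges `q i` and convergent in `X` has a sum bounded in all of them. -/
theorem exists_gauge_bound {ι : Type*} (q : ι → X → ℝ)
    (hadd : ∀ i f g, q i (f + g) ≤ quasiConst 𝕜 X * (q i f + q i g))
    (hsmul : ∀ i (c : 𝕜) f, q i (c • f) = ‖c‖ * q i f)
    (hfin : ∀ f, ∃ M, ∀ i, q i f ≤ M) {C : ℝ}
    (hσ : ∀ (f : ℕ → X) (g : X), (∀ k i, q i (f k) ≤ (2 * quasiConst 𝕜 X)⁻¹ ^ k) →
      Tendsto (fun n => ∑ k ∈ Finset.range n, f k) atTop (𝓝 g) → ∀ i, q i g ≤ C) :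
    ∃ M, 0 < M ∧ ∀ f i, q i f ≤ M * ‖f‖ := by
  have h1 := one_le_quasiConst 𝕜 X
  have h0 := quasiConst_pos 𝕜 X
  set ρ := (2 * quasiConst 𝕜 X)⁻¹ with hρ
  have hρ0 : 0 < ρ := by positivity
  have hρ1 : ρ < 1 := inv_lt_one_of_one_lt₀ (by linarith)
  have := baireSpace 𝕜 (X := X)
  let S : ℝ → Set X := fun t => {f | ∀ i, q i f ≤ t}
  have hSsmul : ∀ (t s : ℝ) (f : X), 0 < s → f ∈ closure (S t) →
      ((s : 𝕜) • f) ∈ closure (S (s * t)) := by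
    intro t s f hs hf
    refine map_mem_closure (continuous_const_smul (s : 𝕜)) hf fun g hg i => ?_
    rw [hsmul, RCLike.norm_ofReal, abs_of_pos hs]
    have := hg i
    gcongr
  obtain ⟨n, x0, hx0⟩ := nonempty_interior_of_iUnion_of_closed
    (f := fun n : ℕ => closure (S n)) (fun _ => isClosed_closure) (by
      refine Set.eq_univ_of_forall fun f => ?_
      obtain ⟨M, hM⟩ := hfin f
      obtain ⟨n, hn⟩ := exists_nat_ge M
      exact Set.mem_iUnion.2 ⟨n, subset_closure fun i => (hM i).trans hn⟩)
  -- the closure of some `S m` is a neighbourhood of zero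
  have hball : ∃ ε > 0, ∃ m > 0, ∀ y : X, ‖y‖ < ε → y ∈ closure (S m) := by
    have hn : (fun y => x0 + y) ⁻¹' (closure (S n)) ∈ 𝓝 (0 : X) := by
      refine (continuous_const_add x0).continuousAt.preimage_mem_nhds ?_
      rw [add_zero]
      exact mem_interior_iff_mem_nhds.1 hx0
    obtain ⟨ε, hε, hsub⟩ := (QuasiBanachSpace.nhds_zero_basis (𝕜 := 𝕜) (X := X)).mem_iff.1 hn
    refine ⟨ε, hε, quasiConst 𝕜 X * (n + n) + 1, by positivity, fun y hy => ?_⟩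
    have hy1 : x0 + y ∈ closure (S n) := hsub hy
    have hy2 : x0 ∈ closure (S n) := interior_subset hx0
    have := map_mem_closure₂ continuous_sub hy1 hy2
      (u := S (quasiConst 𝕜 X * (n + n) + 1)) (fun a ha b hb i => by
        have e1 := hadd i a (-b)
        have e2 : q i (-b) = q i b := by simpa using hsmul i (-1) b
        rw [← sub_eq_add_neg, e2] at e1
        have e3 := ha i
        have e4 := hb i
        calc q i (a - b) ≤ quasiConst 𝕜 X * (q i a + q i b) := e1
          _ ≤ quasiConst 𝕜 X * (n + n) := by gcongr
          _ ≤ _ := by linarith)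
    simpa using this
  obtain ⟨ε, hε, m, hm, hball⟩ := hball
  -- successive approximation, each error being smaller by the factor `ρ`
  have hstep : ∀ (k : ℕ) (y : X), ‖y‖ < ε * ρ ^ k →
      ∃ f, (∀ i, q i f ≤ m * ρ ^ k) ∧ ‖y - f‖ < ε * ρ ^ (k + 1) := by
    intro k y hy
    have hk : 0 < ρ ^ k := by positivity
    have h2 : (((ρ ^ k)⁻¹ : ℝ) : 𝕜) • y ∈ closure (S m) := by
      refine hball _ ?_
      rw [qnorm_smul 𝕜, RCLike.norm_ofReal, abs_of_pos (by positivity), inv_mul_lt_iff₀ hk,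
        mul_comm]
      exact hy
    have h3 := hSsmul m (ρ ^ k) _ hk h2
    rw [smul_smul, ← RCLike.ofReal_mul, mul_inv_cancel₀ hk.ne', RCLike.ofReal_one, one_smul] at h3
    have h4 : {z | ‖y - z‖ < ε * ρ ^ (k + 1)} ∈ 𝓝 y := by
      have h5 : Tendsto (fun z : X => y - z) (𝓝 y) (𝓝 0) := by
        simpa using (tendsto_const_nhds (x := y)).sub (tendsto_id (x := 𝓝 y))
      exact h5.eventually ((QuasiBanachSpace.nhds_zero_basis (𝕜 := 𝕜) (X := X)).mem_of_mem
        (by positivity))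
    obtain ⟨f, hf1, hf2⟩ := mem_closure_iff_nhds.1 h3 _ h4
    exact ⟨f, fun i => by simpa [mul_comm] using hf2 i, hf1⟩
  choose! G hG1 hG2 using hstep
  -- every vector of the ball is the sum of a series to which `hσ` applies after scaling
  have key : ∀ y : X, ‖y‖ < ε → ∀ i, q i y ≤ m * C := by
    intro y hy
    let r : ℕ → X := fun k => Nat.rec y (fun k z => z - G k z) k
    have hr : ∀ k, ‖r k‖ < ε * ρ ^ k := by
      intro k
      induction k with
      | zero => simpa [r] using hy
      | succ k ih => exact hG2 k (r k) ih
    have hsum : ∀ n, ∑ k ∈ Finset.range n, G k (r k) = y - r n := by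
      intro n
      induction n with
      | zero => simp [r]
      | succ n ih =>
        rw [Finset.sum_range_succ, ih]
        change _ = y - (r n - G n (r n))
        abel
    have hlim : Tendsto (fun n => ∑ k ∈ Finset.range n, G k (r k)) atTop (𝓝 y) := by
      refine tendsto_of_qnorm_sub 𝕜 fun δ hδ => ?_
      have h6 : Tendsto (fun k : ℕ => ε * ρ ^ k) atTop (𝓝 0) := by
        simpa using (tendsto_pow_atTop_nhds_zero_of_lt_one hρ0.le hρ1).const_mul ε
      filter_upwards [h6.eventually (gt_mem_nhds hδ)] with k hk
      rw [hsum, sub_sub_cancel_left, qnorm_neg 𝕜]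
      exact (hr k).trans hk
    have hlim2 : Tendsto (fun n => ∑ k ∈ Finset.range n, ((m⁻¹ : ℝ) : 𝕜) • G k (r k)) atTop
        (𝓝 (((m⁻¹ : ℝ) : 𝕜) • y)) := by
      simpa [Finset.smul_sum] using hlim.const_smul ((m⁻¹ : ℝ) : 𝕜)
    intro i
    have h7 := hσ _ _ (fun k i => by
      rw [hsmul, RCLike.norm_ofReal, abs_of_pos (by positivity), inv_mul_le_iff₀ hm]
      exact hG1 k (r k) (hr k) i) hlim2 i
    rw [hsmul, RCLike.norm_ofReal, abs_of_pos (by positivity), inv_mul_le_iff₀ hm] at h7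
    exact h7
  refine ⟨2 * m * |C| / ε + 1, by positivity, fun f i => ?_⟩
  by_cases hf : f = 0
  · subst hf
    have := hsmul i (0 : 𝕜) 0
    simp only [smul_zero, norm_zero, zero_mul] at this
    rw [this, qnorm_zero 𝕜, mul_zero]
  have hfp := qnorm_pos 𝕜 hf
  have h8 := key ((((ε / (2 * ‖f‖)) : ℝ) : 𝕜) • f) (by
    rw [qnorm_smul 𝕜, RCLike.norm_ofReal, abs_of_pos (by positivity)]
    rw [show ε / (2 * ‖f‖) * ‖f‖ = ε / 2 by field_simp]
    linarith) i
  rw [hsmul, RCLike.norm_ofReal, abs_of_pos (by positivity), div_mul_eq_mul_div,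
    div_le_iff₀ (by positivity)] at h8
  have h9 : ε * q i f ≤ ε * (2 * m * |C| / ε * ‖f‖) := by
    rw [show ε * (2 * m * |C| / ε * ‖f‖) = m * |C| * (2 * ‖f‖) by field_simp]
    refine h8.trans ?_
    have := le_abs_self C
    gcongr
  have h10 := le_of_mul_le_mul_left h9 hε
  linarith

/-- A continuous linear map is bounded for the quasi-norms. -/
theorem exists_bound_of_continuous {Y : Type w} [AddCommGroup Y] [Module 𝕜 Y]
    [TopologicalSpace Y] (T : X →L[𝕜] Y) (q : Y → ℝ) (hq : ∀ (c : 𝕜) y, q (c • y) = ‖c‖ * q y)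
    (hq0 : {y | q y < 1} ∈ 𝓝 (0 : Y)) : ∃ M, 0 < M ∧ ∀ f, q (T f) ≤ M * ‖f‖ := by
  have h1 : T ⁻¹' {y | q y < 1} ∈ 𝓝 (0 : X) := by
    refine T.continuous.continuousAt.preimage_mem_nhds ?_
    rwa [map_zero]
  obtain ⟨ε, hε, hsub⟩ := (QuasiBanachSpace.nhds_zero_basis (𝕜 := 𝕜) (X := X)).mem_iff.1 h1
  refine ⟨2 / ε, by positivity, fun f => ?_⟩
  by_cases hf : f = 0
  · subst hf
    have := hq (0 : 𝕜) 0
    simp only [smul_zero, norm_zero, zero_mul] at this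
    rw [map_zero, this, qnorm_zero 𝕜, mul_zero]
  have hfp := qnorm_pos 𝕜 hf
  have h2 : (((ε / (2 * ‖f‖)) : ℝ) : 𝕜) • f ∈ T ⁻¹' {y | q y < 1} := hsub (by
    change ‖_‖ < _
    rw [qnorm_smul 𝕜, RCLike.norm_ofReal, abs_of_pos (by positivity)]
    rw [show ε / (2 * ‖f‖) * ‖f‖ = ε / 2 by field_simp]
    linarith)
  simp only [Set.mem_preimage, map_smul, Set.mem_ofPred_eq] at h2
  rw [hq, RCLike.norm_ofReal, abs_of_pos (by positivity), div_mul_eq_mul_div,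
    div_lt_iff₀ (by positivity)] at h2
  rw [div_mul_eq_mul_div, le_div_iff₀ hε]
  linarith

theorem exists_bound_endo (T : X →L[𝕜] X) : ∃ M, 0 < M ∧ ∀ f, ‖T f‖ ≤ M * ‖f‖ :=
  exists_bound_of_continuous 𝕜 T (fun y => ‖y‖) (qnorm_smul 𝕜)
    ((QuasiBanachSpace.nhds_zero_basis (𝕜 := 𝕜) (X := X)).mem_of_mem one_pos)

theorem exists_bound_functional (T : X →L[𝕜] 𝕜) : ∃ M, 0 < M ∧ ∀ f, ‖T f‖ ≤ M * ‖f‖ :=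
  exists_bound_of_continuous 𝕜 T (fun y => ‖y‖) norm_smul
    (by simpa [Metric.ball, dist_zero_right] using Metric.ball_mem_nhds (0 : 𝕜) one_pos)

theorem continuous_of_qbound {Y : Type w} [AddCommGroup Y] [Module 𝕜 Y]
    [UniformSpace Y] [IsUniformAddGroup Y] [ContinuousSMul 𝕜 Y] [Norm Y] [QuasiBanachSpace 𝕜 Y]
    (T : X →ₗ[𝕜] Y) (M : ℝ) (h : ∀ f, ‖T f‖ ≤ M * ‖f‖) : Continuous T := by
  refine continuous_of_continuousAt_zero T.toAddMonoidHom ?_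
  change Tendsto T (𝓝 0) (𝓝 (T 0))
  rw [map_zero]
  refine (QuasiBanachSpace.nhds_zero_basis (𝕜 := 𝕜) (X := Y)).tendsto_right_iff.2 fun ε hε => ?_
  have h1 : {x : X | ‖x‖ < ε / (|M| + 1)} ∈ 𝓝 (0 : X) :=
    (QuasiBanachSpace.nhds_zero_basis (𝕜 := 𝕜) (X := X)).mem_of_mem (by positivity)
  filter_upwards [h1] with x hx
  have h2 : ‖x‖ < ε / (|M| + 1) := hx
  rw [lt_div_iff₀ (by positivity)] at h2
  have h3 := qnorm_nonneg 𝕜 x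
  have h4 := le_abs_self M
  calc ‖T x‖ ≤ M * ‖x‖ := h x
    _ ≤ ‖x‖ * (|M| + 1) := by nlinarith
    _ < ε := h2

theorem continuous_functional_of_qbound (T : X →ₗ[𝕜] 𝕜) (M : ℝ) (h : ∀ f, ‖T f‖ ≤ M * ‖f‖) :
    Continuous T := by
  refine continuous_of_continuousAt_zero T.toAddMonoidHom ?_
  change Tendsto T (𝓝 0) (𝓝 (T 0))
  rw [map_zero]
  refine Metric.nhds_basis_ball.tendsto_right_iff.2 fun ε hε => ?_
  have h1 : {x : X | ‖x‖ < ε / (|M| + 1)} ∈ 𝓝 (0 : X) :=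
    (QuasiBanachSpace.nhds_zero_basis (𝕜 := 𝕜) (X := X)).mem_of_mem (by positivity)
  filter_upwards [h1] with x hx
  have h2 : ‖x‖ < ε / (|M| + 1) := hx
  rw [lt_div_iff₀ (by positivity)] at h2
  have h3 := qnorm_nonneg 𝕜 x
  have h4 := le_abs_self M
  rw [mem_ball_zero_iff]
  calc ‖T x‖ ≤ M * ‖x‖ := h x
    _ ≤ ‖x‖ * (|M| + 1) := by nlinarith
    _ < ε := h2

end QuasiNorm

/-! ### Coordinate functionals and multipliers -/

section Coordinates

open Filter

variable (𝕜 : Type v) [RCLike 𝕜] {X : Type u} [AddCommGroup X] [Module 𝕜 X]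
  [UniformSpace X] [IsUniformAddGroup X] [ContinuousSMul 𝕜 X] [Norm X]
  [QuasiBanachSpace 𝕜 X]

variable (X) in
/-- Multipliers with values in `[0, 1]` are controlled by subset sums. Rounding the multiplier to
multiples of `1 / B` with `B ≥ 2κ` leaves an error that the supremum over all multipliers
absorbs; convexity is not available. -/
theorem exists_real_multiplier_bound : ∃ C : ℝ, 1 ≤ C ∧ ∀ {ι : Type w} (F : Finset ι) (y : ι → X)
    (s : ℝ), (∀ A ⊆ F, ‖∑ i ∈ A, y i‖ ≤ s) → ∀ c : ι → ℝ, (∀ i, 0 ≤ c i ∧ c i ≤ 1) →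
      ‖∑ i ∈ F, (c i : 𝕜) • y i‖ ≤ C * s := by
  classical
  have h1 := one_le_quasiConst 𝕜 X
  have h0 := quasiConst_pos 𝕜 X
  set κ := quasiConst 𝕜 X with hκ
  obtain ⟨B, hB⟩ := exists_nat_ge (2 * κ)
  have hBpos : (0 : ℝ) < B := by linarith
  refine ⟨2 * κ ^ (B + 1), ?_, fun {ι} F y s hs c hc => ?_⟩
  · have : (1 : ℝ) ≤ κ ^ (B + 1) := one_le_pow₀ h1
    linarith
  let S : Set ℝ := {t | ∃ c : ι → ℝ, (∀ i, 0 ≤ c i ∧ c i ≤ 1) ∧ t = ‖∑ i ∈ F, (c i : 𝕜) • y i‖}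
  have hSb : BddAbove S := by
    refine ⟨κ ^ F.card * ∑ i ∈ F, ‖y i‖, ?_⟩
    rintro t ⟨c, hc, rfl⟩
    refine (qnorm_sum_le 𝕜 _ _).trans ?_
    gcongr with i hi
    rw [qnorm_smul 𝕜, RCLike.norm_ofReal, abs_of_nonneg (hc i).1]
    exact mul_le_of_le_one_left (qnorm_nonneg 𝕜 _) (hc i).2
  -- `B • c = ∑ t < B, 1_{t < d i} + c'`, with subset sums on the left and a multiplier `c'` again
  have hstep : ∀ t ∈ S, t ≤ κ ^ (B + 1) * s + sSup S / 2 := by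
    rintro t ⟨c, hc, rfl⟩
    let d : ι → ℕ := fun i => ⌊B * c i⌋₊
    let c' : ι → ℝ := fun i => B * c i - d i
    have hc' : ∀ i, 0 ≤ c' i ∧ c' i ≤ 1 := fun i => by
      have h2 : 0 ≤ B * c i := mul_nonneg hBpos.le (hc i).1
      have := Nat.floor_le h2
      have := Nat.lt_floor_add_one (B * c i)
      exact ⟨by simp only [c', d]; linarith, by simp only [c', d]; linarith⟩
    have hd : ∀ i, d i ≤ B := fun i => by
      refine Nat.floor_le_of_le ?_
      exact mul_le_of_le_one_right hBpos.le (hc i).2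
    have hdsum : ∀ i, (d i : 𝕜) = ∑ t ∈ Finset.range B, if t < d i then (1 : 𝕜) else 0 := by
      intro i
      rw [Finset.sum_ite, Finset.sum_const_zero, add_zero, Finset.sum_const, nsmul_eq_mul, mul_one]
      have : (Finset.range B).filter (fun t => t < d i) = Finset.range (d i) := by
        ext t
        have := hd i
        simp only [Finset.mem_filter, Finset.mem_range]
        omega
      rw [this, Finset.card_range]
    have hdec : ∑ i ∈ F, (c i : 𝕜) • y i = (((B : ℝ)⁻¹ : ℝ) : 𝕜) •
        ((∑ t ∈ Finset.range B, ∑ i ∈ F with t < d i, y i) + ∑ i ∈ F, (c' i : 𝕜) • y i) := by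
      have e1 : ∑ t ∈ Finset.range B, ∑ i ∈ F with t < d i, y i = ∑ i ∈ F, (d i : 𝕜) • y i := by
        simp_rw [Finset.sum_filter]
        rw [Finset.sum_comm]
        refine Finset.sum_congr rfl fun i _ => ?_
        rw [hdsum, Finset.sum_smul]
        refine Finset.sum_congr rfl fun t _ => ?_
        split_ifs <;> simp
      rw [e1, ← Finset.sum_add_distrib, Finset.smul_sum]
      refine Finset.sum_congr rfl fun i _ => ?_
      rw [← add_smul, smul_smul]
      congr 1
      have : (c i : ℝ) = (B : ℝ)⁻¹ * (d i + c' i) := by simp only [c']; field_simp; ring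
      rw [this]; push_cast; ring
    rw [hdec, qnorm_smul 𝕜, RCLike.norm_ofReal, abs_of_pos (by positivity), inv_mul_le_iff₀ hBpos]
    have e2 : ‖∑ t ∈ Finset.range B, ∑ i ∈ F with t < d i, y i‖ ≤ κ ^ B * (B * s) := by
      have := qnorm_sum_le_of_le 𝕜 (Finset.range B) (fun t => ∑ i ∈ F with t < d i, y i) (C := s)
        (fun t _ => hs _ (Finset.filter_subset _ _))
      simpa using this
    have e3 : ‖∑ i ∈ F, (c' i : 𝕜) • y i‖ ≤ sSup S := le_csSup hSb ⟨c', hc', rfl⟩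
    have e4 : 0 ≤ sSup S := (qnorm_nonneg 𝕜 _).trans e3
    calc _ ≤ κ * (_ + _) := qnorm_add_le 𝕜 _ _
      _ ≤ κ * (κ ^ B * (B * s) + sSup S) := by gcongr
      _ = B * (κ ^ (B + 1) * s) + (2 * κ) * (sSup S / 2) := by ring
      _ ≤ B * (κ ^ (B + 1) * s) + B * (sSup S / 2) := by gcongr
      _ = _ := by ring
  have hne : S.Nonempty := ⟨_, c, hc, rfl⟩
  have h5 := csSup_le hne hstep
  have h6 : ‖∑ i ∈ F, (c i : 𝕜) • y i‖ ≤ sSup S := le_csSup hSb ⟨c, hc, rfl⟩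
  linarith

variable (X) in
theorem exists_multiplier_bound : ∃ C : ℝ, 1 ≤ C ∧ ∀ {ι : Type w} (F : Finset ι) (y : ι → X)
    (s : ℝ), (∀ A ⊆ F, ‖∑ i ∈ A, y i‖ ≤ s) → ∀ c : ι → 𝕜, (∀ i, ‖c i‖ ≤ 1) →
      ‖∑ i ∈ F, c i • y i‖ ≤ C * s := by
  obtain ⟨C, hC, h⟩ := exists_real_multiplier_bound.{u, v, w} 𝕜 X
  have h1 := one_le_quasiConst 𝕜 X
  have h0 := quasiConst_pos 𝕜 X
  refine ⟨4 * quasiConst 𝕜 X ^ 2 * C, ?_, fun {ι} F y s hs c hc => ?_⟩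
  · have : (1 : ℝ) ≤ quasiConst 𝕜 X ^ 2 := one_le_pow₀ h1
    nlinarith
  have hre : ∀ i, |RCLike.re (c i)| ≤ 1 := fun i => (RCLike.abs_re_le_norm _).trans (hc i)
  have him : ∀ i, |RCLike.im (c i)| ≤ 1 := fun i => (RCLike.abs_im_le_norm _).trans (hc i)
  have hpos : ∀ r : ℝ, |r| ≤ 1 → 0 ≤ max r 0 ∧ max r 0 ≤ 1 := fun r hr =>
    ⟨le_max_right _ _, max_le ((le_abs_self r).trans hr) zero_le_one⟩
  have t1 := h F y s hs (fun i => max (RCLike.re (c i)) 0) (fun i => hpos _ (hre i))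
  have t2 := h F y s hs (fun i => max (-RCLike.re (c i)) 0)
    (fun i => hpos _ (by rw [abs_neg]; exact hre i))
  have t3 := h F y s hs (fun i => max (RCLike.im (c i)) 0) (fun i => hpos _ (him i))
  have t4 := h F y s hs (fun i => max (-RCLike.im (c i)) 0)
    (fun i => hpos _ (by rw [abs_neg]; exact him i))
  set z1 := ∑ i ∈ F, ((max (RCLike.re (c i)) 0 : ℝ) : 𝕜) • y i
  set z2 := ∑ i ∈ F, ((max (-RCLike.re (c i)) 0 : ℝ) : 𝕜) • y i
  set z3 := ∑ i ∈ F, ((max (RCLike.im (c i)) 0 : ℝ) : 𝕜) • y i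
  set z4 := ∑ i ∈ F, ((max (-RCLike.im (c i)) 0 : ℝ) : 𝕜) • y i
  have hmax : ∀ r : ℝ, max r 0 - max (-r) 0 = r := fun r => by
    rcases le_total r 0 with hr | hr
    · rw [max_eq_right hr, max_eq_left (by linarith)]; ring
    · rw [max_eq_left hr, max_eq_right (by linarith)]; ring
  have hdec : ∑ i ∈ F, c i • y i = (z1 - z2) + (RCLike.I : 𝕜) • (z3 - z4) := by
    simp only [z1, z2, z3, z4]
    rw [← Finset.sum_sub_distrib, ← Finset.sum_sub_distrib, Finset.smul_sum,
      ← Finset.sum_add_distrib]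
    refine Finset.sum_congr rfl fun i _ => ?_
    rw [← sub_smul, ← sub_smul, ← RCLike.ofReal_sub, ← RCLike.ofReal_sub, hmax, hmax, smul_smul,
      ← add_smul, mul_comm, RCLike.re_add_im]
  have hI : ‖(RCLike.I : 𝕜)‖ ≤ 1 := by
    rcases RCLike.I_eq_zero_or_im_I_eq_one (K := 𝕜) with h | h
    · rw [h]; simp
    · exact (RCLike.norm_I_of_ne_zero (by rintro h'; rw [h'] at h; simp at h)).le
  rw [hdec]
  calc _ ≤ quasiConst 𝕜 X * (‖z1 - z2‖ + ‖(RCLike.I : 𝕜) • (z3 - z4)‖) := qnorm_add_le 𝕜 _ _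
    _ ≤ quasiConst 𝕜 X * (‖z1 - z2‖ + ‖z3 - z4‖) := by
        rw [qnorm_smul 𝕜]
        have := mul_le_of_le_one_left (qnorm_nonneg 𝕜 (z3 - z4)) hI
        gcongr
    _ ≤ quasiConst 𝕜 X * (quasiConst 𝕜 X * (C * s + C * s) + quasiConst 𝕜 X * (C * s + C * s)) := by
        have e1 := qnorm_sub_le 𝕜 z1 z2
        have e2 := qnorm_sub_le 𝕜 z3 z4
        gcongr
        · exact e1.trans (by gcongr)
        · exact e2.trans (by gcongr)
    _ = _ := by ring

include 𝕜 in
/-- Partial sums of an unconditionally convergent series are bounded; convexity is not needed. -/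
theorem exists_subset_sum_bound {ι : Type*} {g : ι → X} {f : X} (h : HasSum g f) :
    ∃ M, ∀ F : Finset ι, ‖∑ i ∈ F, g i‖ ≤ M := by
  classical
  have h1 := one_le_quasiConst 𝕜 X
  have h0 := quasiConst_pos 𝕜 X
  obtain ⟨F0, hF0⟩ := eventually_atTop.1 (eventually_qnorm_sub_lt 𝕜 h one_pos)
  refine ⟨quasiConst 𝕜 X * (quasiConst 𝕜 X * (1 + ‖f‖) +
    quasiConst 𝕜 X ^ F0.card * ∑ i ∈ F0, ‖g i‖), fun F => ?_⟩
  have e1 : ∑ i ∈ F, g i = ∑ i ∈ F ∪ F0, g i - ∑ i ∈ F0 \ F, g i := by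
    rw [eq_sub_iff_add_eq, ← Finset.sum_union Finset.disjoint_sdiff,
      Finset.union_sdiff_self_eq_union]
  have e2 : ‖∑ i ∈ F ∪ F0, g i‖ ≤ quasiConst 𝕜 X * (1 + ‖f‖) := by
    have := qnorm_add_le 𝕜 (∑ i ∈ F ∪ F0, g i - f) f
    rw [sub_add_cancel] at this
    have h3 := (hF0 (F ∪ F0) Finset.subset_union_right).le
    exact this.trans (by gcongr)
  have e3 : ‖∑ i ∈ F0 \ F, g i‖ ≤ quasiConst 𝕜 X ^ F0.card * ∑ i ∈ F0, ‖g i‖ := by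
    refine (qnorm_sum_le 𝕜 _ _).trans ?_
    have e4 : ∑ i ∈ F0 \ F, ‖g i‖ ≤ ∑ i ∈ F0, ‖g i‖ :=
      Finset.sum_le_sum_of_subset_of_nonneg Finset.sdiff_subset fun i _ _ => qnorm_nonneg 𝕜 _
    have e5 : (F0 \ F).card ≤ F0.card := Finset.card_le_card Finset.sdiff_subset
    have e6 : 0 ≤ ∑ i ∈ F0 \ F, ‖g i‖ := Finset.sum_nonneg fun i _ => qnorm_nonneg 𝕜 _
    gcongr
  rw [e1]
  exact (qnorm_sub_le 𝕜 _ _).trans (by gcongr)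

variable {𝕜} {I : Type w}

/-- A biorthogonal system `(b, φ)` in `X` whose finite multiplier operators
`f ↦ ∑ i ∈ F, c i φ i (f) b i` with `|c i| ≤ 1` are uniformly bounded by `K`. -/
structure IsUncSystem (b : I → X) (φ : I → X →L[𝕜] 𝕜) (K : ℝ) : Prop where
  one_le : 1 ≤ K
  apply_self : ∀ i, φ i (b i) = 1
  apply_ne : ∀ i k, i ≠ k → φ i (b k) = 0
  bound : ∀ (F : Finset I) (c : I → 𝕜) (f : X), (∀ i, ‖c i‖ ≤ 1) →
    ‖∑ i ∈ F, (c i * φ i f) • b i‖ ≤ K * ‖f‖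

omit [Norm X] [QuasiBanachSpace 𝕜 X] in
theorem IsUnconditionalBasicSeq.ne_zero {b : I → X} (hb : IsUnconditionalBasicSeq 𝕜 b) (i : I) :
    b i ≠ 0 := by
  classical
  intro hi
  obtain ⟨a, ha, hu⟩ := hb 0 (Submodule.zero_mem _)
  have e0 := hu 0 (by simp)
  have e1 := hu (Pi.single i 1) (by
    convert hasSum_zero (α := X) (β := I) using 2 with k
    by_cases hk : k = i
    · subst hk; simp [hi]
    · simp [hk])
  have := congrFun (e1.trans e0.symm) i
  simp at this

/-- The coordinate functionals of an unconditional basic sequence, composed with a bounded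
projection onto its closed span, form an unconditional system. The partial sum operators are not
known to be continuous beforehand, so their boundedness is an instance of `exists_gauge_bound`. -/
theorem exists_coordinates {b : I → X} (hb : IsUnconditionalBasicSeq 𝕜 b) (P : X →L[𝕜] X)
    (hP : ∀ f, P f ∈ closedSpan 𝕜 b) (hPb : ∀ i, P (b i) = b i) :
    ∃ (φ : I → X →L[𝕜] 𝕜) (K : ℝ), IsUncSystem b φ K ∧
      ∀ f, HasSum (fun i => φ i f • b i) (P f) := by
  classical
  have h1 := one_le_quasiConst 𝕜 X
  have h0 := quasiConst_pos 𝕜 X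
  have := t2Space 𝕜 (X := X)
  have hne := hb.ne_zero
  choose a ha hu using fun f => hb (P f) (hP f)
  have hadd : ∀ f g, a (f + g) = a f + a g := fun f g => by
    refine (hu (f + g) _ ?_).symm
    simpa [add_smul] using (ha f).add (ha g)
  have hsmul : ∀ (c : 𝕜) f, a (c • f) = c • a f := fun c f => by
    refine (hu (c • f) _ ?_).symm
    simpa [smul_smul] using (ha f).const_smul c
  have hsum : ∀ (f : ℕ → X) n i, a (∑ k ∈ Finset.range n, f k) i
      = ∑ k ∈ Finset.range n, a (f k) i := by
    intro f n i
    induction n with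
    | zero =>
      have := congrFun (hsmul 0 0) i
      simpa using this
    | succ n ih => rw [Finset.sum_range_succ, hadd, Pi.add_apply, ih, Finset.sum_range_succ]
  set ρ := (2 * quasiConst 𝕜 X)⁻¹ with hρ
  have hρ0 : 0 < ρ := by positivity
  have hρ1 : ρ < 1 := inv_lt_one_of_one_lt₀ (by linarith)
  have hρlim : Tendsto (fun k : ℕ => ρ ^ k) atTop (𝓝 0) :=
    tendsto_pow_atTop_nhds_zero_of_lt_one hρ0.le hρ1
  obtain ⟨M, hM0, hM⟩ := exists_gauge_bound 𝕜 (X := X)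
    (fun (F : Finset I) f => ‖∑ i ∈ F, a f i • b i‖) (C := quasiConst 𝕜 X * (2 * quasiConst 𝕜 X))
    (fun F f g => by
      have := qnorm_add_le 𝕜 (∑ i ∈ F, a f i • b i) (∑ i ∈ F, a g i • b i)
      rw [← Finset.sum_add_distrib] at this
      simpa [hadd, add_smul] using this)
    (fun F c f => by
      rw [← qnorm_smul 𝕜, Finset.smul_sum]
      simp [hsmul, smul_smul])
    (fun f => exists_subset_sum_bound 𝕜 (ha f))
    (fun f g hf hg => by
      -- the coordinates of the partial sums converge
      have hcoord : ∀ i, ∃ c, Tendsto (fun n => a (∑ k ∈ Finset.range n, f k) i) atTop (𝓝 c) := by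
        intro i
        have hbi := qnorm_pos 𝕜 (hne i)
        have hs : Summable fun k => a (f k) i := by
          refine Summable.of_norm_bounded (g := fun k => ‖b i‖⁻¹ * ρ ^ k)
            ((summable_geometric_of_lt_one hρ0.le hρ1).mul_left _) fun k => ?_
          have := hf k {i}
          simp only [Finset.sum_singleton, qnorm_smul 𝕜] at this
          rw [inv_mul_eq_div, le_div_iff₀ hbi]
          exact this
        refine ⟨∑' k, a (f k) i, ?_⟩
        simp_rw [hsum]
        exact hs.hasSum.tendsto_sum_nat
      choose c hc using hcoord
      have hF : ∀ F : Finset I, Tendsto (fun n => ∑ i ∈ F, a (∑ k ∈ Finset.range n, f k) i • b i)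
          atTop (𝓝 (∑ i ∈ F, c i • b i)) := fun F =>
        tendsto_finsetSum _ fun i _ => (hc i).smul_const _
      have hpart : ∀ F : Finset I, ∀ m n, ∑ i ∈ F, a (∑ k ∈ Finset.range (m + n), f k) i • b i
          = ∑ i ∈ F, a (∑ k ∈ Finset.range m, f k) i • b i
            + ∑ k ∈ Finset.range n, ∑ i ∈ F, a (f (m + k)) i • b i := by
        intro F m n
        rw [Finset.sum_comm, ← Finset.sum_add_distrib]
        refine Finset.sum_congr rfl fun i _ => ?_
        rw [hsum, hsum, Finset.sum_range_add, add_smul, Finset.sum_smul, Finset.sum_smul]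
      have htail : ∀ F : Finset I, ∀ m,
          ‖∑ i ∈ F, c i • b i - ∑ i ∈ F, a (∑ k ∈ Finset.range m, f k) i • b i‖
            ≤ quasiConst 𝕜 X * (2 * quasiConst 𝕜 X * ρ ^ m) := by
        intro F m
        have h2 : Tendsto (fun n => ∑ k ∈ Finset.range n, ∑ i ∈ F, a (f (m + k)) i • b i) atTop
            (𝓝 (∑ i ∈ F, c i • b i - ∑ i ∈ F, a (∑ k ∈ Finset.range m, f k) i • b i)) := by
          have := (((tendsto_add_atTop_iff_nat m).2 (hF F)).sub_const
            (∑ i ∈ F, a (∑ k ∈ Finset.range m, f k) i • b i))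
          refine this.congr fun n => ?_
          rw [add_comm n m, hpart, add_sub_cancel_left]
        refine qnorm_le_of_tendsto 𝕜 h2 (Eventually.of_forall fun n => ?_)
        have := qnorm_sum_range_le 𝕜 (fun k => ∑ i ∈ F, a (f (m + k)) i • b i) (C := 1) m
          (fun k => by simpa using hf (m + k) F) n
        rwa [mul_one] at this
      -- by uniqueness of expansions, the limits `c` are the coordinates of `g`
      have hPg : HasSum (fun i => c i • b i) (P g) := by
        refine tendsto_of_qnorm_sub 𝕜 fun ε hε => ?_
        have hlim1 : Tendsto (fun m => P (∑ k ∈ Finset.range m, f k)) atTop (𝓝 (P g)) :=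
          (P.continuous.tendsto g).comp hg
        have hlim2 : Tendsto (fun m => quasiConst 𝕜 X * (2 * quasiConst 𝕜 X * ρ ^ m)) atTop
            (𝓝 0) := by
          simpa using (hρlim.const_mul (2 * quasiConst 𝕜 X)).const_mul (quasiConst 𝕜 X)
        have hδ : 0 < ε / (3 * quasiConst 𝕜 X ^ 2) := by positivity
        obtain ⟨m, hm1, hm2⟩ := ((eventually_qnorm_sub_lt 𝕜 hlim1 hδ).and
          (hlim2.eventually (gt_mem_nhds hδ))).exists
        filter_upwards [eventually_qnorm_sub_lt 𝕜 (ha (∑ k ∈ Finset.range m, f k)) hδ] with F hF3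
        set δ := ε / (3 * quasiConst 𝕜 X ^ 2)
        set y := ∑ i ∈ F, c i • b i
        set y' := ∑ i ∈ F, a (∑ k ∈ Finset.range m, f k) i • b i
        set z := P (∑ k ∈ Finset.range m, f k)
        have e1 : y - P g = (y - y') + ((y' - z) + (z - P g)) := by abel
        have e2 : ‖y - y'‖ < δ := (htail F m).trans_lt hm2
        rw [e1]
        calc _ ≤ quasiConst 𝕜 X * (‖y - y'‖ + ‖(y' - z) + (z - P g)‖) := qnorm_add_le 𝕜 _ _
          _ ≤ quasiConst 𝕜 X * (‖y - y'‖ + quasiConst 𝕜 X * (‖y' - z‖ + ‖z - P g‖)) := by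
              have := qnorm_add_le 𝕜 (y' - z) (z - P g)
              gcongr
          _ < quasiConst 𝕜 X * (δ + quasiConst 𝕜 X * (δ + δ)) := by gcongr
          _ ≤ quasiConst 𝕜 X * (quasiConst 𝕜 X * δ + quasiConst 𝕜 X * (δ + δ)) := by
              gcongr
              exact le_mul_of_one_le_left hδ.le h1
          _ = ε := by simp only [δ]; field_simp; ring
      have hcg : c = a g := hu g c hPg
      intro F
      have h3 := htail F 0
      have ha0 : ∀ i, a 0 i = 0 := fun i => by simpa using congrFun (hsmul 0 0) i
      simp only [Finset.range_zero, Finset.sum_empty, ha0, zero_smul, Finset.sum_const_zero,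
        sub_zero, pow_zero, mul_one] at h3
      rw [← hcg]
      exact h3)
  have hφ : ∀ i, ∀ f, ‖a f i‖ ≤ M / ‖b i‖ * ‖f‖ := fun i f => by
    have := hM f {i}
    simp only [Finset.sum_singleton, qnorm_smul 𝕜] at this
    rw [div_mul_eq_mul_div, le_div_iff₀ (qnorm_pos 𝕜 (hne i))]
    exact this
  let φl : I → X →ₗ[𝕜] 𝕜 := fun i =>
    { toFun := fun f => a f i
      map_add' := fun f g => by rw [hadd]; rfl
      map_smul' := fun c f => by rw [hsmul]; rfl }
  let φ : I → X →L[𝕜] 𝕜 := fun i =>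
    ⟨φl i, continuous_functional_of_qbound 𝕜 (φl i) (M / ‖b i‖) (hφ i)⟩
  have hφa : ∀ i f, φ i f = a f i := fun i f => rfl
  obtain ⟨C, hC1, hC⟩ := exists_multiplier_bound.{u, v, w} 𝕜 X
  have hab : ∀ k, a (b k) = Pi.single k 1 := fun k => by
    refine (hu (b k) _ ?_).symm
    rw [hPb]
    convert hasSum_ite_eq k (b k) using 2 with i
    by_cases hik : i = k
    · subst hik; simp
    · simp [hik]
  refine ⟨φ, max 1 (C * M), ⟨le_max_left _ _, fun i => ?_, fun i k hik => ?_, ?_⟩, fun f => ?_⟩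
  · rw [hφa, hab]; simp
  · rw [hφa, hab]; simp [hik]
  · intro F c f hc
    have := hC F (fun i => a f i • b i) (M * ‖f‖) (fun A _ => hM f A) c hc
    simp only [smul_smul] at this
    refine this.trans ?_
    rw [← mul_assoc]
    have := qnorm_nonneg 𝕜 f
    gcongr
    exact le_max_right _ _
  · exact ha f

end Coordinates

/-! ### L-convexity -/

section LConvex

variable {𝕜 : Type v} [RCLike 𝕜] {X : Type u} [AddCommGroup X] [Module 𝕜 X]
  [UniformSpace X] [IsUniformAddGroup X] [ContinuousSMul 𝕜 X] [Norm X]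
  [QuasiBanachSpace 𝕜 X] {J : Type w} {x : J → X} {e : J → X →L[𝕜] 𝕜} {K : ℝ}

omit [IsUniformAddGroup X] [ContinuousSMul 𝕜 X] [Norm X] [QuasiBanachSpace 𝕜 X] in
/-- A vector whose coefficients are dominated by those of `g` arises from `g` by a multiplier. -/
theorem exists_multiplier (D : Finset J) (f : J → 𝕜) (g : X) (hf : ∀ j ∈ D, ‖f j‖ ≤ ‖e j g‖) :
    ∃ c : J → 𝕜, (∀ j, ‖c j‖ ≤ 1) ∧ ∑ j ∈ D, f j • x j = ∑ j ∈ D, (c j * e j g) • x j := by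
  classical
  refine ⟨fun j => if j ∈ D then f j / e j g else 0, fun j => ?_,
    Finset.sum_congr rfl fun j hj => ?_⟩
  · by_cases hj : j ∈ D
    · simp only [hj, if_true, norm_div]
      exact div_le_one_of_le₀ (hf j hj) (norm_nonneg _)
    · simp [hj]
  · simp only [hj, if_true]
    by_cases h0 : e j g = 0
    · have := hf j hj
      rw [h0, norm_zero, norm_le_zero_iff] at this
      rw [this, h0]; simp
    · rw [div_mul_cancel₀ _ h0]

omit [IsUniformAddGroup X] [ContinuousSMul 𝕜 X] [QuasiBanachSpace 𝕜 X] in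
/-- Domination of coefficients gives domination of norms. -/
theorem IsUncSystem.norm_sum_le (h : IsUncSystem x e K) (D : Finset J) (f : J → 𝕜) (g : X)
    (hf : ∀ j ∈ D, ‖f j‖ ≤ ‖e j g‖) : ‖∑ j ∈ D, f j • x j‖ ≤ K * ‖g‖ := by
  obtain ⟨c, hc, hs⟩ := exists_multiplier (x := x) D f g hf
  rw [hs]
  exact h.bound D c g hc

omit [IsUniformAddGroup X] [ContinuousSMul 𝕜 X] [Norm X] [QuasiBanachSpace 𝕜 X] in
theorem apply_sum_of_biorth [DecidableEq J] (h1 : ∀ j, e j (x j) = 1)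
    (h2 : ∀ i k, i ≠ k → e i (x k) = 0)
    (D : Finset J) (f : J → 𝕜) (j : J) : e j (∑ i ∈ D, f i • x i) = if j ∈ D then f j else 0 := by
  rw [map_sum]
  split_ifs with hj
  · rw [Finset.sum_eq_single_of_mem j hj fun i _ hij => by
      rw [map_smul, h2 j i hij.symm, smul_zero]]
    rw [map_smul, h1, smul_eq_mul, mul_one]
  · refine Finset.sum_eq_zero fun i hi => ?_
    rw [map_smul, h2 j i (fun hji => hj (hji ▸ hi)), smul_zero]

omit [IsUniformAddGroup X] [ContinuousSMul 𝕜 X] [QuasiBanachSpace 𝕜 X] in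
theorem IsUncSystem.apply_sum [DecidableEq J] (h : IsUncSystem x e K) (D : Finset J) (f : J → 𝕜)
    (j : J) : e j (∑ i ∈ D, f i • x i) = if j ∈ D then f j else 0 :=
  apply_sum_of_biorth h.apply_self h.apply_ne D f j

/-- In an L-convex lattice, `‖f‖` is bounded by the supremum of `‖F ω‖` as soon as each coordinate
of `f` is dominated for a fixed proportion of the `ω`. The proportion is first raised to
`1 - ε` by taking several independent copies of `ω`. -/
theorem exists_lconvex_const (h : IsUncSystem x e K) (hL : IsLConvexBasis 𝕜 x) {δ : ℝ}
    (hδ : 0 < δ) : ∃ C : ℝ, 0 < C ∧ ∀ (Ω : Type*) [Fintype Ω] [Nonempty Ω] (F : Ω → X)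
      (D : Finset J) (f : J → 𝕜) (t : ℝ), (∀ ω, ‖F ω‖ ≤ t) →
      (∀ j ∈ D, ∃ A : Finset Ω, δ * Fintype.card Ω ≤ A.card ∧ ∀ ω ∈ A, ‖f j‖ ≤ ‖e j (F ω)‖) →
        ‖∑ j ∈ D, f j • x j‖ ≤ C * t := by
  classical
  obtain ⟨ε, hε0, hε1, hL⟩ := hL
  have hK := h.one_le
  have hK0 : 0 < K := by linarith
  have h0 := quasiConst_pos 𝕜 X
  obtain ⟨m, hm⟩ : ∃ m : ℕ, (max (1 - δ) 0) ^ m < ε :=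
    exists_pow_lt_of_lt_one hε0 (max_lt (by linarith) one_pos)
  refine ⟨K * (ε⁻¹ * (quasiConst 𝕜 X ^ (m + 1) * ((m + 1) * K))), by positivity, ?_⟩
  intro Ω _ _ F D f t hF hA
  choose! A hAcard hA using hA
  have ht : 0 ≤ t := (qnorm_nonneg 𝕜 _).trans (hF (Classical.arbitrary Ω))
  -- `G w` keeps the coordinates of `f` that are dominated by one of `F (w 0), …, F (w (m - 1))`
  let G : (Fin m → Ω) → J → ℝ := fun w j => if j ∈ D ∧ ∃ k, w k ∈ A j then ‖f j‖ else 0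
  let a : J → ℝ := fun j => if j ∈ D then ‖f j‖ else 0
  let N := Fintype.card (Fin m → Ω)
  have hN : 0 < N := Fintype.card_pos
  let σ : Fin N ≃ (Fin m → Ω) := (Fintype.equivFin _).symm
  have hsum : ∀ (c : J → ℝ), (∀ j ∉ D, c j = 0) →
      HasSum (fun j => (c j : 𝕜) • x j) (∑ j ∈ D, (c j : 𝕜) • x j) := fun c hc =>
    hasSum_sum_of_ne_finset_zero fun j hj => by rw [hc j hj]; simp
  obtain ⟨i, hi⟩ := hL N hN (∑ j ∈ D, (a j : 𝕜) • x j) (fun i => ∑ j ∈ D, (G (σ i) j : 𝕜) • x j)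
    a (fun i => G (σ i)) (hsum a fun j hj => by simp [a, hj])
    (fun i => hsum _ fun j hj => by simp [G, hj])
    (fun i j => by
      simp only [G, a]
      by_cases hj : j ∈ D
      · by_cases hk : ∃ k, σ i k ∈ A j
        · simp [hj, hk]
        · simp [hj, hk]
      · simp [hj])
    (fun j => by
      by_cases hj : j ∈ D
      swap
      · simp [G, a, hj]
      rw [σ.sum_comp (fun w => G w j)]
      have e1 : ∀ w, G w j = ‖f j‖ - if (∀ k, w k ∈ (A j)ᶜ) then ‖f j‖ else 0 := fun w => by
        by_cases hk : ∃ k, w k ∈ A j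
        · have : ¬ ∀ k, w k ∈ (A j)ᶜ := by
            push Not; obtain ⟨k, hk⟩ := hk; exact ⟨k, by simpa using hk⟩
          rw [if_neg this]
          simp [G, hj, hk]
        · have h2 : ∀ k, w k ∈ (A j)ᶜ := by
            push Not at hk; intro k; simpa using hk k
          have h3 : ∀ k, w k ∉ A j := by push Not at hk; exact hk
          simp [G, h3]
      have e2 : (Finset.univ.filter fun w : Fin m → Ω => ∀ k, w k ∈ (A j)ᶜ)
          = Fintype.piFinset fun _ => (A j)ᶜ := by
        ext w; simp [Fintype.mem_piFinset]
      have e3 : (∑ w : Fin m → Ω, G w j) = N * ‖f j‖ - ((A j)ᶜ.card : ℝ) ^ m * ‖f j‖ := by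
        simp_rw [e1]
        rw [Finset.sum_sub_distrib, Finset.sum_const, ← Finset.sum_filter, e2, Finset.sum_const,
          Fintype.card_piFinset]
        simp [N]
      have hΩ : (0 : ℝ) < Fintype.card Ω := by exact_mod_cast Fintype.card_pos
      have e4 : ((A j)ᶜ.card : ℝ) ≤ max (1 - δ) 0 * Fintype.card Ω := by
        have h5 : ((A j)ᶜ.card : ℝ) = Fintype.card Ω - (A j).card := by
          rw [Finset.card_compl, Nat.cast_sub (Finset.card_le_univ _)]
        have := hAcard j hj
        rw [h5]
        calc (Fintype.card Ω : ℝ) - (A j).card ≤ (1 - δ) * Fintype.card Ω := by linarith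
          _ ≤ _ := by gcongr; exact le_max_left _ _
      have e5 : ((A j)ᶜ.card : ℝ) ^ m ≤ ε * N := by
        calc ((A j)ᶜ.card : ℝ) ^ m ≤ (max (1 - δ) 0 * Fintype.card Ω) ^ m := by gcongr
          _ = (max (1 - δ) 0) ^ m * N := by
              rw [mul_pow]; congr 1; simp [N]
          _ ≤ _ := by gcongr
      have hN' : (0 : ℝ) < N := by exact_mod_cast hN
      rw [e3, le_div_iff₀ hN']
      simp only [a, hj, if_true]
      have := mul_le_mul_of_nonneg_right e5 (norm_nonneg (f j))
      linarith)
  set w := σ i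
  -- split the selected coordinates according to the copy that dominates them
  have hG : ‖∑ j ∈ D, (G w j : 𝕜) • x j‖ ≤ quasiConst 𝕜 X ^ m * (m * (K * t)) := by
    let ch : J → Option (Fin m) := fun j =>
      if hk : ∃ k, w k ∈ A j then some (Classical.choose hk) else none
    have hch : ∀ j k, ch j = some k → w k ∈ A j := by
      intro j k hjk
      simp only [ch] at hjk
      split_ifs at hjk with hk
      rw [← Option.some.inj hjk]
      exact Classical.choose_spec hk
    have e1 : ∑ j ∈ D, (G w j : 𝕜) • x j
        = ∑ k : Fin m, ∑ j ∈ D with ch j = some k, ((‖f j‖ : ℝ) : 𝕜) • x j := by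
      simp_rw [Finset.sum_filter]
      rw [Finset.sum_comm]
      refine Finset.sum_congr rfl fun j hj => ?_
      by_cases hk : ∃ k, w k ∈ A j
      · have : ch j = some (Classical.choose hk) := by simp only [ch, hk, dif_pos]
        rw [Finset.sum_eq_single (Classical.choose hk)]
        · simp [this, G, hj, hk]
        · intro k _ hne
          rw [if_neg]
          rw [this]
          exact fun h => hne (Option.some.inj h).symm
        · simp
      · have : ch j = none := by simp only [ch, hk, dif_neg, not_false_eq_true]
        simp [this, G, hk]
    rw [e1]
    have := qnorm_sum_le_of_le 𝕜 (Finset.univ : Finset (Fin m))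
      (fun k => ∑ j ∈ D with ch j = some k, ((‖f j‖ : ℝ) : 𝕜) • x j) (C := K * t) (fun k _ => by
        refine (h.norm_sum_le _ (fun j => ((‖f j‖ : ℝ) : 𝕜)) (F (w k)) fun j hj => ?_).trans ?_
        · rw [Finset.mem_filter] at hj
          rw [RCLike.norm_ofReal, abs_of_nonneg (norm_nonneg _)]
          exact hA j hj.1 _ (hch j k hj.2)
        · have := hF (w k)
          gcongr)
    simpa using this
  have h7 : ‖∑ j ∈ D, f j • x j‖ ≤ K * ‖∑ j ∈ D, (a j : 𝕜) • x j‖ := by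
    refine h.norm_sum_le D f _ fun j hj => ?_
    rw [h.apply_sum, if_pos hj, RCLike.norm_ofReal]
    simp [a, hj]
  have h8 : ‖∑ j ∈ D, (a j : 𝕜) • x j‖
      ≤ ε⁻¹ * (quasiConst 𝕜 X ^ (m + 1) * ((m + 1) * (K * t))) := by
    rw [le_inv_mul_iff₀ hε0]
    refine (hi.trans hG).trans ?_
    have hκ1 := one_le_quasiConst 𝕜 X
    gcongr
    · exact Nat.le_succ m
    · linarith
  calc _ ≤ _ := h7
    _ ≤ K * (ε⁻¹ * (quasiConst 𝕜 X ^ (m + 1) * ((m + 1) * (K * t)))) := by gcongr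
    _ = _ := by ring

end LConvex

/-! ### Random signs -/

section Signs

/-- The sign `1` or `-1` attached to a bit. -/
def sgn (s : Bool) : ℝ := if s then 1 else -1

theorem sgn_mul_self (s : Bool) : sgn s * sgn s = 1 := by cases s <;> simp [sgn]

theorem sgn_not (s : Bool) : sgn (!s) = -sgn s := by cases s <;> simp [sgn]

theorem abs_sgn (s : Bool) : |sgn s| = 1 := by cases s <;> simp [sgn]

theorem norm_sgn {𝕜 : Type v} [RCLike 𝕜] (s : Bool) : ‖(sgn s : 𝕜)‖ = 1 := by
  rw [RCLike.norm_ofReal, abs_sgn]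

/-- A function on the cube that is odd in one coordinate has zero sum. -/
theorem sum_eq_zero_of_flip {ι : Type*} [Fintype ι] [DecidableEq ι] {M : Type*} [AddCommGroup M]
    [Module ℝ M] (i : ι) (f : (ι → Bool) → M)
    (hf : ∀ ε, f (Function.update ε i (!ε i)) = -f ε) : ∑ ε, f ε = 0 := by
  have hinv : Function.Involutive fun ε : ι → Bool => Function.update ε i (!ε i) := by
    intro ε; simp
  have h1 := Equiv.sum_comp (Function.Involutive.toPerm _ hinv) f
  simp only [Function.Involutive.coe_toPerm, hf, Finset.sum_neg_distrib] at h1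
  have h2 : (2 : ℝ) • ∑ ε, f ε = 0 := by
    rw [two_smul]
    nth_rewrite 1 [← h1]
    exact neg_add_cancel _
  exact (smul_eq_zero.1 h2).resolve_left two_ne_zero

variable {𝕜 : Type v} [RCLike 𝕜]

theorem parallelogram_pow_four (g h : 𝕜) :
    ‖g + h‖ ^ 4 + ‖g - h‖ ^ 4 ≤ 2 * (‖g‖ ^ 4 + 6 * (‖g‖ ^ 2 * ‖h‖ ^ 2) + ‖h‖ ^ 4) := by
  have h1 : ‖g + h‖ ^ 2 + ‖g - h‖ ^ 2 = 2 * (‖g‖ ^ 2 + ‖h‖ ^ 2) := by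
    have := parallelogram_law_with_norm 𝕜 g h
    nlinarith
  have h2 : |‖g + h‖ ^ 2 - ‖g - h‖ ^ 2| ≤ 4 * (‖g‖ * ‖h‖) := by
    have e1 : ‖g + h‖ ^ 2 - ‖g - h‖ ^ 2 = 4 * RCLike.re (inner 𝕜 g h) := by
      rw [@norm_add_sq 𝕜, @norm_sub_sq 𝕜]; ring
    rw [e1, abs_mul, abs_of_pos (by norm_num : (0 : ℝ) < 4)]
    have := abs_real_inner_le_norm (F := 𝕜)
    have h3 : |RCLike.re (inner 𝕜 g h)| ≤ ‖g‖ * ‖h‖ :=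
      (RCLike.abs_re_le_norm _).trans (norm_inner_le_norm g h)
    linarith
  have h3 : (‖g + h‖ ^ 2 - ‖g - h‖ ^ 2) ^ 2 ≤ (4 * (‖g‖ * ‖h‖)) ^ 2 := by
    rw [← sq_abs]
    gcongr
  have h4 : (‖g + h‖ ^ 2 + ‖g - h‖ ^ 2) ^ 2 = (2 * (‖g‖ ^ 2 + ‖h‖ ^ 2)) ^ 2 := by rw [h1]
  nlinarith

/-- One step of the hypercontractive estimate: adjoining an independent sign to `g` and `h`. -/
theorem fourth_moment_step {Ω : Type*} [Fintype Ω] (g h : Ω → 𝕜) {N C : ℝ} (hN : 0 ≤ N)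
    (hC : 0 ≤ C)
    (hg : N * ∑ ω, ‖g ω‖ ^ 4 ≤ 9 * C * (∑ ω, ‖g ω‖ ^ 2) ^ 2)
    (hh : N * ∑ ω, ‖h ω‖ ^ 4 ≤ C * (∑ ω, ‖h ω‖ ^ 2) ^ 2) :
    2 * N * ∑ ω, (‖g ω + h ω‖ ^ 4 + ‖g ω - h ω‖ ^ 4)
      ≤ 9 * C * (∑ ω, (‖g ω + h ω‖ ^ 2 + ‖g ω - h ω‖ ^ 2)) ^ 2 := by
  set G2 := ∑ ω, ‖g ω‖ ^ 2
  set H2 := ∑ ω, ‖h ω‖ ^ 2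
  set G4 := ∑ ω, ‖g ω‖ ^ 4
  set H4 := ∑ ω, ‖h ω‖ ^ 4
  set GH := ∑ ω, ‖g ω‖ ^ 2 * ‖h ω‖ ^ 2
  have hG2 : 0 ≤ G2 := Finset.sum_nonneg fun _ _ => by positivity
  have hH2 : 0 ≤ H2 := Finset.sum_nonneg fun _ _ => by positivity
  have hG4 : 0 ≤ G4 := Finset.sum_nonneg fun _ _ => by positivity
  have hH4 : 0 ≤ H4 := Finset.sum_nonneg fun _ _ => by positivity
  have hGH : 0 ≤ GH := Finset.sum_nonneg fun _ _ => by positivity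
  have h1 : ∑ ω, (‖g ω + h ω‖ ^ 2 + ‖g ω - h ω‖ ^ 2) = 2 * (G2 + H2) := by
    rw [← Finset.sum_add_distrib, Finset.mul_sum]
    refine Finset.sum_congr rfl fun ω _ => ?_
    have := parallelogram_law_with_norm 𝕜 (g ω) (h ω)
    nlinarith
  have h2 : ∑ ω, (‖g ω + h ω‖ ^ 4 + ‖g ω - h ω‖ ^ 4) ≤ 2 * (G4 + 6 * GH + H4) := by
    simp only [G4, GH, H4]
    rw [Finset.mul_sum, ← Finset.sum_add_distrib, ← Finset.sum_add_distrib, Finset.mul_sum]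
    exact Finset.sum_le_sum fun ω _ => parallelogram_pow_four _ _
  have h3 : GH ^ 2 ≤ G4 * H4 := by
    have := Finset.sum_mul_sq_le_sq_mul_sq Finset.univ (fun ω => ‖g ω‖ ^ 2) (fun ω => ‖h ω‖ ^ 2)
    simpa only [← pow_mul] using this
  have h4 : N * GH ≤ 3 * C * (G2 * H2) := by
    refine le_of_sq_le_sq ?_ (by positivity)
    calc (N * GH) ^ 2 = N ^ 2 * GH ^ 2 := by ring
      _ ≤ N ^ 2 * (G4 * H4) := by gcongr
      _ = (N * G4) * (N * H4) := by ring
      _ ≤ (9 * C * G2 ^ 2) * (C * H2 ^ 2) := by gcongr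
      _ = _ := by ring
  rw [h1]
  have h5 : 0 ≤ C * H2 ^ 2 := by positivity
  calc 2 * N * ∑ ω, (‖g ω + h ω‖ ^ 4 + ‖g ω - h ω‖ ^ 4)
      ≤ 2 * N * (2 * (G4 + 6 * GH + H4)) := by gcongr
    _ = 4 * (N * G4 + 6 * (N * GH) + N * H4) := by ring
    _ ≤ 4 * (9 * C * G2 ^ 2 + 6 * (3 * C * (G2 * H2)) + C * H2 ^ 2) := by gcongr
    _ ≤ _ := by nlinarith

theorem sum_cube_succ {M : Type*} [AddCommMonoid M] (n : ℕ) (f : (Fin (n + 1) → Bool) → M) :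
    ∑ ε, f ε = ∑ ε : Fin n → Bool, (f (Fin.cons true ε) + f (Fin.cons false ε)) := by
  rw [← (Fin.consEquiv fun _ => Bool).sum_comp, Fintype.sum_prod_type, Fintype.sum_bool,
    ← Finset.sum_add_distrib]
  rfl

/-- Equivalence of the second and fourth moments for affine functions of signs. -/
theorem linear_fourth_moment (n : ℕ) (d : 𝕜) (b : Fin n → 𝕜) :
    2 ^ n * ∑ ε : Fin n → Bool, ‖d + ∑ i, (sgn (ε i) : 𝕜) * b i‖ ^ 4
      ≤ 9 * (∑ ε : Fin n → Bool, ‖d + ∑ i, (sgn (ε i) : 𝕜) * b i‖ ^ 2) ^ 2 := by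
  induction n with
  | zero =>
    simp only [Finset.univ_eq_empty, Finset.sum_empty, add_zero, Finset.sum_const]
    simp only [Finset.card_univ, Fintype.card_pi, Finset.univ_eq_empty, Finset.prod_empty, one_smul]
    nlinarith [sq_nonneg (‖d‖ ^ 2)]
  | succ n ih =>
    have key := fourth_moment_step (C := 1) (N := 2 ^ n)
      (fun ε : Fin n → Bool => d + ∑ i, (sgn (ε i) : 𝕜) * b i.succ) (fun _ => b 0) (by positivity)
      zero_le_one (by simpa using ih (fun i => b i.succ)) (by
        simp only [Finset.sum_const, Finset.card_univ, Fintype.card_pi, Fintype.card_bool,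
          Finset.prod_const, Fintype.card_fin, nsmul_eq_mul, Nat.cast_pow, Nat.cast_ofNat]
        apply le_of_eq; ring)
    have e1 : ∀ ε : Fin n → Bool,
        d + ∑ i, (sgn ((Fin.cons true ε : Fin (n + 1) → Bool) i) : 𝕜) * b i
        = d + ∑ i, (sgn (ε i) : 𝕜) * b i.succ + b 0 := fun ε => by
      rw [Fin.sum_univ_succ]; simp [sgn]; ring
    have e2 : ∀ ε : Fin n → Bool,
        d + ∑ i, (sgn ((Fin.cons false ε : Fin (n + 1) → Bool) i) : 𝕜) * b i
        = d + ∑ i, (sgn (ε i) : 𝕜) * b i.succ - b 0 := fun ε => by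
      rw [Fin.sum_univ_succ]; simp [sgn]; ring
    simp only [sum_cube_succ, e1, e2]
    rw [pow_succ, mul_comm (2 ^ n : ℝ) 2]
    simpa using key

/-- The quadratic polynomial in signs with coefficients `d`, `b`, `t`. -/
noncomputable def quad {ι : Type*} [Fintype ι] (d : 𝕜) (b : ι → 𝕜) (t : ι → ι → 𝕜) (ε : ι → Bool) :
    𝕜 :=
  d + ∑ i, (sgn (ε i) : 𝕜) * b i + ∑ i, ∑ l, (sgn (ε i) : 𝕜) * (sgn (ε l) : 𝕜) * t i l

theorem quad_cons {n : ℕ} (d : 𝕜) (b : Fin (n + 1) → 𝕜) (t : Fin (n + 1) → Fin (n + 1) → 𝕜)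
    (s : Bool) (ε : Fin n → Bool) :
    quad d b t (Fin.cons s ε) = quad (d + t 0 0) (fun i => b i.succ) (fun i l => t i.succ l.succ) ε
      + (sgn s : 𝕜) * (b 0 + ∑ i, (sgn (ε i) : 𝕜) * (t 0 i.succ + t i.succ 0)) := by
  have hs : (sgn s : 𝕜) * (sgn s : 𝕜) = 1 := by
    rw [← RCLike.ofReal_mul, sgn_mul_self, RCLike.ofReal_one]
  simp only [quad, Fin.sum_univ_succ, Fin.cons_zero, Fin.cons_succ, hs, one_mul,
    Finset.sum_add_distrib, mul_add]
  have e1 : ∀ x : Fin n, (sgn s : 𝕜) * (sgn (ε x) : 𝕜) * t 0 x.succ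
      = (sgn s : 𝕜) * ((sgn (ε x) : 𝕜) * t 0 x.succ) := fun x => by ring
  have e2 : ∀ x : Fin n, (sgn (ε x) : 𝕜) * (sgn s : 𝕜) * t x.succ 0
      = (sgn s : 𝕜) * ((sgn (ε x) : 𝕜) * t x.succ 0) := fun x => by ring
  simp only [e1, e2, ← Finset.mul_sum]
  ring

/-- Hypercontractivity for quadratic polynomials in signs, by induction on the number of signs: the
coefficient of the new sign is an affine function of the others. -/
theorem quad_fourth_moment_fin (n : ℕ) (d : 𝕜) (b : Fin n → 𝕜) (t : Fin n → Fin n → 𝕜) :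
    2 ^ n * ∑ ε, ‖quad d b t ε‖ ^ 4 ≤ 81 * (∑ ε, ‖quad d b t ε‖ ^ 2) ^ 2 := by
  induction n generalizing d with
  | zero =>
    simp only [quad, Finset.univ_eq_empty, Finset.sum_empty, add_zero, Finset.sum_const]
    simp only [Finset.card_univ, Fintype.card_pi, Finset.univ_eq_empty, Finset.prod_empty, one_smul]
    nlinarith [sq_nonneg (‖d‖ ^ 2)]
  | succ n ih =>
    have key := fourth_moment_step (C := 9) (N := 2 ^ n)
      (quad (d + t 0 0) (fun i => b i.succ) (fun i l => t i.succ l.succ))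
      (fun ε : Fin n → Bool => b 0 + ∑ i, (sgn (ε i) : 𝕜) * (t 0 i.succ + t i.succ 0))
      (by positivity) (by norm_num)
      (by
        refine (ih _ _ _).trans (le_of_eq ?_)
        norm_num)
      (linear_fourth_moment n _ _)
    simp only [sum_cube_succ, quad_cons]
    have e1 : (sgn true : 𝕜) = 1 := by simp [sgn]
    have e2 : (sgn false : 𝕜) = -1 := by simp [sgn]
    simp only [e1, e2, one_mul, neg_mul, ← sub_eq_add_neg]
    rw [pow_succ, mul_comm (2 ^ n : ℝ) 2]
    refine key.trans (le_of_eq ?_)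
    norm_num

theorem quad_fourth_moment {ι : Type*} [Fintype ι] [DecidableEq ι] (d : 𝕜) (b : ι → 𝕜)
    (t : ι → ι → 𝕜) :
    2 ^ Fintype.card ι * ∑ ε, ‖quad d b t ε‖ ^ 4 ≤ 81 * (∑ ε, ‖quad d b t ε‖ ^ 2) ^ 2 := by
  let σ := Fintype.equivFin ι
  have h := quad_fourth_moment_fin (Fintype.card ι) d (fun i => b (σ.symm i))
    (fun i l => t (σ.symm i) (σ.symm l))
  have e1 : ∀ ε : Fin (Fintype.card ι) → Bool,
      quad d (fun i => b (σ.symm i)) (fun i l => t (σ.symm i) (σ.symm l)) ε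
        = quad d b t ((σ.arrowCongr (Equiv.refl Bool)).symm ε) := fun ε => by
    simp only [quad]
    congr 1
    · congr 1
      rw [← σ.symm.sum_comp]
      simp [Equiv.arrowCongr]
    · rw [← σ.symm.sum_comp]
      refine Finset.sum_congr rfl fun i _ => ?_
      rw [← σ.symm.sum_comp]
      simp [Equiv.arrowCongr]
  simp only [e1] at h
  rw [(σ.arrowCongr (Equiv.refl Bool)).symm.sum_comp (fun ε => ‖quad d b t ε‖ ^ 4),
    (σ.arrowCongr (Equiv.refl Bool)).symm.sum_comp (fun ε => ‖quad d b t ε‖ ^ 2)] at h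
  exact h

/-- The Paley–Zygmund inequality for quadratic polynomials in signs: on a fixed proportion of the
cube, the square of the polynomial is at least half of its mean square. -/
theorem exists_quad_large {ι : Type*} [Fintype ι] [DecidableEq ι] (d : 𝕜) (b : ι → 𝕜)
    (t : ι → ι → 𝕜) :
    ∃ A : Finset (ι → Bool), (1 / 324 : ℝ) * 2 ^ Fintype.card ι ≤ A.card ∧
      ∀ ε ∈ A, ∑ η, ‖quad d b t η‖ ^ 2 ≤ 2 * 2 ^ Fintype.card ι * ‖quad d b t ε‖ ^ 2 := by
  set N : ℝ := 2 ^ Fintype.card ι with hN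
  have hN0 : 0 < N := by positivity
  have hcard : ((Finset.univ : Finset (ι → Bool)).card : ℝ) = N := by simp [hN]
  set S := ∑ η, ‖quad d b t η‖ ^ 2 with hS
  have hS0 : 0 ≤ S := Finset.sum_nonneg fun _ _ => by positivity
  refine ⟨Finset.univ.filter fun ε => S ≤ 2 * N * ‖quad d b t ε‖ ^ 2, ?_, fun ε hε =>
    (Finset.mem_filter.1 hε).2⟩
  set A := Finset.univ.filter fun ε => S ≤ 2 * N * ‖quad d b t ε‖ ^ 2
  have hsplit : ∑ ε ∈ A, ‖quad d b t ε‖ ^ 2 + ∑ ε ∈ Aᶜ, ‖quad d b t ε‖ ^ 2 = S :=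
    Finset.sum_add_sum_compl A _
  have hsmall : ∑ ε ∈ Aᶜ, ‖quad d b t ε‖ ^ 2 ≤ S / 2 := by
    calc ∑ ε ∈ Aᶜ, ‖quad d b t ε‖ ^ 2 ≤ ∑ ε ∈ Aᶜ, S / (2 * N) := by
          refine Finset.sum_le_sum fun ε hε => ?_
          rw [Finset.mem_compl, Finset.mem_filter] at hε
          push Not at hε
          rw [le_div_iff₀ (by positivity)]
          linarith [hε (Finset.mem_univ _)]
      _ ≤ ∑ ε : ι → Bool, S / (2 * N) :=
          Finset.sum_le_sum_of_subset_of_nonneg (Finset.subset_univ _) fun _ _ _ => by positivity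
      _ = S / 2 := by rw [Finset.sum_const, nsmul_eq_mul, hcard]; field_simp
  have hbig : S / 2 ≤ ∑ ε ∈ A, ‖quad d b t ε‖ ^ 2 := by linarith
  have hCS : (∑ ε ∈ A, ‖quad d b t ε‖ ^ 2) ^ 2 ≤ A.card * ∑ ε ∈ A, ‖quad d b t ε‖ ^ 4 := by
    have := Finset.sum_mul_sq_le_sq_mul_sq A (fun _ => (1 : ℝ)) (fun ε => ‖quad d b t ε‖ ^ 2)
    simpa [← pow_mul] using this
  have h4 : ∑ ε ∈ A, ‖quad d b t ε‖ ^ 4 ≤ ∑ ε, ‖quad d b t ε‖ ^ 4 :=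
    Finset.sum_le_sum_of_subset_of_nonneg (Finset.subset_univ _) fun _ _ _ => by positivity
  have h5 := quad_fourth_moment d b t
  rcases hS0.eq_or_lt with h0 | h0
  · have : A = Finset.univ := Finset.filter_true_of_mem fun ε _ => by rw [← h0]; positivity
    rw [this, hcard]; linarith
  · have h6 : N * (S / 2) ^ 2 ≤ A.card * (81 * S ^ 2) := by
      calc N * (S / 2) ^ 2 ≤ N * (∑ ε ∈ A, ‖quad d b t ε‖ ^ 2) ^ 2 := by gcongr
        _ ≤ N * (A.card * ∑ ε, ‖quad d b t ε‖ ^ 4) := by gcongr; exact hCS.trans (by gcongr)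
        _ = A.card * (N * ∑ ε, ‖quad d b t ε‖ ^ 4) := by ring
        _ ≤ _ := by gcongr
    have h7 : S ^ 2 * ((1 / 324) * N) ≤ S ^ 2 * A.card := by nlinarith
    exact le_of_mul_le_mul_left h7 (by positivity)

theorem sum_sgn_mul_sgn {ι : Type*} [Fintype ι] [DecidableEq ι] (i l : ι) :
    ∑ ε : ι → Bool, (sgn (ε i) : 𝕜) * (sgn (ε l) : 𝕜)
      = if i = l then 2 ^ Fintype.card ι else 0 := by
  split_ifs with h
  · subst h
    simp only [← RCLike.ofReal_mul, sgn_mul_self, RCLike.ofReal_one]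
    simp
  · refine sum_eq_zero_of_flip i _ fun ε => ?_
    rw [Function.update_self, Function.update_of_ne (Ne.symm h), sgn_not]
    push_cast; ring

/-- Anti-concentration of a decoupled form around its diagonal. -/
theorem exists_diag_le {ι : Type*} [Fintype ι] [DecidableEq ι] (t : ι → ι → 𝕜) :
    ∃ A : Finset (ι → Bool), (1 / 324 : ℝ) * Fintype.card (ι → Bool) ≤ A.card ∧
      ∀ ε ∈ A, ‖∑ i, t i i‖ ≤ 2 * ‖∑ i, ∑ l, (sgn (ε i) : 𝕜) * (sgn (ε l) : 𝕜) * t i l‖ := by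
  obtain ⟨A, hA, hA'⟩ := exists_quad_large (0 : 𝕜) (fun _ : ι => 0) t
  have hq : ∀ ε, quad (0 : 𝕜) (fun _ : ι => 0) t ε
      = ∑ i, ∑ l, (sgn (ε i) : 𝕜) * (sgn (ε l) : 𝕜) * t i l := fun ε => by simp [quad]
  refine ⟨A, by simpa using hA, fun ε hε => ?_⟩
  have h1 := hA' ε hε
  simp only [hq] at h1
  set N : ℝ := 2 ^ Fintype.card ι with hN
  have hN0 : 0 < N := by positivity
  have h2 : ∑ ε : ι → Bool, ∑ i, ∑ l, (sgn (ε i) : 𝕜) * (sgn (ε l) : 𝕜) * t i l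
      = (N : 𝕜) * ∑ i, t i i := by
    rw [hN, RCLike.ofReal_pow, RCLike.ofReal_ofNat, Finset.sum_comm, Finset.mul_sum]
    refine Finset.sum_congr rfl fun i _ => ?_
    rw [Finset.sum_comm]
    simp_rw [← Finset.sum_mul, sum_sgn_mul_sgn]
    simp
  have h3 : N * ‖∑ i, t i i‖
      ≤ ∑ ε : ι → Bool, ‖∑ i, ∑ l, (sgn (ε i) : 𝕜) * (sgn (ε l) : 𝕜) * t i l‖ := by
    have := norm_sum_le Finset.univ
      fun ε : ι → Bool => ∑ i, ∑ l, (sgn (ε i) : 𝕜) * (sgn (ε l) : 𝕜) * t i l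
    rwa [h2, norm_mul, RCLike.norm_ofReal, abs_of_pos hN0] at this
  have h4 : (∑ ε : ι → Bool, ‖∑ i, ∑ l, (sgn (ε i) : 𝕜) * (sgn (ε l) : 𝕜) * t i l‖) ^ 2
      ≤ N * ∑ ε : ι → Bool, ‖∑ i, ∑ l, (sgn (ε i) : 𝕜) * (sgn (ε l) : 𝕜) * t i l‖ ^ 2 := by
    have := Finset.sum_mul_sq_le_sq_mul_sq Finset.univ (fun _ : ι → Bool => (1 : ℝ))
      (fun ε => ‖∑ i, ∑ l, (sgn (ε i) : 𝕜) * (sgn (ε l) : 𝕜) * t i l‖)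
    simpa [hN] using this
  refine le_of_sq_le_sq ?_ (by positivity)
  have h5 : N ^ 2 * ‖∑ i, t i i‖ ^ 2
      ≤ N ^ 2 * (2 * ‖∑ i, ∑ l, (sgn (ε i) : 𝕜) * (sgn (ε l) : 𝕜) * t i l‖ ^ 2) := by
    calc _ = (N * ‖∑ i, t i i‖) ^ 2 := by ring
      _ ≤ _ := by gcongr
      _ ≤ _ := h4
      _ ≤ N * (2 * N * ‖∑ i, ∑ l, (sgn (ε i) : 𝕜) * (sgn (ε l) : 𝕜) * t i l‖ ^ 2) := by gcongr
      _ = _ := by ring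
  have h6 := le_of_mul_le_mul_left h5 (by positivity)
  nlinarith [sq_nonneg ‖∑ i, ∑ l, (sgn (ε i) : 𝕜) * (sgn (ε l) : 𝕜) * t i l‖]

theorem sum_norm_sq_sgn {ι : Type*} [Fintype ι] [DecidableEq ι] (c : ι → 𝕜) :
    ∑ ε : ι → Bool, ‖∑ i, (sgn (ε i) : 𝕜) * c i‖ ^ 2 = 2 ^ Fintype.card ι * ∑ i, ‖c i‖ ^ 2 := by
  have h1 : ∀ ε : ι → Bool, ((‖∑ i, (sgn (ε i) : 𝕜) * c i‖ ^ 2 : ℝ) : 𝕜)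
      = ∑ i, ∑ l, (sgn (ε i) : 𝕜) * (sgn (ε l) : 𝕜) * (c i * (starRingEnd 𝕜) (c l)) := fun ε => by
    rw [RCLike.ofReal_pow, ← RCLike.mul_conj, map_sum, Finset.sum_mul_sum]
    refine Finset.sum_congr rfl fun i _ => Finset.sum_congr rfl fun l _ => ?_
    rw [map_mul, RCLike.conj_ofReal]; ring
  have h2 : ((∑ ε : ι → Bool, ‖∑ i, (sgn (ε i) : 𝕜) * c i‖ ^ 2 : ℝ) : 𝕜)
      = ((2 ^ Fintype.card ι * ∑ i, ‖c i‖ ^ 2 : ℝ) : 𝕜) := by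
    rw [RCLike.ofReal_sum]
    simp_rw [h1]
    rw [Finset.sum_comm]
    push_cast
    rw [Finset.mul_sum]
    refine Finset.sum_congr rfl fun i _ => ?_
    rw [Finset.sum_comm]
    simp_rw [← Finset.sum_mul, sum_sgn_mul_sgn]
    simp [RCLike.mul_conj]
  exact RCLike.ofReal_injective h2

/-- On a fixed proportion of the cube, a linear form in signs is at least half its `L₂` norm. -/
theorem exists_linear_large {ι : Type*} [Fintype ι] [DecidableEq ι] (c : ι → 𝕜) :
    ∃ A : Finset (ι → Bool), (1 / 324 : ℝ) * Fintype.card (ι → Bool) ≤ A.card ∧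
      ∀ ε ∈ A, √(∑ i, ‖c i‖ ^ 2) ≤ 2 * ‖∑ i, (sgn (ε i) : 𝕜) * c i‖ := by
  obtain ⟨A, hA, hA'⟩ := exists_quad_large (0 : 𝕜) c (fun _ _ => 0)
  have hq : ∀ ε, quad (0 : 𝕜) c (fun _ _ => 0) ε = ∑ i, (sgn (ε i) : 𝕜) * c i := fun ε => by
    simp [quad]
  refine ⟨A, by simpa using hA, fun ε hε => ?_⟩
  have h1 := hA' ε hε
  simp only [hq] at h1
  rw [sum_norm_sq_sgn] at h1
  refine Real.sqrt_le_iff.2 ⟨by positivity, ?_⟩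
  have h2 : (2 : ℝ) ^ Fintype.card ι * ∑ i, ‖c i‖ ^ 2
      ≤ 2 ^ Fintype.card ι * (2 * ‖∑ i, (sgn (ε i) : 𝕜) * c i‖ ^ 2) := by linarith
  have h3 := le_of_mul_le_mul_left h2 (by positivity)
  nlinarith [sq_nonneg ‖∑ i, (sgn (ε i) : 𝕜) * c i‖]

/-- The Khinchine inequality between the first and the second moment. -/
theorem khinchine {ι : Type*} [Fintype ι] [DecidableEq ι] (c : ι → 𝕜) :
    2 ^ Fintype.card ι * √(∑ i, ‖c i‖ ^ 2)
      ≤ 648 * ∑ ε : ι → Bool, ‖∑ i, (sgn (ε i) : 𝕜) * c i‖ := by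
  obtain ⟨A, hA, hA'⟩ := exists_linear_large c
  have h1 : A.card * √(∑ i, ‖c i‖ ^ 2) ≤ 2 * ∑ ε ∈ A, ‖∑ i, (sgn (ε i) : 𝕜) * c i‖ := by
    rw [Finset.mul_sum, ← nsmul_eq_mul, ← Finset.sum_const]
    exact Finset.sum_le_sum hA'
  have h2 : ∑ ε ∈ A, ‖∑ i, (sgn (ε i) : 𝕜) * c i‖ ≤ ∑ ε : ι → Bool, ‖∑ i, (sgn (ε i) : 𝕜) * c i‖ :=
    Finset.sum_le_sum_of_subset_of_nonneg (Finset.subset_univ _) fun _ _ _ => norm_nonneg _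
  have h3 : (Fintype.card (ι → Bool) : ℝ) = 2 ^ Fintype.card ι := by simp
  rw [h3] at hA
  have h4 := mul_le_mul_of_nonneg_right hA (Real.sqrt_nonneg (∑ i, ‖c i‖ ^ 2))
  linarith

end Signs

/-! ### Disjointification -/

section Disjointification

open Filter

variable {𝕜 : Type v} [RCLike 𝕜] {X : Type u} [AddCommGroup X] [Module 𝕜 X]
  [UniformSpace X] [IsUniformAddGroup X] [ContinuousSMul 𝕜 X] [Norm X]
  [QuasiBanachSpace 𝕜 X] {J : Type*} {x : J → X} {e : J → X →L[𝕜] 𝕜} {K : ℝ}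
  {I : Type*} {u : I → X} {φ : I → X →L[𝕜] 𝕜} {K' : ℝ}

/-- The maximal function of an unconditional basic sequence: selecting at each coordinate `j` one
term of `∑ a i u i` costs only a constant, because a random choice of signs makes
`∑ ± a i u i` at least as large at `j`. -/
theorem exists_selection_bound (h : IsUncSystem x e K) (hL : IsLConvexBasis 𝕜 x)
    (hu : IsUncSystem u φ K') : ∃ C : ℝ, 0 < C ∧ ∀ (F : Finset I) (a : I → 𝕜) (D : Finset J)
      (s : J → I) (f : J → 𝕜), (∀ j ∈ D, s j ∈ F ∧ ‖f j‖ ≤ ‖a (s j)‖ * ‖e j (u (s j))‖) →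
        ‖∑ j ∈ D, f j • x j‖ ≤ C * ‖∑ i ∈ F, a i • u i‖ := by
  classical
  obtain ⟨C, hC0, hC⟩ := exists_lconvex_const h hL (δ := 1 / 324) (by norm_num)
  have hK' : 0 < K' := lt_of_lt_of_le one_pos hu.one_le
  refine ⟨C * (2 * K'), by positivity, fun F a D s f hf => ?_⟩
  rw [mul_assoc]
  refine hC (F → Bool) (fun ε => (2 : 𝕜) • ∑ i : F, ((sgn (ε i) : 𝕜) * a i) • u i) D f _
    (fun ε => ?_) fun j hj => ?_
  · rw [qnorm_smul 𝕜, RCLike.norm_ofNat, mul_assoc]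
    gcongr
    have e1 : ∑ i : F, ((sgn (ε i) : 𝕜) * a i) • u i
        = ∑ i ∈ F, (if hi : i ∈ F then (sgn (ε ⟨i, hi⟩) : 𝕜) * a i else 0) • u i := by
      rw [← Finset.sum_coe_sort F]
      refine Finset.sum_congr rfl fun i _ => ?_
      simp
    rw [e1]
    refine hu.norm_sum_le F _ _ fun i hi => ?_
    rw [hu.apply_sum, if_pos hi, dif_pos hi, norm_mul, norm_sgn, one_mul]
  · obtain ⟨A, hA, hA'⟩ := exists_linear_large fun i : F => a i * e j (u i)
    refine ⟨A, hA, fun ε hε => ?_⟩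
    obtain ⟨hs, hle⟩ := hf j hj
    have h1 : ‖f j‖ ≤ √(∑ i : F, ‖a i * e j (u i)‖ ^ 2) := by
      refine hle.trans ?_
      rw [← norm_mul]
      refine Real.le_sqrt_of_sq_le ?_
      exact Finset.single_le_sum (f := fun i : F => ‖a i * e j (u i)‖ ^ 2)
        (fun _ _ => by positivity) (Finset.mem_univ (⟨s j, hs⟩ : F))
    refine (h1.trans (hA' ε hε)).trans (le_of_eq ?_)
    rw [map_smul, norm_smul, RCLike.norm_ofNat, map_sum]
    congr 2
    refine Finset.sum_congr rfl fun i _ => ?_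
    rw [map_smul, smul_eq_mul, mul_assoc]

/-- The diagonal of the operator `f ↦ ∑ φ i (f) u i`. In a Banach space this is an average over
signs; here the coordinates of the diagonal are compared with those of a quadratic polynomial in
signs, which is rarely small compared with its mean. -/
theorem exists_diagonal_bound (h : IsUncSystem x e K) (htot : ∀ f, HasSum (fun j => e j f • x j) f)
    (hL : IsLConvexBasis 𝕜 x) (hu : IsUncSystem u φ K') :
    ∃ C : ℝ, 0 < C ∧ ∀ (F : Finset I) (c : I → 𝕜) (f : I → X) (t : ℝ), (∀ i, ‖c i‖ ≤ 1) →
      (∀ ε : I → Bool, ‖∑ i ∈ F, (sgn (ε i) : 𝕜) • f i‖ ≤ t) →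
        ‖∑ i ∈ F, (c i * φ i (f i)) • u i‖ ≤ C * t := by
  classical
  obtain ⟨C, hC0, hC⟩ := exists_lconvex_const h hL (δ := 1 / 324) (by norm_num)
  have hK' : 0 < K' := lt_of_lt_of_le one_pos hu.one_le
  have hκ := quasiConst_pos 𝕜 X
  refine ⟨quasiConst 𝕜 X * (C * (2 * K')), by positivity, fun F c f t hc ht => ?_⟩
  set d := ∑ i ∈ F, (c i * φ i (f i)) • u i with hd
  rw [mul_assoc]
  refine qnorm_le_of_tendsto 𝕜 (htot d) (Eventually.of_forall fun D => ?_)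
  rw [mul_assoc]
  let g : (F → Bool) → X := fun ε => ∑ l : F, (sgn (ε l) : 𝕜) • f l
  have hg : ∀ ε, ‖g ε‖ ≤ t := fun ε => by
    refine le_of_eq_of_le ?_ (ht fun i => if hi : i ∈ F then ε ⟨i, hi⟩ else true)
    rw [← Finset.sum_coe_sort F]
    simp [g]
  refine hC (F → Bool)
    (fun ε => (2 : 𝕜) • ∑ i : F, ((sgn (ε i) : 𝕜) * (c i * φ i (g ε))) • u i) D
    (fun j => e j d) _ (fun ε => ?_) fun j hj => ?_
  · rw [qnorm_smul 𝕜, RCLike.norm_ofNat, mul_assoc]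
    gcongr
    have e1 : ∑ i : F, ((sgn (ε i) : 𝕜) * (c i * φ i (g ε))) • u i
        = ∑ i ∈ F, (if hi : i ∈ F then (sgn (ε ⟨i, hi⟩) : 𝕜) * (c i * φ i (g ε)) else 0) • u i := by
      rw [← Finset.sum_coe_sort F]
      refine Finset.sum_congr rfl fun i _ => ?_
      simp
    rw [e1]
    refine (hu.norm_sum_le F _ (g ε) fun i hi => ?_).trans (by gcongr; exact hg ε)
    rw [dif_pos hi, norm_mul, norm_sgn, one_mul, norm_mul]
    exact mul_le_of_le_one_left (norm_nonneg _) (hc i)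
  · obtain ⟨A, hA, hA'⟩ := exists_diag_le fun i l : F => c i * φ i (f l) * e j (u i)
    refine ⟨A, hA, fun ε hε => ?_⟩
    refine le_of_eq_of_le ?_ ((hA' ε hε).trans (le_of_eq ?_))
    · rw [hd, map_sum, ← Finset.sum_coe_sort F]
      simp only [map_smul, smul_eq_mul]
    · rw [map_smul, norm_smul, RCLike.norm_ofNat, map_sum]
      congr 2
      refine Finset.sum_congr rfl fun i _ => ?_
      simp only [g, map_smul, map_sum, smul_eq_mul, Finset.mul_sum, Finset.sum_mul]
      exact Finset.sum_congr rfl fun l _ => by ring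

end Disjointification

/-! ### Random embeddings of Euclidean space -/

section RandomSigns

variable {ι : Type*} [Fintype ι] [DecidableEq ι] {n : ℕ}

/-- The squared Hilbert–Schmidt norm of the off-diagonal part of `∑ i, w i • (r i) (r i)ᵀ`, where
`r i` is the sign vector `k ↦ sgn (ω (i, k))`. -/
noncomputable def offDiag (w : ι → ℝ) (ω : ι × Fin n → Bool) : ℝ :=
  ∑ k, ∑ l, if k = l then 0 else (∑ i, w i * (sgn (ω (i, k)) * sgn (ω (i, l)))) ^ 2

omit [DecidableEq ι] in
theorem offDiag_nonneg (w : ι → ℝ) (ω : ι × Fin n → Bool) : 0 ≤ offDiag w ω := by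
  refine Finset.sum_nonneg fun k _ => Finset.sum_nonneg fun l _ => ?_
  split_ifs <;> positivity

/-- The mean of `offDiag w` over all signs; distinct coordinates of `r i` are uncorrelated. -/
theorem sum_offDiag_le (w : ι → ℝ) :
    ∑ ω : ι × Fin n → Bool, offDiag w ω
      ≤ Fintype.card (ι × Fin n → Bool) * (n ^ 2 * ∑ i, w i ^ 2) := by
  have key : ∀ k l : Fin n, k ≠ l →
      ∑ ω : ι × Fin n → Bool, (∑ i, w i * (sgn (ω (i, k)) * sgn (ω (i, l)))) ^ 2
        = Fintype.card (ι × Fin n → Bool) * ∑ i, w i ^ 2 := by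
    intro k l hkl
    simp_rw [sq, Finset.sum_mul_sum]
    rw [Finset.sum_comm, Finset.mul_sum]
    refine Finset.sum_congr rfl fun i _ => ?_
    rw [Finset.sum_comm, Finset.sum_eq_single i]
    · have : ∀ ω : ι × Fin n → Bool, w i * (sgn (ω (i, k)) * sgn (ω (i, l)))
          * (w i * (sgn (ω (i, k)) * sgn (ω (i, l)))) = w i * w i := fun ω => by
        have h1 := sgn_mul_self (ω (i, k))
        have h2 := sgn_mul_self (ω (i, l))
        calc _ = w i * w i * (sgn (ω (i, k)) * sgn (ω (i, k)))
              * (sgn (ω (i, l)) * sgn (ω (i, l))) := by ring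
          _ = _ := by rw [h1, h2]; ring
      simp_rw [this]
      rw [Finset.sum_const, nsmul_eq_mul, Finset.card_univ]
    · intro i' _ hne
      refine sum_eq_zero_of_flip (i, k) _ fun ω => ?_
      have e1 : (i, l) ≠ (i, k) := fun h => hkl (Prod.mk.inj h).2.symm
      have e2 : (i', k) ≠ (i, k) := fun h => hne (Prod.mk.inj h).1
      have e3 : (i', l) ≠ (i, k) := fun h => hne (Prod.mk.inj h).1
      rw [Function.update_self, Function.update_of_ne e1, Function.update_of_ne e2,
        Function.update_of_ne e3, sgn_not]
      ring
    · simp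
  have hS : 0 ≤ (Fintype.card (ι × Fin n → Bool) : ℝ) * ∑ i, w i ^ 2 := by
    have : 0 ≤ ∑ i, w i ^ 2 := Finset.sum_nonneg fun _ _ => sq_nonneg _
    positivity
  calc ∑ ω : ι × Fin n → Bool, offDiag w ω
      = ∑ k : Fin n, ∑ l : Fin n, ∑ ω : ι × Fin n → Bool,
        (if k = l then 0 else (∑ i, w i * (sgn (ω (i, k)) * sgn (ω (i, l)))) ^ 2) := by
        simp only [offDiag]
        rw [Finset.sum_comm]
        exact Finset.sum_congr rfl fun k _ => Finset.sum_comm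
    _ ≤ ∑ k : Fin n, ∑ l : Fin n, Fintype.card (ι × Fin n → Bool) * ∑ i, w i ^ 2 := by
        refine Finset.sum_le_sum fun k _ => Finset.sum_le_sum fun l _ => ?_
        by_cases h : k = l
        · simpa [h] using hS
        · simp only [h, if_false]; exact (key k l h).le
    _ = _ := by
        simp only [Finset.sum_const, Finset.card_univ, Fintype.card_fin, nsmul_eq_mul]; ring

variable {𝕜 : Type v} [RCLike 𝕜]

/-- The coordinate of `ξ` along the sign vector `k ↦ sgn (ω (i, k))`. -/
noncomputable def signDot (ω : ι × Fin n → Bool) (ξ : Fin n → 𝕜) (i : ι) : 𝕜 :=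
  ∑ k, (sgn (ω (i, k)) : 𝕜) * ξ k

omit [Fintype ι] [DecidableEq ι] in
theorem norm_signDot_sq_le (ω : ι × Fin n → Bool) (ξ : Fin n → 𝕜) (i : ι) :
    ‖signDot ω ξ i‖ ^ 2 ≤ n * ∑ k, ‖ξ k‖ ^ 2 := by
  have h1 : ‖signDot ω ξ i‖ ≤ ∑ k, ‖ξ k‖ := by
    refine (norm_sum_le _ _).trans (le_of_eq (Finset.sum_congr rfl fun k _ => ?_))
    rw [norm_mul, norm_sgn, one_mul]
  have h2 := Finset.sum_mul_sq_le_sq_mul_sq Finset.univ (fun _ : Fin n => (1 : ℝ)) (fun k => ‖ξ k‖)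
  simp only [one_mul, one_pow, Finset.sum_const, Finset.card_univ, Fintype.card_fin,
    nsmul_eq_mul, mul_one] at h2
  exact (pow_le_pow_left₀ (norm_nonneg _) h1 2).trans h2

omit [DecidableEq ι] in
/-- The quadratic form of `∑ i, w i • (r i) (r i)ᵀ` differs from that of its diagonal part, a
multiple of the identity, by at most the Hilbert–Schmidt norm of the rest. -/
theorem abs_sum_signDot_sub_le (w : ι → ℝ) (ω : ι × Fin n → Bool) (ξ : Fin n → 𝕜) :
    |∑ i, w i * ‖signDot ω ξ i‖ ^ 2 - (∑ i, w i) * ∑ k, ‖ξ k‖ ^ 2|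
      ≤ √(offDiag w ω) * ∑ k, ‖ξ k‖ ^ 2 := by
  set c : Fin n → Fin n → ℝ := fun k l => RCLike.re (ξ k * (starRingEnd 𝕜) (ξ l)) with hc
  have hcl : ∀ k l, |c k l| ≤ ‖ξ k‖ * ‖ξ l‖ := fun k l => by
    refine (RCLike.abs_re_le_norm _).trans ?_
    rw [norm_mul, RCLike.norm_conj]
  have hck : ∀ k, c k k = ‖ξ k‖ ^ 2 := fun k => by
    simp only [hc, RCLike.mul_conj]
    rw [← RCLike.ofReal_pow, RCLike.ofReal_re]
  have h1 : ∀ i, ‖signDot ω ξ i‖ ^ 2 = ∑ k, ∑ l, sgn (ω (i, k)) * sgn (ω (i, l)) * c k l := by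
    intro i
    have e1 : ((‖signDot ω ξ i‖ ^ 2 : ℝ) : 𝕜) = ∑ k, ∑ l,
        ((sgn (ω (i, k)) * sgn (ω (i, l)) : ℝ) : 𝕜) * (ξ k * (starRingEnd 𝕜) (ξ l)) := by
      rw [RCLike.ofReal_pow, ← RCLike.mul_conj, signDot, map_sum, Finset.sum_mul_sum]
      refine Finset.sum_congr rfl fun k _ => Finset.sum_congr rfl fun l _ => ?_
      rw [map_mul, RCLike.conj_ofReal]; push_cast; ring
    have e2 := congrArg RCLike.re e1
    rw [RCLike.ofReal_re] at e2
    rw [e2]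
    simp only [map_sum, RCLike.re_ofReal_mul, hc]
  set R : Fin n → Fin n → ℝ := fun k l => ∑ i, w i * (sgn (ω (i, k)) * sgn (ω (i, l))) with hR
  have h2 : ∑ i, w i * ‖signDot ω ξ i‖ ^ 2 = ∑ k, ∑ l, R k l * c k l := by
    simp_rw [h1, Finset.mul_sum]
    rw [Finset.sum_comm]
    refine Finset.sum_congr rfl fun k _ => ?_
    rw [Finset.sum_comm]
    refine Finset.sum_congr rfl fun l _ => ?_
    rw [hR, Finset.sum_mul]
    exact Finset.sum_congr rfl fun i _ => by ring
  have hRk : ∀ k, R k k = ∑ i, w i := fun k => by simp [hR, sgn_mul_self]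
  have h3 : (∑ i, w i) * ∑ k, ‖ξ k‖ ^ 2 = ∑ k, ∑ l, if k = l then R k l * c k l else 0 := by
    rw [Finset.mul_sum]
    refine Finset.sum_congr rfl fun k _ => ?_
    simp [hRk, hck]
  have h4 : ∑ i, w i * ‖signDot ω ξ i‖ ^ 2 - (∑ i, w i) * ∑ k, ‖ξ k‖ ^ 2
      = ∑ p : Fin n × Fin n, (if p.1 = p.2 then 0 else R p.1 p.2) * c p.1 p.2 := by
    rw [h2, h3, ← Finset.sum_sub_distrib, Fintype.sum_prod_type]
    refine Finset.sum_congr rfl fun k _ => ?_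
    rw [← Finset.sum_sub_distrib]
    refine Finset.sum_congr rfl fun l _ => ?_
    split_ifs <;> simp
  have h5 : offDiag w ω = ∑ p : Fin n × Fin n, (if p.1 = p.2 then 0 else R p.1 p.2) ^ 2 := by
    rw [offDiag, Fintype.sum_prod_type]
    refine Finset.sum_congr rfl fun k _ => Finset.sum_congr rfl fun l _ => ?_
    simp only
    split_ifs <;> simp [hR]
  have h6 : ∑ p : Fin n × Fin n, c p.1 p.2 ^ 2 ≤ (∑ k, ‖ξ k‖ ^ 2) ^ 2 := by
    rw [Fintype.sum_prod_type, sq (∑ k, ‖ξ k‖ ^ 2), Finset.sum_mul_sum]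
    refine Finset.sum_le_sum fun k _ => Finset.sum_le_sum fun l _ => ?_
    simp only
    rw [← mul_pow, ← sq_abs (c k l)]
    have := hcl k l
    gcongr
  have hξ : 0 ≤ ∑ k, ‖ξ k‖ ^ 2 := Finset.sum_nonneg fun _ _ => by positivity
  rw [h4, h5]
  refine (Finset.abs_sum_le_sum_abs _ _).trans ?_
  simp_rw [abs_mul]
  refine (Real.sum_mul_le_sqrt_mul_sqrt _ _ _).trans ?_
  simp_rw [sq_abs]
  gcongr
  exact Real.sqrt_le_iff.2 ⟨hξ, h6⟩

end RandomSigns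

section Selection

variable {ι : Type*} [Fintype ι] [DecidableEq ι] {J : Type*} [DecidableEq J]

omit [DecidableEq ι] in
/-- A union bound for the terms that are large compared with the square sum of their column: there
are at most `1 / t` of them, and each product is at most `m`. -/
theorem sum_heavy_le (a b : ι → ℝ) (H : Finset ι) {t m : ℝ} (ht : 0 < t) (hm : 0 ≤ m)
    (hH : ∀ i ∈ H, t * ∑ i, a i ^ 2 < a i ^ 2) (hab : ∀ i ∈ H, a i * b i ≤ m) :
    ∑ i ∈ H, a i * b i ≤ m / t := by
  have hS : 0 ≤ ∑ i, a i ^ 2 := Finset.sum_nonneg fun _ _ => sq_nonneg _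
  have h1 : (H.card : ℝ) * t ≤ 1 := by
    by_cases hne : H.Nonempty
    · have h2 : H.card * (t * ∑ i, a i ^ 2) ≤ ∑ i ∈ H, a i ^ 2 := by
        rw [← nsmul_eq_mul, ← Finset.sum_const]
        exact Finset.sum_le_sum fun i hi => (hH i hi).le
      have h3 : ∑ i ∈ H, a i ^ 2 ≤ ∑ i, a i ^ 2 :=
        Finset.sum_le_sum_of_subset_of_nonneg (Finset.subset_univ _) fun _ _ _ => sq_nonneg _
      have h4 : 0 < ∑ i, a i ^ 2 := by
        obtain ⟨i, hi⟩ := hne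
        refine lt_of_lt_of_le (lt_of_le_of_lt (by positivity) (hH i hi))
          (Finset.single_le_sum (f := fun i => a i ^ 2) (fun _ _ => sq_nonneg _)
            (Finset.mem_univ i))
      have h5 : (H.card * t) * ∑ i, a i ^ 2 ≤ 1 * ∑ i, a i ^ 2 := by linarith
      exact le_of_mul_le_mul_right h5 h4
    · rw [Finset.not_nonempty_iff_eq_empty.1 hne]; simp
  calc ∑ i ∈ H, a i * b i ≤ ∑ i ∈ H, m := Finset.sum_le_sum hab
    _ = H.card * m := by rw [Finset.sum_const, nsmul_eq_mul]
    _ ≤ m / t := by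
      rw [le_div_iff₀ ht]
      nlinarith

omit [DecidableEq ι] in
theorem sum_truncated_sq_le (a : ι → ℝ) {t : ℝ} (ht : 0 ≤ t) :
    ∑ i, (if a i ^ 2 ≤ t * ∑ l, a l ^ 2 then a i ^ 2 else 0) ^ 2
      ≤ t * (∑ l, a l ^ 2) ^ 2 := by
  have hS : 0 ≤ ∑ i, a i ^ 2 := Finset.sum_nonneg fun _ _ => sq_nonneg _
  calc ∑ i, (if a i ^ 2 ≤ t * ∑ l, a l ^ 2 then a i ^ 2 else 0) ^ 2
      ≤ ∑ i, (t * ∑ l, a l ^ 2) * a i ^ 2 := by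
        refine Finset.sum_le_sum fun i _ => ?_
        split_ifs with h
        · rw [sq (a i ^ 2)]
          gcongr
        · simp only [ne_eq, OfNat.ofNat_ne_zero, not_false_eq_true, zero_pow]; positivity
    _ = _ := by rw [← Finset.mul_sum]; ring

/-- Signs and index sets for a random embedding of `ℓ₂ⁿ`. Given matrices `A`, `B` whose columns
carry the square functions `(∑ i, A i j ^ 2)^½` and `(∑ i, B i j ^ 2)^½`, suppose that the products
`A i j * B i j` have row sums comparable with a probability `p` but that their column maxima have a
small sum. Then, off small index sets, both square functions of `i ↦ ⟨r i, ξ⟩ A i j` and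
`i ↦ ⟨r i, ξ⟩ B i j` are bounded by those of `A` and `B` times `‖ξ‖`. -/
theorem exists_random_signs {𝕜 : Type v} [RCLike 𝕜] {n : ℕ} (A B : ι → J → ℝ) (p : ι → ℝ)
    (G : ι → Finset J)
    (J0 : Finset J) (m : J → ℝ) {t η C : ℝ} (hA : ∀ i j, 0 ≤ A i j) (hB : ∀ i j, 0 ≤ B i j)
    (hG : ∀ i, G i ⊆ J0) (hp0 : ∀ i, 0 ≤ p i) (hp : ∑ i, p i = 1)
    (hlow : ∀ i, p i / 2 ≤ ∑ j ∈ G i, A i j * B i j) (hm0 : ∀ j, 0 ≤ m j)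
    (hm : ∀ i, ∀ j ∈ G i, A i j * B i j ≤ m j) (hmη : ∑ j ∈ J0, m j ≤ η)
    (hC : ∑ j ∈ J0, √(∑ i, A i j ^ 2) * √(∑ i, B i j ^ 2) ≤ C) (ht : 0 < t)
    (hθ : n ^ 2 * (2 * η + 2 * t * C) ≤ 1 / 16)
    (hlam : 4 * n * (2 * η / t + n ^ 2 * (2 * η + 2 * t * C)) ≤ 1 / 4) :
    ∃ (ω : ι × Fin n → Bool) (F : Finset ι) (D : ι → Finset J), (∀ i, D i ⊆ J0) ∧
      (∀ i ∈ F, p i ≤ 4 * ∑ j ∈ D i, A i j * B i j) ∧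
      (∀ j (ξ : Fin n → 𝕜), ∑ i, (if j ∈ D i then A i j ^ 2 * ‖signDot ω ξ i‖ ^ 2 else 0)
        ≤ 2 * (∑ i, A i j ^ 2) * ∑ k, ‖ξ k‖ ^ 2) ∧
      (∀ j (ξ : Fin n → 𝕜), ∑ i, (if j ∈ D i then B i j ^ 2 * ‖signDot ω ξ i‖ ^ 2 else 0)
        ≤ 2 * (∑ i, B i j ^ 2) * ∑ k, ‖ξ k‖ ^ 2) ∧
      ∀ ξ : Fin n → 𝕜, (∑ k, ‖ξ k‖ ^ 2) / 2 ≤ ∑ i ∈ F, p i * ‖signDot ω ξ i‖ ^ 2 := by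
  classical
  set θ : ℝ := n ^ 2 * (2 * η + 2 * t * C) with hθdef
  set S : J → ℝ := fun j => ∑ i, A i j ^ 2 with hS
  set R : J → ℝ := fun j => ∑ i, B i j ^ 2 with hR
  have hS0 : ∀ j, 0 ≤ S j := fun j => Finset.sum_nonneg fun _ _ => sq_nonneg _
  have hR0 : ∀ j, 0 ≤ R j := fun j => Finset.sum_nonneg fun _ _ => sq_nonneg _
  set μ : J → ℝ := fun j => √(S j) * √(R j) with hμ
  have hμ0 : ∀ j, 0 ≤ μ j := fun j => by positivity
  have hAB : ∀ i j, 0 ≤ A i j * B i j := fun i j => mul_nonneg (hA i j) (hB i j)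
  let wA : J → ι → ℝ := fun j i => if A i j ^ 2 ≤ t * S j then A i j ^ 2 else 0
  let wB : J → ι → ℝ := fun j i => if B i j ^ 2 ≤ t * R j then B i j ^ 2 else 0
  have hwA : ∀ j, ∑ i, wA j i ^ 2 ≤ t * S j ^ 2 := fun j => sum_truncated_sq_le _ ht.le
  have hwB : ∀ j, ∑ i, wB j i ^ 2 ≤ t * R j ^ 2 := fun j => sum_truncated_sq_le _ ht.le
  have hwA1 : ∀ j, ∑ i, wA j i ≤ S j := fun j => Finset.sum_le_sum fun i _ => by
    simp only [wA]; split_ifs; exacts [le_rfl, sq_nonneg _]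
  have hwB1 : ∀ j, ∑ i, wB j i ≤ R j := fun j => Finset.sum_le_sum fun i _ => by
    simp only [wB]; split_ifs; exacts [le_rfl, sq_nonneg _]
  have hpη : ∑ i, p i ^ 2 ≤ 2 * η := by
    have h1 : ∀ i, p i ≤ 2 * η := fun i => by
      have : ∑ j ∈ G i, A i j * B i j ≤ ∑ j ∈ J0, m j :=
        (Finset.sum_le_sum (hm i)).trans
          (Finset.sum_le_sum_of_subset_of_nonneg (hG i) fun j _ _ => hm0 j)
      have := hlow i
      linarith
    calc ∑ i, p i ^ 2 ≤ ∑ i, 2 * η * p i := Finset.sum_le_sum fun i _ => by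
          rw [sq]; exact mul_le_mul_of_nonneg_right (h1 i) (hp0 i)
      _ = 2 * η := by rw [← Finset.mul_sum, hp, mul_one]
  -- first moment method: some choice of signs makes the off-diagonal parts small for `p` and, on
  -- average with respect to `μ`, for the light entries of the columns of `A` and `B`; in columns
  -- with `S j = 0` or `R j = 0` the quotients are zero, and so is `μ j`
  obtain ⟨ω, -, hω⟩ : ∃ ω ∈ (Finset.univ : Finset (ι × Fin n → Bool)), offDiag p ω
      + ∑ j ∈ J0, μ j * (offDiag (wA j) ω / S j ^ 2 + offDiag (wB j) ω / R j ^ 2) ≤ θ := by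
    refine Finset.exists_le_of_sum_le Finset.univ_nonempty ?_
    rw [Finset.sum_const, nsmul_eq_mul, Finset.card_univ]
    set N : ℝ := (Fintype.card (ι × Fin n → Bool) : ℝ) with hN
    have hN0 : 0 ≤ N := by positivity
    rw [Finset.sum_add_distrib, Finset.sum_comm]
    have e1 : ∑ ω : ι × Fin n → Bool, offDiag p ω ≤ N * (n ^ 2 * (2 * η)) :=
      (sum_offDiag_le p).trans (by gcongr)
    have e2 : ∀ (w : ι → ℝ) (s : ℝ), ∑ i, w i ^ 2 ≤ t * s ^ 2 →
        ∑ ω : ι × Fin n → Bool, offDiag w ω / s ^ 2 ≤ N * (n ^ 2 * t) := by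
      intro w s hws
      rw [← Finset.sum_div]
      by_cases hs : s = 0
      · rw [hs]; simp only [ne_eq, OfNat.ofNat_ne_zero, not_false_eq_true, zero_pow, div_zero]
        positivity
      · rw [div_le_iff₀ (by positivity)]
        calc _ ≤ N * (n ^ 2 * ∑ i, w i ^ 2) := sum_offDiag_le w
          _ ≤ N * (n ^ 2 * (t * s ^ 2)) := by gcongr
          _ = _ := by ring
    have e3 : ∑ j ∈ J0, ∑ ω : ι × Fin n → Bool,
        μ j * (offDiag (wA j) ω / S j ^ 2 + offDiag (wB j) ω / R j ^ 2)
          ≤ N * (n ^ 2 * (2 * t * C)) := by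
      calc _ ≤ ∑ j ∈ J0, μ j * (N * (n ^ 2 * t) + N * (n ^ 2 * t)) := by
            refine Finset.sum_le_sum fun j _ => ?_
            rw [← Finset.mul_sum, Finset.sum_add_distrib]
            have := e2 _ _ (hwA j)
            have := e2 _ _ (hwB j)
            have := hμ0 j
            gcongr
        _ = (N * (n ^ 2 * (2 * t))) * ∑ j ∈ J0, μ j := by rw [← Finset.sum_mul]; ring
        _ ≤ (N * (n ^ 2 * (2 * t))) * C := by gcongr
        _ = _ := by ring
    calc _ ≤ N * (n ^ 2 * (2 * η)) + N * (n ^ 2 * (2 * t * C)) := add_le_add e1 e3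
      _ = N * θ := by rw [hθdef]; ring
  have hterm : ∀ j, 0 ≤ μ j * (offDiag (wA j) ω / S j ^ 2 + offDiag (wB j) ω / R j ^ 2) :=
    fun j => by
      have := hμ0 j
      have := offDiag_nonneg (wA j) ω
      have := offDiag_nonneg (wB j) ω
      positivity
  have hoffp : offDiag p ω ≤ θ := by
    have : 0 ≤ ∑ j ∈ J0, μ j * (offDiag (wA j) ω / S j ^ 2 + offDiag (wB j) ω / R j ^ 2) :=
      Finset.sum_nonneg fun j _ => hterm j
    linarith
  -- columns in which both truncated quadratic forms are controlled
  let good : J → Prop := fun j => offDiag (wA j) ω ≤ S j ^ 2 ∧ offDiag (wB j) ω ≤ R j ^ 2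
  have hbad : ∑ j ∈ J0, (if good j then 0 else μ j) ≤ θ := by
    refine le_trans (Finset.sum_le_sum fun j _ => ?_) (le_trans (le_add_of_nonneg_left
      (offDiag_nonneg p ω)) hω)
    split_ifs with hg
    · exact hterm j
    · by_cases hz : S j = 0 ∨ R j = 0
      · have : μ j = 0 := by rcases hz with hz | hz <;> simp [hμ, hz]
        rw [this, zero_mul]
      · push Not at hz
        have hSj : 0 < S j ^ 2 := by have := hz.1; positivity
        have hRj : 0 < R j ^ 2 := by have := hz.2; positivity
        refine le_mul_of_one_le_right (hμ0 j) ?_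
        have h1 := div_nonneg (offDiag_nonneg (wA j) ω) hSj.le
        have h2 := div_nonneg (offDiag_nonneg (wB j) ω) hRj.le
        by_cases hg1 : offDiag (wA j) ω ≤ S j ^ 2
        · have hg2 : R j ^ 2 < offDiag (wB j) ω := by
            by_contra hcon
            exact hg ⟨hg1, not_lt.1 hcon⟩
          have := (one_lt_div hRj).2 hg2
          linarith
        · have := (one_lt_div hSj).2 (not_le.1 hg1)
          linarith
  let D : ι → Finset J := fun i =>
    (G i).filter fun j => A i j ^ 2 ≤ t * S j ∧ B i j ^ 2 ≤ t * R j ∧ good j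
  -- the mass lost in row `i` by discarding heavy entries and bad columns
  let L : ι → J → ℝ := fun i j => if j ∈ G i ∧ j ∉ D i then A i j * B i j else 0
  have hL0 : ∀ i j, 0 ≤ L i j := fun i j => by
    simp only [L]; split_ifs; exacts [hAB i j, le_rfl]
  have hLj : ∀ j, ∑ i, L i j ≤ 2 * (m j / t) + if good j then 0 else μ j := by
    intro j
    have e1 := sum_heavy_le (fun i => A i j) (fun i => B i j)
      (Finset.univ.filter fun i => j ∈ G i ∧ t * S j < A i j ^ 2) ht (hm0 j)
      (fun i hi => (Finset.mem_filter.1 hi).2.2) (fun i hi => hm i j (Finset.mem_filter.1 hi).2.1)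
    have e2 := sum_heavy_le (fun i => B i j) (fun i => A i j)
      (Finset.univ.filter fun i => j ∈ G i ∧ t * R j < B i j ^ 2) ht (hm0 j)
      (fun i hi => (Finset.mem_filter.1 hi).2.2)
      (fun i hi => by rw [mul_comm]; exact hm i j (Finset.mem_filter.1 hi).2.1)
    have e3 : ∑ i, A i j * B i j ≤ μ j := Real.sum_mul_le_sqrt_mul_sqrt _ _ _
    have e4 : (∑ i, if good j then 0 else A i j * B i j) ≤ if good j then 0 else μ j := by
      split_ifs
      · simp
      · exact e3
    rw [Finset.sum_filter] at e1 e2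
    refine le_trans ?_ (le_of_le_of_eq (add_le_add (add_le_add e1 e2) e4) (by ring))
    rw [← Finset.sum_add_distrib, ← Finset.sum_add_distrib]
    refine Finset.sum_le_sum fun i _ => ?_
    have h0 := hAB i j
    have h0' : 0 ≤ B i j * A i j := by rw [mul_comm]; exact h0
    by_cases hc : j ∈ G i ∧ j ∉ D i
    · simp only [L, hc, not_false_eq_true, and_self, if_true, true_and]
      have hnd := hc.2
      simp only [D, Finset.mem_filter, hc.1, true_and] at hnd
      by_cases h1 : A i j ^ 2 ≤ t * S j
      · by_cases h2 : B i j ^ 2 ≤ t * R j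
        · have h3 : ¬ good j := fun h3 => hnd ⟨h1, h2, h3⟩
          simp [not_lt.2 h1, not_lt.2 h2, h3]
        · rw [if_pos (not_le.1 h2), mul_comm (B i j)]
          have : 0 ≤ (if t * S j < A i j ^ 2 then A i j * B i j else 0) := by
            split_ifs; exacts [h0, le_rfl]
          have : 0 ≤ (if good j then 0 else A i j * B i j) := by split_ifs; exacts [le_rfl, h0]
          linarith
      · rw [if_pos (not_le.1 h1)]
        have : 0 ≤ (if t * R j < B i j ^ 2 then B i j * A i j else 0) := by
          split_ifs; exacts [h0', le_rfl]
        have : 0 ≤ (if good j then 0 else A i j * B i j) := by split_ifs; exacts [le_rfl, h0]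
        linarith
    · simp only [L, hc, if_false]
      have : 0 ≤ (if j ∈ G i ∧ t * S j < A i j ^ 2 then A i j * B i j else 0) := by
        split_ifs; exacts [h0, le_rfl]
      have : 0 ≤ (if j ∈ G i ∧ t * R j < B i j ^ 2 then B i j * A i j else 0) := by
        split_ifs; exacts [h0', le_rfl]
      have : 0 ≤ (if good j then 0 else A i j * B i j) := by split_ifs; exacts [le_rfl, h0]
      linarith
  have hLsum : ∑ i, ∑ j ∈ J0, L i j ≤ 2 * η / t + θ := by
    rw [Finset.sum_comm]
    calc _ ≤ ∑ j ∈ J0, (2 * (m j / t) + if good j then 0 else μ j) :=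
          Finset.sum_le_sum fun j _ => hLj j
      _ = 2 * (∑ j ∈ J0, m j) / t + ∑ j ∈ J0, (if good j then 0 else μ j) := by
          rw [Finset.sum_add_distrib, ← Finset.mul_sum, ← Finset.sum_div, mul_div_assoc]
      _ ≤ _ := by gcongr
  have hsplit : ∀ i, ∑ j ∈ G i, A i j * B i j = ∑ j ∈ D i, A i j * B i j + ∑ j ∈ J0, L i j := by
    intro i
    have e1 : ∑ j ∈ J0, L i j = ∑ j ∈ G i \ D i, A i j * B i j := by
      simp only [L]
      rw [← Finset.sum_filter]
      refine Finset.sum_congr ?_ fun _ _ => rfl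
      ext j
      simp only [Finset.mem_filter, Finset.mem_sdiff, and_iff_right_iff_imp, and_imp]
      exact fun hj _ => hG i hj
    rw [e1, add_comm]
    exact (Finset.sum_sdiff (Finset.filter_subset _ _)).symm
  set F : Finset ι := Finset.univ.filter fun i => ∑ j ∈ J0, L i j ≤ p i / 4 with hF
  have hquad : ∀ (w : ι → ℝ) (s : ℝ) (ξ : Fin n → 𝕜), 0 ≤ s → ∑ i, w i ≤ s →
      offDiag w ω ≤ s ^ 2 → ∑ i, w i * ‖signDot ω ξ i‖ ^ 2 ≤ 2 * s * ∑ k, ‖ξ k‖ ^ 2 := by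
    intro w s ξ hs hws hoff
    have hξ : 0 ≤ ∑ k, ‖ξ k‖ ^ 2 := Finset.sum_nonneg fun _ _ => by positivity
    have h1 := (abs_le.1 (abs_sum_signDot_sub_le w ω ξ)).2
    have h2 : √(offDiag w ω) ≤ s := Real.sqrt_le_iff.2 ⟨hs, hoff⟩
    have h3 := mul_le_mul_of_nonneg_right h2 hξ
    have h4 := mul_le_mul_of_nonneg_right hws hξ
    linarith
  refine ⟨ω, F, D, fun i => (Finset.filter_subset _ _).trans (hG i), fun i hi => ?_, fun j ξ => ?_,
    fun j ξ => ?_, fun ξ => ?_⟩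
  · have h1 := (Finset.mem_filter.1 hi).2
    have h2 := hsplit i
    have h3 := hlow i
    linarith
  · by_cases hj : ∃ i, j ∈ D i
    · obtain ⟨i0, hi0⟩ := hj
      have hg : good j := (Finset.mem_filter.1 hi0).2.2.2
      refine le_trans (Finset.sum_le_sum fun i _ => ?_) (hquad (wA j) (S j) ξ (hS0 j) (hwA1 j) hg.1)
      split_ifs with hji
      · have h1 := (Finset.mem_filter.1 hji).2.1
        simp only [wA, h1, if_true]
        exact le_rfl
      · have : 0 ≤ wA j i := by simp only [wA]; split_ifs; exacts [sq_nonneg _, le_rfl]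
        positivity
    · push Not at hj
      simp only [hj, if_false, Finset.sum_const_zero]
      have := hS0 j
      have : 0 ≤ ∑ k, ‖ξ k‖ ^ 2 := Finset.sum_nonneg fun _ _ => by positivity
      positivity
  · by_cases hj : ∃ i, j ∈ D i
    · obtain ⟨i0, hi0⟩ := hj
      have hg : good j := (Finset.mem_filter.1 hi0).2.2.2
      refine le_trans (Finset.sum_le_sum fun i _ => ?_) (hquad (wB j) (R j) ξ (hR0 j) (hwB1 j) hg.2)
      split_ifs with hji
      · have h1 := (Finset.mem_filter.1 hji).2.2.1
        simp only [wB, h1, if_true]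
        exact le_rfl
      · have : 0 ≤ wB j i := by simp only [wB]; split_ifs; exacts [sq_nonneg _, le_rfl]
        positivity
    · push Not at hj
      simp only [hj, if_false, Finset.sum_const_zero]
      have := hR0 j
      have : 0 ≤ ∑ k, ‖ξ k‖ ^ 2 := Finset.sum_nonneg fun _ _ => by positivity
      positivity
  · set q := ∑ k, ‖ξ k‖ ^ 2 with hq
    have hq0 : 0 ≤ q := Finset.sum_nonneg fun _ _ => by positivity
    have h1 := (abs_le.1 (abs_sum_signDot_sub_le p ω ξ)).1
    rw [hp, one_mul] at h1
    have h2 : √(offDiag p ω) ≤ 1 / 4 :=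
      Real.sqrt_le_iff.2 ⟨by norm_num, (hoffp.trans hθ).trans (by norm_num)⟩
    have h3 := mul_le_mul_of_nonneg_right h2 hq0
    have h4 : ∑ i ∈ F, p i * ‖signDot ω ξ i‖ ^ 2 + ∑ i ∈ Fᶜ, p i * ‖signDot ω ξ i‖ ^ 2
        = ∑ i, p i * ‖signDot ω ξ i‖ ^ 2 := Finset.sum_add_sum_compl F _
    have h5 : ∑ i ∈ Fᶜ, p i ≤ 4 * (2 * η / t + θ) := by
      calc ∑ i ∈ Fᶜ, p i ≤ ∑ i ∈ Fᶜ, 4 * ∑ j ∈ J0, L i j := Finset.sum_le_sum fun i hi => by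
            rw [Finset.mem_compl, Finset.mem_filter] at hi
            push Not at hi
            have := hi (Finset.mem_univ _)
            linarith
        _ ≤ ∑ i, 4 * ∑ j ∈ J0, L i j :=
            Finset.sum_le_sum_of_subset_of_nonneg (Finset.subset_univ _) fun i _ _ =>
              mul_nonneg (by norm_num) (Finset.sum_nonneg fun j _ => hL0 i j)
        _ ≤ _ := by rw [← Finset.mul_sum]; gcongr
    have h6 : ∑ i ∈ Fᶜ, p i * ‖signDot ω ξ i‖ ^ 2 ≤ 1 / 4 * q := by
      calc _ ≤ ∑ i ∈ Fᶜ, p i * (n * q) := Finset.sum_le_sum fun i _ =>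
            mul_le_mul_of_nonneg_left (norm_signDot_sq_le ω ξ i) (hp0 i)
        _ = (∑ i ∈ Fᶜ, p i) * (n * q) := by rw [Finset.sum_mul]
        _ ≤ (4 * (2 * η / t + θ)) * (n * q) := by gcongr
        _ = (4 * n * (2 * η / t + θ)) * q := by ring
        _ ≤ _ := by gcongr
    linarith

end Selection

/-! ### The Banach envelope -/

section Envelope

variable {𝕜 : Type v} [RCLike 𝕜] {X : Type u} [AddCommGroup X] [Module 𝕜 X] [Norm X]
  {E : Type u} [NormedAddCommGroup E] [NormedSpace 𝕜 E] [CompleteSpace E] {JX : X →ₗ[𝕜] E}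

/-- The target space `Z` is transported to a linear copy `Z'` in the universe of `X`. -/
theorem IsBanachEnvelope.exists_extension_of_equiv (hJ : IsBanachEnvelope JX) {Z : Type*}
    [NormedAddCommGroup Z] [NormedSpace 𝕜 Z] [CompleteSpace Z] {Z' : Type u} [AddCommGroup Z']
    [Module 𝕜 Z'] (e : Z' ≃ₗ[𝕜] Z) (R : X →ₗ[𝕜] Z)
    {M : ℝ} (hM : 0 < M) (hR : ∀ f, ‖R f‖ ≤ M * ‖f‖) :
    ∃ S : E →L[𝕜] Z, (∀ y, ‖S y‖ ≤ M * ‖y‖) ∧ ∀ f, S (JX f) = R f := by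
  let _ : NormedAddCommGroup Z' := NormedAddCommGroup.induced Z' Z e e.injective
  let _ : NormedSpace 𝕜 Z' := NormedSpace.induced 𝕜 Z' Z e
  have he : ∀ z, ‖e z‖ = ‖z‖ := fun z => rfl
  let e' : Z' ≃ₗᵢ[𝕜] Z := ⟨e, he⟩
  have : CompleteSpace Z' := (completeSpace_congr (e := e'.toEquiv)
    e'.isometry.isUniformEmbedding).2 inferInstance
  obtain ⟨S, ⟨hS1, hS2⟩, -⟩ := hJ.2 Z'
    (((M⁻¹ : ℝ) : 𝕜) • (e.symm.toLinearMap ∘ₗ R)) (fun f => by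
      have h1 : ‖e.symm (R f)‖ = ‖R f‖ := by rw [← he, e.apply_symm_apply]
      simp only [LinearMap.smul_apply, LinearMap.comp_apply, LinearEquiv.coe_coe]
      rw [norm_smul, RCLike.norm_ofReal, abs_of_pos (by positivity), h1, inv_mul_le_iff₀ hM]
      exact hR f)
  let S' : E →ₗ[𝕜] Z := ((M : ℝ) : 𝕜) • (e.toLinearMap ∘ₗ S)
  have hS' : ∀ y, ‖S' y‖ ≤ M * ‖y‖ := fun y => by
    simp only [S', LinearMap.smul_apply, LinearMap.comp_apply, LinearEquiv.coe_coe]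
    rw [norm_smul, RCLike.norm_ofReal, abs_of_pos hM, he]
    have := hS1 y
    gcongr
  refine ⟨S'.mkContinuous M hS', hS', fun f => ?_⟩
  have h2 : S (JX f) = ((M⁻¹ : ℝ) : 𝕜) • e.symm (R f) := by
    have := LinearMap.congr_fun hS2 f
    simpa using this
  change ((M : ℝ) : 𝕜) • e (S (JX f)) = R f
  rw [h2, map_smul, e.apply_symm_apply, smul_smul, ← RCLike.ofReal_mul, mul_inv_cancel₀ hM.ne',
    RCLike.ofReal_one, one_smul]

/-- Bounded maps into Banach spaces extend to the envelope. The target may live in another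
universe, provided that it has a copy in the universe of `X`. -/
theorem IsBanachEnvelope.exists_extension (hJ : IsBanachEnvelope JX) {Z : Type*}
    [NormedAddCommGroup Z] [NormedSpace 𝕜 Z] [CompleteSpace Z] [Small.{u} Z] (R : X →ₗ[𝕜] Z)
    {M : ℝ} (hM : 0 < M) (hR : ∀ f, ‖R f‖ ≤ M * ‖f‖) :
    ∃ S : E →L[𝕜] Z, (∀ y, ‖S y‖ ≤ M * ‖y‖) ∧ ∀ f, S (JX f) = R f :=
  hJ.exists_extension_of_equiv (Shrink.linearEquiv 𝕜 Z) R hM hR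

/-- Bounded operators on `X` are bounded for the seminorm of the envelope, with the same
constant. -/
theorem IsBanachEnvelope.norm_map_le (hJ : IsBanachEnvelope JX) (R : X →ₗ[𝕜] X) {M : ℝ}
    (hM : 0 < M) (hR : ∀ f, ‖R f‖ ≤ M * ‖f‖) (f : X) : ‖JX (R f)‖ ≤ M * ‖JX f‖ := by
  obtain ⟨S, hS, hS'⟩ := hJ.exists_extension (JX ∘ₗ R) hM fun f => (hJ.1 _).trans (hR f)
  have := hS (JX f)
  rwa [hS'] at this

variable [UniformSpace X] {J : Type*} {x : J → X} {e : J → X →L[𝕜] 𝕜} {K : ℝ}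

/-- Domination of coefficients gives domination of norms in the envelope. -/
theorem IsBanachEnvelope.norm_map_sum_le (hJ : IsBanachEnvelope JX) (h : IsUncSystem x e K)
    (D : Finset J) (f : J → 𝕜) (g : X) (hf : ∀ j ∈ D, ‖f j‖ ≤ ‖e j g‖) :
    ‖JX (∑ j ∈ D, f j • x j)‖ ≤ K * ‖JX g‖ := by
  obtain ⟨c, hc, hs⟩ := exists_multiplier (x := x) D f g hf
  rw [hs]
  have := hJ.norm_map_le (∑ j ∈ D, (c j • (e j).toLinearMap).smulRight (x j))
    (lt_of_lt_of_le one_pos h.one_le) (fun f => by simpa using h.bound D c f hc) g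
  simpa using this

end Envelope

/-! ### Square functions -/

section SquareFunction

variable {𝕜 : Type v} [RCLike 𝕜] {X : Type u} [AddCommGroup X] [Module 𝕜 X] [Norm X]
  [UniformSpace X]
  {E : Type u} [NormedAddCommGroup E] [NormedSpace 𝕜 E] [CompleteSpace E] {JX : X →ₗ[𝕜] E}
  {J : Type*} {x : J → X} {e : J → X →L[𝕜] 𝕜} {K : ℝ}
  {ι : Type*} [Fintype ι] {u : ι → X} {φ : ι → X →L[𝕜] 𝕜}

theorem exists_norm_le_one_mul_eq (z : 𝕜) : ∃ c : 𝕜, ‖c‖ ≤ 1 ∧ c * z = ‖z‖ := by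
  by_cases hz : z = 0
  · exact ⟨0, by simp, by simp [hz]⟩
  · have h1 : (‖z‖ : 𝕜) ≠ 0 := by
      rw [RCLike.ofReal_ne_zero]; exact norm_ne_zero_iff.2 hz
    refine ⟨(starRingEnd 𝕜) z / ‖z‖, ?_, ?_⟩
    · rw [norm_div, RCLike.norm_conj, RCLike.norm_ofReal, abs_norm]
      exact div_self_le_one _
    · rw [div_mul_eq_mul_div, RCLike.conj_mul, sq, mul_div_assoc, div_self h1, mul_one]

/-- The square functions of a vector `∑ a i u i` and of a functional `∑ b i φ i` pair at most like
their norms in the envelope and its dual. -/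
theorem IsBanachEnvelope.sum_sqrt_mul_sqrt_le (hJ : IsBanachEnvelope JX) (hx : IsUncSystem x e K)
    (hu : IsUncSystem u φ K) (D : Finset J) (a : ι → 𝕜) (b : ι → ℝ) {M : ℝ} (hM : 0 ≤ M)
    (hb : ∀ g, ∑ i, b i * ‖φ i g‖ ≤ M * ‖JX g‖) (hb0 : ∀ i, 0 ≤ b i) :
    ∑ j ∈ D, √(∑ i, (‖a i‖ * ‖e j (u i)‖) ^ 2) * √(∑ i, (b i * ‖φ i (x j)‖) ^ 2)
      ≤ 648 ^ 2 * K ^ 2 * M * ‖JX (∑ i, a i • u i)‖ := by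
  classical
  have hK : 0 ≤ K := zero_le_one.trans hx.one_le
  set N : ℝ := 2 ^ Fintype.card ι with hN
  have hN0 : 0 < N := by positivity
  let f : (ι → Bool) → X := fun ε => ∑ i, ((sgn (ε i) : 𝕜) * a i) • u i
  let ψ : (ι → Bool) → X → 𝕜 := fun η g => ∑ i, (sgn (η i) : 𝕜) * ((b i : 𝕜) * φ i g)
  have key : ∀ ε η, ∑ j ∈ D, ‖e j (f ε)‖ * ‖ψ η (x j)‖ ≤ K ^ 2 * M * ‖JX (∑ i, a i • u i)‖ := by
    intro ε η
    choose c hc hc' using fun j => exists_norm_le_one_mul_eq (e j (f ε) * ψ η (x j))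
    have h1 : ψ η (∑ j ∈ D, (c j * e j (f ε)) • x j)
        = ((∑ j ∈ D, ‖e j (f ε)‖ * ‖ψ η (x j)‖ : ℝ) : 𝕜) := by
      push_cast
      have : ∀ j, (‖e j (f ε)‖ : 𝕜) * ‖ψ η (x j)‖ = (c j * e j (f ε)) * ψ η (x j) := fun j => by
        rw [mul_assoc, hc', norm_mul, RCLike.ofReal_mul]
      simp_rw [this]
      simp only [ψ, map_sum, map_smul, smul_eq_mul, Finset.mul_sum]
      rw [Finset.sum_comm]
      exact Finset.sum_congr rfl fun j _ => Finset.sum_congr rfl fun i _ => by ring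
    have h2 : ∀ g, ‖ψ η g‖ ≤ M * ‖JX g‖ := fun g => by
      refine (norm_sum_le _ _).trans ((Finset.sum_le_sum fun i _ => ?_).trans (hb g))
      rw [norm_mul, norm_sgn, one_mul, norm_mul, RCLike.norm_ofReal, abs_of_nonneg (hb0 i)]
    have h3 : ‖JX (∑ j ∈ D, (c j * e j (f ε)) • x j)‖ ≤ K * ‖JX (f ε)‖ :=
      hJ.norm_map_sum_le hx D _ _ fun j _ => by
        rw [norm_mul]; exact mul_le_of_le_one_left (norm_nonneg _) (hc j)
    have h4 : ‖JX (f ε)‖ ≤ K * ‖JX (∑ i, a i • u i)‖ :=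
      hJ.norm_map_sum_le hu Finset.univ _ _ fun i _ => by
        rw [hu.apply_sum, if_pos (Finset.mem_univ i), norm_mul, norm_sgn, one_mul]
    have h5 : ∑ j ∈ D, ‖e j (f ε)‖ * ‖ψ η (x j)‖
        = ‖ψ η (∑ j ∈ D, (c j * e j (f ε)) • x j)‖ := by
      rw [h1, RCLike.norm_ofReal, abs_of_nonneg]
      exact Finset.sum_nonneg fun _ _ => by positivity
    rw [h5]
    calc _ ≤ M * (K * (K * ‖JX (∑ i, a i • u i)‖)) :=
          (h2 _).trans (by gcongr; exact h3.trans (by gcongr))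
      _ = _ := by ring
  have hcol : ∀ j, N ^ 2 * (√(∑ i, (‖a i‖ * ‖e j (u i)‖) ^ 2) * √(∑ i, (b i * ‖φ i (x j)‖) ^ 2))
      ≤ 648 ^ 2 * ∑ ε : ι → Bool, ∑ η : ι → Bool, ‖e j (f ε)‖ * ‖ψ η (x j)‖ := by
    intro j
    have k1 := khinchine fun i => a i * e j (u i)
    have k2 := khinchine fun i => (b i : 𝕜) * φ i (x j)
    have e1 : ∀ ε : ι → Bool, ∑ i, (sgn (ε i) : 𝕜) * (a i * e j (u i)) = e j (f ε) := fun ε => by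
      simp only [f, map_sum, map_smul, smul_eq_mul, mul_assoc]
    simp only [e1, norm_mul] at k1
    have e2 : ∀ i, ‖(b i : 𝕜)‖ = b i := fun i => by
      rw [RCLike.norm_ofReal, abs_of_nonneg (hb0 i)]
    have e3 : ∀ η : ι → Bool, ∑ i, (sgn (η i) : 𝕜) * ((b i : 𝕜) * φ i (x j)) = ψ η (x j) :=
      fun η => rfl
    simp only [e3] at k2
    simp only [norm_mul, e2] at k2
    have k3 := mul_le_mul k1 k2 (by positivity)
      (mul_nonneg (by norm_num) (Finset.sum_nonneg fun _ _ => norm_nonneg _))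
    rw [← Finset.sum_mul_sum]
    calc _ = _ := by ring
      _ ≤ _ := k3
      _ = _ := by ring
  have hfin : N ^ 2 * ∑ j ∈ D, √(∑ i, (‖a i‖ * ‖e j (u i)‖) ^ 2)
      * √(∑ i, (b i * ‖φ i (x j)‖) ^ 2)
      ≤ N ^ 2 * (648 ^ 2 * K ^ 2 * M * ‖JX (∑ i, a i • u i)‖) := by
    rw [Finset.mul_sum]
    calc _ ≤ ∑ j ∈ D, 648 ^ 2 * ∑ ε : ι → Bool, ∑ η : ι → Bool, ‖e j (f ε)‖ * ‖ψ η (x j)‖ :=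
          Finset.sum_le_sum fun j _ => hcol j
      _ = 648 ^ 2 * ∑ ε : ι → Bool, ∑ η : ι → Bool, ∑ j ∈ D, ‖e j (f ε)‖ * ‖ψ η (x j)‖ := by
          rw [← Finset.mul_sum, Finset.sum_comm]
          congr 1
          exact Finset.sum_congr rfl fun ε _ => Finset.sum_comm
      _ ≤ 648 ^ 2 * ∑ ε : ι → Bool, ∑ η : ι → Bool, K ^ 2 * M * ‖JX (∑ i, a i • u i)‖ := by
          gcongr with ε _ η _
          exact key ε η
      _ = _ := by
          simp only [Finset.sum_const, Finset.card_univ, Fintype.card_pi, Fintype.card_bool,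
            Finset.prod_const, nsmul_eq_mul, Nat.cast_pow, Nat.cast_ofNat, hN]
          ring
  exact le_of_mul_le_mul_left hfin (by positivity)

/-- Cauchy–Schwarz in each column, for rows that keep a fixed part of their mass on `D i`. -/
theorem sum_mul_le_of_columns {J0 : Finset J} [DecidableEq J] (A B : ι → J → ℝ) (y c : ι → ℝ)
    (F : Finset ι) (D : ι → Finset J) (hA : ∀ i j, 0 ≤ A i j) (hB : ∀ i j, 0 ≤ B i j)
    (hy : ∀ i, 0 ≤ y i) (hc : ∀ i, 0 ≤ c i) (hD : ∀ i, D i ⊆ J0)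
    (hF : ∀ i ∈ F, 1 ≤ 4 * ∑ j ∈ D i, A i j * B i j) :
    ∑ i ∈ F, y i * c i ≤ 4 * ∑ j ∈ J0, √(∑ i, if j ∈ D i then (y i * A i j) ^ 2 else 0)
      * √(∑ i, (c i * B i j) ^ 2) := by
  classical
  have h1 : ∀ i ∈ F, y i * c i
      ≤ 4 * ∑ j ∈ J0, (if j ∈ D i then y i * A i j else 0) * (c i * B i j) := by
    intro i hi
    have e1 : ∑ j ∈ J0, (if j ∈ D i then y i * A i j else 0) * (c i * B i j)
        = (y i * c i) * ∑ j ∈ D i, A i j * B i j := by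
      rw [Finset.mul_sum]
      simp only [ite_mul, zero_mul]
      rw [← Finset.sum_filter]
      have : J0.filter (fun j => j ∈ D i) = D i := by
        ext j; simp only [Finset.mem_filter, and_iff_right_iff_imp]; exact fun h => hD i h
      rw [this]
      exact Finset.sum_congr rfl fun j _ => by ring
    rw [e1]
    have := mul_le_mul_of_nonneg_left (hF i hi) (mul_nonneg (hy i) (hc i))
    linarith
  calc ∑ i ∈ F, y i * c i
      ≤ ∑ i ∈ F, 4 * ∑ j ∈ J0, (if j ∈ D i then y i * A i j else 0) * (c i * B i j) :=
        Finset.sum_le_sum h1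
    _ ≤ ∑ i, 4 * ∑ j ∈ J0, (if j ∈ D i then y i * A i j else 0) * (c i * B i j) := by
        refine Finset.sum_le_sum_of_subset_of_nonneg (Finset.subset_univ _) fun i _ _ => ?_
        refine mul_nonneg (by norm_num) (Finset.sum_nonneg fun j _ => ?_)
        have := hy i; have := hc i; have := hA i j; have := hB i j
        split_ifs <;> positivity
    _ = 4 * ∑ j ∈ J0, ∑ i, (if j ∈ D i then y i * A i j else 0) * (c i * B i j) := by
        rw [← Finset.mul_sum, Finset.sum_comm]
    _ ≤ _ := by
        gcongr with j _
        refine (Real.sum_mul_le_sqrt_mul_sqrt _ _ _).trans (le_of_eq ?_)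
        congr 2
        refine Finset.sum_congr rfl fun i _ => ?_
        split_ifs <;> simp

end SquareFunction

/-! ### Lozanovskii factorization -/

section Lozanovskii

open Filter

variable {ι : Type*} [Fintype ι]

/-- The finite-dimensional Lozanovskii factorization: a maximizer `α` of `∏ i, α i ^ p i` over a
compact convex set of nonnegative vectors has `(p i / α i)` in the polar set. -/
theorem exists_lozanovskii (S : Set (ι → ℝ)) (hc : IsCompact S) (hconv : Convex ℝ S)
    (h0 : ∀ a ∈ S, ∀ i, 0 ≤ a i) (hpos : ∃ a ∈ S, ∀ i, 0 < a i) (p : ι → ℝ) (hp : ∀ i, 0 < p i) :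
    ∃ α ∈ S, (∀ i, 0 < α i) ∧ ∀ y ∈ S, ∑ i, p i / α i * y i ≤ ∑ i, p i := by
  obtain ⟨a0, ha0, ha0pos⟩ := hpos
  have hcont : Continuous fun a : ι → ℝ => ∏ i, a i ^ p i :=
    continuous_finsetProd _ fun i _ => (continuous_apply i).rpow_const fun _ => Or.inr (hp i).le
  obtain ⟨α, hα, hmax⟩ := hc.exists_isMaxOn ⟨a0, ha0⟩ hcont.continuousOn
  have hαpos : ∀ i, 0 < α i := by
    intro i
    refine lt_of_le_of_ne (h0 α hα i) fun h => ?_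
    have h1 : ∏ i, α i ^ p i = 0 := Finset.prod_eq_zero (Finset.mem_univ i) (by
      rw [← h, Real.zero_rpow (hp i).ne'])
    have h2 : 0 < ∏ i, a0 i ^ p i := Finset.prod_pos fun i _ => Real.rpow_pos_of_pos (ha0pos i) _
    have h3 := hmax ha0
    simp only [Set.mem_ofPred_eq, h1] at h3
    linarith
  refine ⟨α, hα, hαpos, fun y hy => ?_⟩
  have hstep : ∀ t : ℝ, 0 < t → t < 1 →
      ∑ i, p i * ((y i - α i) / ((1 - t) * α i + t * y i)) ≤ 0 := by
    intro t ht0 ht1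
    set z : ι → ℝ := fun i => (1 - t) * α i + t * y i with hz
    have hzS : z ∈ S := by
      have := hconv hα hy (by linarith : 0 ≤ 1 - t) ht0.le (by ring)
      have e1 : z = (1 - t) • α + t • y := by ext i; simp [hz]
      rwa [e1]
    have hzpos : ∀ i, 0 < z i := fun i => by
      have := mul_pos (by linarith : 0 < 1 - t) (hαpos i)
      have := mul_nonneg ht0.le (h0 y hy i)
      simp only [hz]; linarith
    have h1 : ∏ i, z i ^ p i ≤ ∏ i, α i ^ p i := hmax hzS
    have h2 : ∑ i, p i * Real.log (z i) ≤ ∑ i, p i * Real.log (α i) := by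
      have h3 := Real.log_le_log (Finset.prod_pos fun i _ => Real.rpow_pos_of_pos (hzpos i) _) h1
      rw [Real.log_prod fun i _ => (Real.rpow_pos_of_pos (hzpos i) _).ne',
        Real.log_prod fun i _ => (Real.rpow_pos_of_pos (hαpos i) _).ne'] at h3
      simpa only [Real.log_rpow (hzpos _), Real.log_rpow (hαpos _)] using h3
    have h4 : t * ∑ i, p i * ((y i - α i) / z i) ≤ t * 0 := by
      rw [mul_zero, Finset.mul_sum]
      have h5 : ∑ i, (p i * Real.log (z i) - p i * Real.log (α i)) ≤ 0 := by
        rw [Finset.sum_sub_distrib]; linarith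
      refine le_trans (Finset.sum_le_sum fun i _ => ?_) h5
      have h6 := Real.one_sub_inv_le_log_of_pos (div_pos (hzpos i) (hαpos i))
      rw [Real.log_div (hzpos i).ne' (hαpos i).ne', inv_div] at h6
      have h7 : 1 - α i / z i = t * ((y i - α i) / z i) := by
        have := (hzpos i).ne'
        field_simp
        simp only [hz]; ring
      rw [h7] at h6
      have := mul_le_mul_of_nonneg_left h6 (hp i).le
      linarith
    exact le_of_mul_le_mul_left h4 ht0
  have hlim : Tendsto (fun t : ℝ => ∑ i, p i * ((y i - α i) / ((1 - t) * α i + t * y i))) (𝓝[>] 0)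
      (𝓝 (∑ i, p i * ((y i - α i) / ((1 - 0) * α i + 0 * y i)))) := by
    refine Tendsto.mono_left (ContinuousAt.tendsto ?_) nhdsWithin_le_nhds
    refine tendsto_finsetSum _ fun i _ => ContinuousAt.tendsto (f := fun t : ℝ =>
      p i * ((y i - α i) / ((1 - t) * α i + t * y i))) ?_
    refine ContinuousAt.mul continuousAt_const (ContinuousAt.div continuousAt_const
      (by fun_prop) ?_)
    have := (hαpos i).ne'
    simpa using this
  have h8 := le_of_tendsto hlim (by
    filter_upwards [Ioo_mem_nhdsGT (zero_lt_one' ℝ)] with t ht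
    exact hstep t ht.1 ht.2)
  have h9 : ∑ i, p i * ((y i - α i) / ((1 - 0) * α i + 0 * y i))
      = ∑ i, p i / α i * y i - ∑ i, p i := by
    rw [← Finset.sum_sub_distrib]
    refine Finset.sum_congr rfl fun i _ => ?_
    have := (hαpos i).ne'
    rw [sub_zero, one_mul, zero_mul, add_zero]
    field_simp
  rw [h9] at h8
  linarith

end Lozanovskii

section EuclideanFactor

variable {𝕜 : Type v} [RCLike 𝕜] {X : Type u} [AddCommGroup X] [Module 𝕜 X]
  [UniformSpace X] [IsUniformAddGroup X] [ContinuousSMul 𝕜 X] [Norm X]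
  [QuasiBanachSpace 𝕜 X]
  {E : Type u} [NormedAddCommGroup E] [NormedSpace 𝕜 E] [CompleteSpace E] {JX : X →ₗ[𝕜] E}
  {J : Type*} {x : J → X} {e : J → X →L[𝕜] 𝕜} {K : ℝ}
  {ι : Type*} [Fintype ι] {u : ι → X} {φ : ι → X →L[𝕜] 𝕜}

/-- Normalized weights `α` and `β = p / α` for which `∑ α i u i` lies in the unit ball of the
envelope and `∑ ± β i φ i` in a multiple of its dual ball. -/
theorem IsBanachEnvelope.exists_weights [Small.{u} 𝕜] (hJ : IsBanachEnvelope JX)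
    (hu : IsUncSystem u φ K) (p : ι → ℝ) (hp0 : ∀ i, 0 < p i) (hp : ∑ i, p i = 1) :
    ∃ α : ι → ℝ, (∀ i, 0 < α i) ∧ ‖JX (∑ i, (α i : 𝕜) • u i)‖ ≤ 1 ∧
      ∀ g, ∑ i, p i / α i * ‖φ i g‖ ≤ K * ‖JX g‖ := by
  classical
  have hK : 0 < K := lt_of_lt_of_le one_pos hu.one_le
  have hext : ∀ i, ∃ S : E →L[𝕜] 𝕜, ∀ f, S (JX f) = φ i f := fun i => by
    obtain ⟨M, hM, hb⟩ := exists_bound_functional 𝕜 (φ i)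
    obtain ⟨S, -, hS⟩ := hJ.exists_extension (φ i).toLinearMap hM hb
    exact ⟨S, hS⟩
  choose s hs using hext
  let L : (ι → ℝ) → E := fun a => ∑ i, (a i : 𝕜) • JX (u i)
  have hLJ : ∀ a, L a = JX (∑ i, (a i : 𝕜) • u i) := fun a => by simp [L]
  have hLcont : Continuous L := continuous_finsetSum _ fun i _ =>
    (RCLike.continuous_ofReal.comp (continuous_apply i)).smul continuous_const
  have hsL : ∀ a i, s i (L a) = a i := fun a i => by
    rw [hLJ, hs, hu.apply_sum, if_pos (Finset.mem_univ i)]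
  let S : Set (ι → ℝ) := {a | (∀ i, 0 ≤ a i) ∧ ‖L a‖ ≤ 1}
  have hclosed : IsClosed S := by
    have h1 : IsClosed {a : ι → ℝ | ∀ i, 0 ≤ a i} := by
      have : {a : ι → ℝ | ∀ i, 0 ≤ a i} = ⋂ i, {a | 0 ≤ a i} := by ext; simp
      rw [this]
      exact isClosed_iInter fun i => isClosed_le continuous_const (continuous_apply i)
    exact h1.inter (isClosed_le hLcont.norm continuous_const)
  have hcomp : IsCompact S := by
    refine (isCompact_Icc (a := (0 : ι → ℝ)) (b := fun i => ‖s i‖)).of_isClosed_subset hclosed ?_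
    rintro a ⟨ha0, ha1⟩
    refine ⟨ha0, fun i => ?_⟩
    have h1 := (s i).le_opNorm (L a)
    rw [hsL, RCLike.norm_ofReal, abs_of_nonneg (ha0 i)] at h1
    exact h1.trans (mul_le_of_le_one_right (norm_nonneg _) ha1)
  have hconv : Convex ℝ S := by
    rintro a ⟨ha0, ha1⟩ b ⟨hb0, hb1⟩ r q hr hq hrq
    refine ⟨fun i => ?_, ?_⟩
    · have := ha0 i; have := hb0 i
      simp only [Pi.add_apply, Pi.smul_apply, smul_eq_mul]; positivity
    · have h1 : L (r • a + q • b) = (r : 𝕜) • L a + (q : 𝕜) • L b := by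
        simp only [L, Finset.smul_sum, ← Finset.sum_add_distrib, smul_smul, ← add_smul]
        simp
      rw [h1]
      refine (norm_add_le _ _).trans ?_
      rw [norm_smul, norm_smul, RCLike.norm_ofReal, RCLike.norm_ofReal, abs_of_nonneg hr,
        abs_of_nonneg hq, ← hrq]
      exact add_le_add (mul_le_of_le_one_right hr ha1) (mul_le_of_le_one_right hq hb1)
  have hpos : ∃ a ∈ S, ∀ i, 0 < a i := by
    set T := ∑ i, ‖JX (u i)‖ with hT
    have hT0 : 0 ≤ T := Finset.sum_nonneg fun _ _ => norm_nonneg _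
    refine ⟨fun _ => (T + 1)⁻¹, ⟨fun _ => by positivity, ?_⟩, fun _ => by positivity⟩
    refine (norm_sum_le _ _).trans ?_
    simp only [norm_smul, RCLike.norm_ofReal, abs_of_pos (by positivity : 0 < (T + 1)⁻¹)]
    rw [← Finset.mul_sum, inv_mul_le_iff₀ (by positivity)]
    linarith
  obtain ⟨α, hαS, hα, hmax⟩ := exists_lozanovskii S hcomp hconv (fun a ha => ha.1) hpos p hp0
  refine ⟨α, hα, by rw [← hLJ]; exact hαS.2, fun g => ?_⟩
  rcases (norm_nonneg (JX g)).eq_or_lt with h0 | h0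
  · have : ∀ i, φ i g = 0 := fun i => by
      rw [← hs, norm_eq_zero.1 h0.symm, map_zero]
    simp [this, ← h0]
  · have hy : (fun i => (K * ‖JX g‖)⁻¹ * ‖φ i g‖) ∈ S := by
      refine ⟨fun i => by positivity, ?_⟩
      have h1 : L (fun i => (K * ‖JX g‖)⁻¹ * ‖φ i g‖)
          = (((K * ‖JX g‖)⁻¹ : ℝ) : 𝕜) • JX (∑ i, ((‖φ i g‖ : ℝ) : 𝕜) • u i) := by
        rw [hLJ, ← map_smul, Finset.smul_sum]
        simp only [smul_smul, RCLike.ofReal_mul]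
      rw [h1, norm_smul, RCLike.norm_ofReal, abs_of_pos (by positivity),
        inv_mul_le_iff₀ (by positivity), mul_one]
      exact hJ.norm_map_sum_le hu _ _ _ fun i _ => by simp
    have h2 := hmax _ hy
    rw [hp] at h2
    have h3 : ∑ i, p i / α i * ((K * ‖JX g‖)⁻¹ * ‖φ i g‖)
        = (K * ‖JX g‖)⁻¹ * ∑ i, p i / α i * ‖φ i g‖ := by
      rw [Finset.mul_sum]
      exact Finset.sum_congr rfl fun i _ => by ring
    rw [h3, inv_mul_le_iff₀ (by positivity), mul_one] at h2
    exact h2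

/-- If the products `p i * |e j (u i)| * |φ i (x j)|` have small column maxima, then `ℓ₂ⁿ` embeds in
the envelope as a complemented subspace, with constants independent of `n`. -/
theorem IsBanachEnvelope.exists_euclidean_factor [Small.{u} 𝕜] [DecidableEq ι] [DecidableEq J]
    (hJ : IsBanachEnvelope JX)
    (hx : IsUncSystem x e K) (hu : IsUncSystem u φ K) (n : ℕ) (p : ι → ℝ) (hp0 : ∀ i, 0 < p i)
    (hp : ∑ i, p i = 1) (G : ι → Finset J) (J0 : Finset J) (hG : ∀ i, G i ⊆ J0) (m : J → ℝ)
    (hm0 : ∀ j, 0 ≤ m j) (hlow : ∀ i, 1 / 2 ≤ ∑ j ∈ G i, ‖e j (u i)‖ * ‖φ i (x j)‖)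
    (hm : ∀ i, ∀ j ∈ G i, p i * (‖e j (u i)‖ * ‖φ i (x j)‖) ≤ m j) {t η : ℝ} (ht : 0 < t)
    (hmη : ∑ j ∈ J0, m j ≤ η)
    (hθ : n ^ 2 * (2 * η + 2 * t * (648 ^ 2 * K ^ 3)) ≤ 1 / 16)
    (hlam : 4 * n * (2 * η / t + n ^ 2 * (2 * η + 2 * t * (648 ^ 2 * K ^ 3))) ≤ 1 / 4) :
    ∃ (T : EuclideanSpace 𝕜 (Fin n) →L[𝕜] E) (P : E →L[𝕜] EuclideanSpace 𝕜 (Fin n)),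
      P ∘L T = ContinuousLinearMap.id 𝕜 (EuclideanSpace 𝕜 (Fin n)) ∧
        ‖T‖ * ‖P‖ ≤ (8 * (648 ^ 2 * K ^ 3)) * (2 * (8 * (648 ^ 2 * K ^ 4))) := by
  have hK : 0 < K := lt_of_lt_of_le one_pos hu.one_le
  obtain ⟨α, hα, hα1, hβ⟩ := hJ.exists_weights hu p hp0 hp
  set β : ι → ℝ := fun i => p i / α i with hβdef
  have hβ0 : ∀ i, 0 < β i := fun i => div_pos (hp0 i) (hα i)
  have hαβ : ∀ i, α i * β i = p i := fun i => by
    have := (hα i).ne'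
    simp only [hβdef]; field_simp
  have hαn : ∀ i, ‖(α i : 𝕜)‖ = α i := fun i => by rw [RCLike.norm_ofReal, abs_of_pos (hα i)]
  have hβn : ∀ i, ‖(β i : 𝕜)‖ = β i := fun i => by rw [RCLike.norm_ofReal, abs_of_pos (hβ0 i)]
  have hAB : ∀ i j, (α i * ‖e j (u i)‖) * (β i * ‖φ i (x j)‖)
      = p i * (‖e j (u i)‖ * ‖φ i (x j)‖) := fun i j => by rw [← hαβ i]; ring
  have hαsum : ∀ (b : ι → ℝ), (∀ i, 0 ≤ b i) → (∀ g, ∑ i, b i * ‖φ i g‖ ≤ K * ‖JX g‖) →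
      ∑ j ∈ J0, √(∑ i, (α i * ‖e j (u i)‖) ^ 2) * √(∑ i, (b i * ‖φ i (x j)‖) ^ 2)
        ≤ 648 ^ 2 * K ^ 3 := fun b hb0 hb => by
    have := hJ.sum_sqrt_mul_sqrt_le hx hu J0 (fun i => (α i : 𝕜)) b hK.le hb hb0
    simp only [hαn] at this
    refine this.trans ((mul_le_of_le_one_right (by positivity) hα1).trans (le_of_eq (by ring)))
  obtain ⟨ω, F, D, hD, hF, hA2, hB2, hlower⟩ := exists_random_signs (𝕜 := 𝕜) (n := n)
    (fun i j => α i * ‖e j (u i)‖) (fun i j => β i * ‖φ i (x j)‖) p G J0 m (t := t) (η := η)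
    (C := 648 ^ 2 * K ^ 3) (fun i j => mul_nonneg (hα i).le (norm_nonneg _))
    (fun i j => mul_nonneg (hβ0 i).le (norm_nonneg _)) hG (fun i => (hp0 i).le) hp
    (fun i => by
      simp only [hAB, ← Finset.mul_sum]
      have := mul_le_mul_of_nonneg_left (hlow i) (hp0 i).le
      linarith) hm0 (fun i j hj => by rw [hAB]; exact hm i j hj) hmη
    (hαsum β (fun i => (hβ0 i).le) hβ) ht hθ hlam
  have hF' : ∀ i ∈ F, 1 ≤ 4 * ∑ j ∈ D i, ‖e j (u i)‖ * ‖φ i (x j)‖ := fun i hi => by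
    have h1 := hF i hi
    simp only [hAB, ← Finset.mul_sum] at h1
    have h2 : p i * 1 ≤ p i * (4 * ∑ j ∈ D i, ‖e j (u i)‖ * ‖φ i (x j)‖) := by linarith
    exact le_of_mul_le_mul_left h2 (hp0 i)
  have hF'' : ∀ i ∈ F, 1 ≤ 4 * ∑ j ∈ D i, ‖φ i (x j)‖ * ‖e j (u i)‖ := fun i hi => by
    simpa only [mul_comm] using hF' i hi
  -- the random embedding
  let dot : ι → EuclideanSpace 𝕜 (Fin n) →ₗ[𝕜] 𝕜 := fun i =>
    ∑ k, (sgn (ω (i, k)) : 𝕜) • (EuclideanSpace.proj (𝕜 := 𝕜) k).toLinearMap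
  have hdot : ∀ i ξ, dot i ξ = signDot ω (fun k => ξ k) i := fun i ξ => by
    simp [dot, signDot, RCLike.real_smul_eq_coe_mul]
  have hnorm : ∀ ξ : EuclideanSpace 𝕜 (Fin n), ∑ k, ‖ξ k‖ ^ 2 = ‖ξ‖ ^ 2 := fun ξ =>
    (EuclideanSpace.norm_sq_eq ξ).symm
  let T0 : EuclideanSpace 𝕜 (Fin n) →ₗ[𝕜] E :=
    ∑ i ∈ F, ((α i : 𝕜) • dot i).smulRight (JX (u i))
  have hT0 : ∀ ξ, T0 ξ = ∑ i ∈ F, ((α i : 𝕜) * dot i ξ) • JX (u i) := fun ξ => by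
    simp [T0, RCLike.real_smul_eq_coe_mul]
  have hcolumn : ∀ (s q r : ℝ), 0 ≤ s → 0 ≤ r → q ≤ 2 * s * r ^ 2 → √q ≤ 2 * r * √s :=
    fun s q r hs hr hq => by
      refine Real.sqrt_le_iff.2 ⟨by positivity, ?_⟩
      rw [mul_pow, mul_pow, Real.sq_sqrt hs]
      nlinarith [mul_nonneg hs (sq_nonneg r)]
  have hTbound : ∀ ξ, ‖T0 ξ‖ ≤ 8 * (648 ^ 2 * K ^ 3) * ‖ξ‖ := by
    intro ξ
    obtain ⟨g, hg1, hg2⟩ := exists_dual_vector'' 𝕜 (T0 ξ)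
    have hgJ : ∀ f, ∑ i, ‖g (JX (u i))‖ * ‖φ i f‖ ≤ K * ‖JX f‖ := fun f => by
      choose c hc hc' using fun i => exists_norm_le_one_mul_eq (φ i f * g (JX (u i)))
      have h1 : g (JX (∑ i, (c i * φ i f) • u i))
          = ((∑ i, ‖g (JX (u i))‖ * ‖φ i f‖ : ℝ) : 𝕜) := by
        simp only [map_sum, map_smul, smul_eq_mul, mul_assoc, hc', norm_mul]
        push_cast
        exact Finset.sum_congr rfl fun i _ => mul_comm _ _
      have h2 : ‖JX (∑ i, (c i * φ i f) • u i)‖ ≤ K * ‖JX f‖ :=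
        hJ.norm_map_sum_le hu _ _ _ fun i _ => by
          rw [norm_mul]; exact mul_le_of_le_one_left (norm_nonneg _) (hc i)
      have h3 := g.le_of_opNorm_le hg1 (JX (∑ i, (c i * φ i f) • u i))
      rw [h1, RCLike.norm_ofReal, abs_of_nonneg
        (Finset.sum_nonneg fun _ _ => by positivity), one_mul] at h3
      exact h3.trans h2
    have h1 : ‖T0 ξ‖ ≤ ∑ i ∈ F, (α i * ‖dot i ξ‖) * ‖g (JX (u i))‖ := by
      have h2 : ‖T0 ξ‖ = ‖g (T0 ξ)‖ := by rw [hg2, RCLike.norm_ofReal, abs_norm]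
      rw [h2, hT0, map_sum]
      refine (norm_sum_le _ _).trans (le_of_eq (Finset.sum_congr rfl fun i _ => ?_))
      rw [map_smul, norm_smul, norm_mul, hαn]
    have h2 := sum_mul_le_of_columns (J0 := J0) (fun i j => ‖e j (u i)‖) (fun i j => ‖φ i (x j)‖)
      (fun i => α i * ‖dot i ξ‖) (fun i => ‖g (JX (u i))‖) F D (fun _ _ => norm_nonneg _)
      (fun _ _ => norm_nonneg _) (fun i => mul_nonneg (hα i).le (norm_nonneg _))
      (fun _ => norm_nonneg _) hD hF'
    have h3 : ∀ j, √(∑ i, if j ∈ D i then (α i * ‖dot i ξ‖ * ‖e j (u i)‖) ^ 2 else 0)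
        ≤ 2 * ‖ξ‖ * √(∑ i, (α i * ‖e j (u i)‖) ^ 2) := fun j => by
      refine hcolumn _ _ _ (Finset.sum_nonneg fun _ _ => sq_nonneg _) (norm_nonneg _) ?_
      have := hA2 j (fun k => ξ k)
      rw [hnorm] at this
      refine le_of_eq_of_le (Finset.sum_congr rfl fun i _ => ?_) this
      rw [hdot]
      split_ifs <;> ring
    calc ‖T0 ξ‖ ≤ _ := h1.trans h2
      _ ≤ 4 * ∑ j ∈ J0, (2 * ‖ξ‖ * √(∑ i, (α i * ‖e j (u i)‖) ^ 2))
          * √(∑ i, (‖g (JX (u i))‖ * ‖φ i (x j)‖) ^ 2) := by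
          gcongr with j _
          exact h3 j
      _ = (8 * ‖ξ‖) * ∑ j ∈ J0, √(∑ i, (α i * ‖e j (u i)‖) ^ 2)
          * √(∑ i, (‖g (JX (u i))‖ * ‖φ i (x j)‖) ^ 2) := by
          rw [Finset.mul_sum, Finset.mul_sum]
          exact Finset.sum_congr rfl fun j _ => by ring
      _ ≤ (8 * ‖ξ‖) * (648 ^ 2 * K ^ 3) := by
          gcongr
          exact hαsum _ (fun _ => norm_nonneg _) hgJ
      _ = _ := by ring
  -- the random projection
  let S0 : X →ₗ[𝕜] EuclideanSpace 𝕜 (Fin n) :=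
    (WithLp.linearEquiv 2 𝕜 (Fin n → 𝕜)).symm.toLinearMap ∘ₗ LinearMap.pi fun k =>
      ∑ i ∈ F, ((sgn (ω (i, k)) : 𝕜) * (β i : 𝕜)) • (φ i).toLinearMap
  have hS0 : ∀ f k, S0 f k = ∑ i ∈ F, (sgn (ω (i, k)) : 𝕜) * (β i : 𝕜) * φ i f := fun f k => by
    simp [S0]
  have hSJ : ∀ f, ‖S0 f‖ ≤ 8 * (648 ^ 2 * K ^ 4) * ‖JX f‖ := by
    intro f
    set z : EuclideanSpace 𝕜 (Fin n) := S0 f with hz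
    set zc : Fin n → 𝕜 := fun k => (starRingEnd 𝕜) (z k) with hzc
    have hzcn : ∑ k, ‖zc k‖ ^ 2 = ‖z‖ ^ 2 := by
      rw [← hnorm]; simp only [hzc, RCLike.norm_conj]
    have h1 : ‖z‖ ^ 2 ≤ ∑ i ∈ F, (β i * ‖signDot ω zc i‖) * ‖φ i f‖ := by
      have h2 : ((‖z‖ ^ 2 : ℝ) : 𝕜) = ∑ i ∈ F, (β i : 𝕜) * signDot ω zc i * φ i f := by
        rw [← hnorm]
        push_cast
        have : ∀ k, (‖z k‖ : 𝕜) ^ 2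
            = ∑ i ∈ F, zc k * ((sgn (ω (i, k)) : 𝕜) * (β i : 𝕜) * φ i f) := fun k => by
          rw [← RCLike.conj_mul, ← Finset.mul_sum, ← hS0]
        simp_rw [this]
        rw [Finset.sum_comm]
        refine Finset.sum_congr rfl fun i _ => ?_
        rw [signDot, Finset.mul_sum, Finset.sum_mul]
        exact Finset.sum_congr rfl fun k _ => by ring
      have h3 : ‖z‖ ^ 2 = ‖((‖z‖ ^ 2 : ℝ) : 𝕜)‖ := by
        rw [RCLike.norm_ofReal, abs_of_nonneg (by positivity)]
      rw [h3, h2]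
      refine (norm_sum_le _ _).trans (le_of_eq (Finset.sum_congr rfl fun i _ => ?_))
      rw [norm_mul, norm_mul, hβn]
    have h2 := sum_mul_le_of_columns (J0 := J0) (fun i j => ‖φ i (x j)‖) (fun i j => ‖e j (u i)‖)
      (fun i => β i * ‖signDot ω zc i‖) (fun i => ‖φ i f‖) F D (fun _ _ => norm_nonneg _)
      (fun _ _ => norm_nonneg _) (fun i => mul_nonneg (hβ0 i).le (norm_nonneg _))
      (fun _ => norm_nonneg _) hD hF''
    have h3 : ∀ j, √(∑ i, if j ∈ D i then (β i * ‖signDot ω zc i‖ * ‖φ i (x j)‖) ^ 2 else 0)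
        ≤ 2 * ‖z‖ * √(∑ i, (β i * ‖φ i (x j)‖) ^ 2) := fun j => by
      refine hcolumn _ _ _ (Finset.sum_nonneg fun _ _ => sq_nonneg _) (norm_nonneg _) ?_
      have := hB2 j zc
      rw [hzcn] at this
      refine le_of_eq_of_le (Finset.sum_congr rfl fun i _ => ?_) this
      split_ifs <;> ring
    have h4 := hJ.sum_sqrt_mul_sqrt_le hx hu J0 (fun i => φ i f) β hK.le hβ fun i => (hβ0 i).le
    have h5 : ‖JX (∑ i, φ i f • u i)‖ ≤ K * ‖JX f‖ := hJ.norm_map_sum_le hu _ _ _ fun i _ => le_rfl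
    have h6 : ‖z‖ ^ 2 ≤ ‖z‖ * (8 * (648 ^ 2 * K ^ 4) * ‖JX f‖) := by
      calc ‖z‖ ^ 2 ≤ _ := h1.trans h2
        _ ≤ 4 * ∑ j ∈ J0, (2 * ‖z‖ * √(∑ i, (β i * ‖φ i (x j)‖) ^ 2))
            * √(∑ i, (‖φ i f‖ * ‖e j (u i)‖) ^ 2) := by
            gcongr with j _
            exact h3 j
        _ = (8 * ‖z‖) * ∑ j ∈ J0, √(∑ i, (‖φ i f‖ * ‖e j (u i)‖) ^ 2)
            * √(∑ i, (β i * ‖φ i (x j)‖) ^ 2) := by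
            rw [Finset.mul_sum, Finset.mul_sum]
            exact Finset.sum_congr rfl fun j _ => by ring
        _ ≤ (8 * ‖z‖) * (648 ^ 2 * K ^ 2 * K * (K * ‖JX f‖)) := by
            gcongr
            exact h4.trans (by gcongr)
        _ = _ := by ring
    rcases (norm_nonneg z).eq_or_lt with h0 | h0
    · rw [← h0]; positivity
    · rw [sq] at h6
      exact le_of_mul_le_mul_left h6 h0
  have : Small.{u} (EuclideanSpace 𝕜 (Fin n)) :=
    small_of_injective (β := Fin n → 𝕜) (f := fun z => z.ofLp) (WithLp.ofLp_injective 2)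
  obtain ⟨P0, hP0, hP0J⟩ := hJ.exists_extension S0 (M := 8 * (648 ^ 2 * K ^ 4)) (by positivity)
    fun f => (hSJ f).trans (by gcongr; exact hJ.1 f)
  let T : EuclideanSpace 𝕜 (Fin n) →L[𝕜] E := T0.mkContinuous _ hTbound
  -- the composition is coercive
  have hW : ∀ ξ k, P0 (T ξ) k = ∑ i ∈ F, (sgn (ω (i, k)) : 𝕜) * ((p i : 𝕜) * dot i ξ) := by
    intro ξ k
    have e1 : T ξ = JX (∑ i ∈ F, ((α i : 𝕜) * dot i ξ) • u i) := by
      change T0 ξ = _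
      rw [hT0]; simp
    rw [e1, hP0J, hS0]
    refine Finset.sum_congr rfl fun i hi => ?_
    rw [hu.apply_sum, if_pos hi, ← hαβ i]
    push_cast; ring
  have hcoer : ∀ ξ, ‖ξ‖ / 2 ≤ ‖P0 (T ξ)‖ := by
    intro ξ
    have e1 : inner 𝕜 ξ (P0 (T ξ)) = ((∑ i ∈ F, p i * ‖dot i ξ‖ ^ 2 : ℝ) : 𝕜) := by
      rw [PiLp.inner_apply]
      simp only [RCLike.inner_apply, hW, Finset.sum_mul]
      rw [Finset.sum_comm]
      push_cast
      refine Finset.sum_congr rfl fun i _ => ?_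
      have e2 : (starRingEnd 𝕜) (dot i ξ) = ∑ k, (sgn (ω (i, k)) : 𝕜) * (starRingEnd 𝕜) (ξ k) := by
        rw [hdot, signDot, map_sum]
        refine Finset.sum_congr rfl fun k _ => ?_
        rw [map_mul, RCLike.conj_ofReal]
      rw [← RCLike.mul_conj, e2, Finset.mul_sum, Finset.mul_sum]
      exact Finset.sum_congr rfl fun k _ => by ring
    have e3 := norm_inner_le_norm (𝕜 := 𝕜) ξ (P0 (T ξ))
    have e4 := hlower (fun k => ξ k)
    rw [hnorm] at e4
    simp only [← hdot] at e4
    rw [e1, RCLike.norm_ofReal, abs_of_nonneg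
      (Finset.sum_nonneg fun i _ => mul_nonneg (hp0 i).le (by positivity))] at e3
    rcases (norm_nonneg ξ).eq_or_lt with h0 | h0
    · rw [← h0]; simp
    · refine le_of_mul_le_mul_left ?_ h0
      calc ‖ξ‖ * (‖ξ‖ / 2) = ‖ξ‖ ^ 2 / 2 := by ring
        _ ≤ _ := e4.trans e3
  let W : EuclideanSpace 𝕜 (Fin n) →ₗ[𝕜] EuclideanSpace 𝕜 (Fin n) := (P0 ∘L T).toLinearMap
  have hinj : Function.Injective W := by
    rw [injective_iff_map_eq_zero]
    intro ξ hξ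
    have h1 := hcoer ξ
    have h2 : P0 (T ξ) = 0 := hξ
    rw [h2, norm_zero] at h1
    exact norm_le_zero_iff.1 (by linarith)
  let V := (LinearEquiv.ofInjectiveEndo W hinj).toContinuousLinearEquiv
  have hV : ∀ ξ, V ξ = P0 (T ξ) := fun ξ => rfl
  have hVs : ∀ z, ‖V.symm z‖ ≤ 2 * ‖z‖ := fun z => by
    have h1 := hcoer (V.symm z)
    rw [← hV, V.apply_symm_apply] at h1
    linarith
  refine ⟨T, (V.symm : EuclideanSpace 𝕜 (Fin n) →L[𝕜] EuclideanSpace 𝕜 (Fin n)) ∘L P0, ?_, ?_⟩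
  · ext1 ξ
    change V.symm (P0 (T ξ)) = ξ
    rw [← hV, V.symm_apply_apply]
  · have h1 : ‖T‖ ≤ 8 * (648 ^ 2 * K ^ 3) := LinearMap.mkContinuous_norm_le _ (by positivity) _
    have h2 : ‖(V.symm : EuclideanSpace 𝕜 (Fin n) →L[𝕜] EuclideanSpace 𝕜 (Fin n)) ∘L P0‖
        ≤ 2 * (8 * (648 ^ 2 * K ^ 4)) := by
      refine ContinuousLinearMap.opNorm_le_bound _ (by positivity) fun y => ?_
      refine (hVs (P0 y)).trans ?_
      rw [mul_assoc]
      gcongr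
      exact hP0 y
    gcongr

end EuclideanFactor

/-! ### Fractional selections -/

section Fractional

variable {I J : Type*} [DecidableEq J]

/-- Linear programming duality: if the column maxima of every weighted family `p i * w i j` carry a
fixed part of the total weight, then the rows share the columns fractionally, each keeping a fixed
part of its mass. -/
theorem exists_fractional_finite [DecidableEq I] (w : I → J → ℝ) (hw : ∀ i j, 0 ≤ w i j)
    (G : I → Finset J)
    {c : ℝ} (hmax : ∀ (F : Finset I) (p : I → ℝ) (m : J → ℝ), (∀ i ∈ F, 0 ≤ p i) → (∀ j, 0 ≤ m j) →
      (∀ i ∈ F, ∀ j ∈ G i, p i * w i j ≤ m j) → c * ∑ i ∈ F, p i ≤ ∑ j ∈ F.biUnion G, m j)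
    (F : Finset I) :
    ∃ t : I → J → ℝ, (∀ i j, 0 ≤ t i j) ∧ (∀ j, ∑ i ∈ F, t i j ≤ 1) ∧
      ∀ i ∈ F, c ≤ ∑ j ∈ G i, t i j * w i j := by
  classical
  set J0 := F.biUnion G with hJ0
  let T : Set (F → J0 → ℝ) := {t | (∀ i j, 0 ≤ t i j) ∧ ∀ j, ∑ i, t i j ≤ 1}
  have hTcomp : IsCompact T := by
    have hclosed : IsClosed T := by
      have h1 : T = (⋂ i : F, ⋂ j : J0, {t : F → J0 → ℝ | 0 ≤ t i j})
          ∩ ⋂ j : J0, {t : F → J0 → ℝ | ∑ i, t i j ≤ 1} := by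
        ext t; simp [T]
      rw [h1]
      refine IsClosed.inter (isClosed_iInter fun i => isClosed_iInter fun j =>
        isClosed_le continuous_const (by fun_prop)) (isClosed_iInter fun j =>
        isClosed_le (by fun_prop) continuous_const)
    refine (isCompact_Icc (a := (0 : F → J0 → ℝ)) (b := fun _ _ => 1)).of_isClosed_subset hclosed ?_
    rintro t ⟨ht0, ht1⟩
    exact ⟨fun i j => ht0 i j, fun i j => (Finset.single_le_sum (f := fun i => t i j)
      (fun i _ => ht0 i j) (Finset.mem_univ i)).trans (ht1 j)⟩
  have hTconv : Convex ℝ T := by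
    rintro s ⟨hs0, hs1⟩ t ⟨ht0, ht1⟩ a b ha hb hab
    refine ⟨fun i j => ?_, fun j => ?_⟩
    · have := hs0 i j; have := ht0 i j
      simp only [Pi.add_apply, Pi.smul_apply, smul_eq_mul]; positivity
    · simp only [Pi.add_apply, Pi.smul_apply, smul_eq_mul, Finset.sum_add_distrib,
        ← Finset.mul_sum]
      rw [← hab]
      exact add_le_add (mul_le_of_le_one_right ha (hs1 j)) (mul_le_of_le_one_right hb (ht1 j))
  let w' : F → J0 → ℝ := fun i j => if (j : J) ∈ G i then w i j else 0
  have hw' : ∀ i j, 0 ≤ w' i j := fun i j => by simp only [w']; split_ifs; exacts [hw _ _, le_rfl]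
  let L : (F → J0 → ℝ) →ₗ[ℝ] (F → ℝ) :=
    { toFun := fun t i => ∑ j, t i j * w' i j
      map_add' := fun s t => by ext i; simp [add_mul, Finset.sum_add_distrib]
      map_smul' := fun r t => by ext i; simp [Finset.mul_sum, mul_assoc] }
  have hLcont : Continuous L := L.continuous_of_finiteDimensional
  let O : Set (F → ℝ) := {y | ∀ i, c ≤ y i}
  have hOclosed : IsClosed O := by
    have : O = ⋂ i : F, {y | c ≤ y i} := by ext; simp [O]
    rw [this]
    exact isClosed_iInter fun i => isClosed_le continuous_const (continuous_apply i)
  have hOconv : Convex ℝ O := by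
    rintro y hy z hz a b ha hb hab i
    have h1 := mul_le_mul_of_nonneg_left (hy i) ha
    have h2 := mul_le_mul_of_nonneg_left (hz i) hb
    simp only [Pi.add_apply, Pi.smul_apply, smul_eq_mul]
    calc c = a * c + b * c := by rw [← add_mul, hab, one_mul]
      _ ≤ _ := by linarith
  -- if the feasible values miss the target, a separating functional is a bad weight
  have hmeet : ¬ Disjoint (L '' T) O := by
    intro hdis
    obtain ⟨f, a, b, hf1, hab, hf2⟩ := geometric_hahn_banach_compact_closed
      (hTconv.linear_image L) (hTcomp.image hLcont) hOconv hOclosed hdis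
    let q : F → ℝ := fun i => f (Pi.single i 1)
    have hfq : ∀ y, f y = ∑ i, y i * q i := fun y => by
      have h1 : y = ∑ i, y i • (Pi.single i (1 : ℝ) : F → ℝ) := by
        ext k; simp [Finset.sum_apply, Pi.single_apply]
      conv_lhs => rw [h1]
      simp [q]
    have hcO : ∀ (i : F) (s : ℝ), 0 ≤ s → (fun k => c + if k = i then s else 0) ∈ O :=
      fun i s hs k => by simp only; split_ifs <;> linarith
    have hq0 : ∀ i, 0 ≤ q i := by
      intro i
      by_contra hneg
      push Not at hneg
      set d := ∑ k, c * q k with hd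
      have h1 : ∀ s : ℝ, 0 ≤ s → b < d + s * q i := fun s hs => by
        have := hf2 _ (hcO i s hs)
        rw [hfq] at this
        simpa [add_mul, Finset.sum_add_distrib, hd] using this
      have h2 := h1 ((|d| + |b| + 1) / (-q i)) (by
        have : 0 < -q i := by linarith
        positivity)
      have h3 : (|d| + |b| + 1) / (-q i) * q i = -(|d| + |b| + 1) := by
        have := hneg.ne
        field_simp
      rw [h3] at h2
      have := le_abs_self d
      have := neg_abs_le b
      linarith
    -- the optimal response to the weight `q`
    let m : J0 → ℝ := fun j => if hne : Nonempty F then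
      (Finset.univ : Finset F).sup' (Finset.univ_nonempty) fun i => q i * w' i j else 0
    have hmF : ∀ (i : F) j, q i * w' i j ≤ m j := fun i j => by
      have : Nonempty F := ⟨i⟩
      simp only [m, this, dif_pos]
      exact Finset.le_sup' (fun i => q i * w' i j) (Finset.mem_univ i)
    have hm0 : ∀ j, 0 ≤ m j := fun j => by
      by_cases hne : Nonempty F
      · exact (mul_nonneg (hq0 hne.some) (hw' _ j)).trans (hmF hne.some j)
      · simp only [m, hne, dif_neg, not_false_eq_true, le_refl]
    have hbest : ∃ t ∈ T, ∑ j, m j ≤ f (L t) := by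
      by_cases hne : Nonempty F
      · have hch : ∀ j, ∃ i, m j = q i * w' i j := fun j => by
          obtain ⟨i, -, hi⟩ := Finset.exists_mem_eq_sup' (Finset.univ_nonempty (α := F))
            fun i => q i * w' i j
          refine ⟨i, ?_⟩
          simp only [m, hne, dif_pos]
          exact hi
        choose g hg using hch
        refine ⟨fun i j => if i = g j then 1 else 0, ⟨fun i j => by dsimp only; split_ifs <;> simp,
          fun j => by simp⟩, le_of_eq ?_⟩
        rw [hfq]
        simp only [L, LinearMap.coe_mk, AddHom.coe_mk, Finset.sum_mul]
        rw [Finset.sum_comm]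
        refine Finset.sum_congr rfl fun j _ => ?_
        rw [Finset.sum_eq_single (g j)]
        · rw [if_pos rfl, hg]; ring
        · intro i _ hi; simp [hi]
        · simp
      · have : IsEmpty F := not_nonempty_iff.1 hne
        refine ⟨0, ⟨fun i => isEmptyElim i, fun j => by simp⟩, le_of_eq ?_⟩
        have h1 : ∀ j, m j = 0 := fun j => by
          simp only [m, hne, dif_neg, not_false_eq_true]
        simp [h1]
    obtain ⟨t, htT, ht⟩ := hbest
    have h1 := hf1 _ ⟨t, htT, rfl⟩
    have h2 := hf2 (fun _ => c) fun _ => le_rfl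
    rw [hfq, ← Finset.mul_sum] at h2
    have h3 := hmax F (fun i => if hi : i ∈ F then q ⟨i, hi⟩ else 0)
      (fun j => if hj : j ∈ J0 then m ⟨j, hj⟩ else 0)
      (fun i hi => by simp only [hi, dif_pos]; exact hq0 _)
      (fun j => by split_ifs; exacts [hm0 _, le_rfl])
      (fun i hi j hj => by
        have hjJ : j ∈ J0 := Finset.mem_biUnion.2 ⟨i, hi, hj⟩
        simp only [hi, hjJ, dif_pos]
        have := hmF ⟨i, hi⟩ ⟨j, hjJ⟩
        simpa only [w', hj, if_true] using this)
    rw [← Finset.sum_coe_sort F, ← hJ0, ← Finset.sum_coe_sort J0] at h3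
    simp only [Finset.coe_mem, dif_pos, Subtype.coe_eta] at h3
    linarith
  obtain ⟨y, ⟨t, htT, rfl⟩, hy⟩ := Set.not_disjoint_iff.1 hmeet
  refine ⟨fun i j => if h : i ∈ F ∧ j ∈ J0 then t ⟨i, h.1⟩ ⟨j, h.2⟩ else 0, fun i j => ?_,
    fun j => ?_, fun i hi => ?_⟩
  · dsimp only
    split_ifs
    · exact htT.1 _ _
    · exact le_rfl
  · rw [← Finset.sum_coe_sort F]
    by_cases hj : j ∈ J0
    · have := htT.2 ⟨j, hj⟩
      simpa [hj] using this
    · simp [hj]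
  · have h1 := hy ⟨i, hi⟩
    have h2 : ∀ j ∈ G i, j ∈ J0 := fun j hj => Finset.mem_biUnion.2 ⟨i, hi, hj⟩
    refine h1.trans (le_of_eq ?_)
    change ∑ j : J0, t ⟨i, hi⟩ j * w' ⟨i, hi⟩ j = _
    have h3 : ∀ j : J0, t ⟨i, hi⟩ j * w' ⟨i, hi⟩ j
        = (fun j : J => if j ∈ G i then (if h : i ∈ F ∧ j ∈ J0 then t ⟨i, h.1⟩ ⟨j, h.2⟩ else 0)
          * w i j else 0) j := fun j => by
      simp only [w', hi, true_and, Finset.coe_mem, dif_pos, Subtype.coe_eta, mul_ite, mul_zero]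
    rw [Finset.sum_congr rfl fun j _ => h3 j, Finset.sum_coe_sort J0
      (fun j : J => if j ∈ G i then (if h : i ∈ F ∧ j ∈ J0 then t ⟨i, h.1⟩ ⟨j, h.2⟩ else 0)
          * w i j else 0), ← Finset.sum_filter]
    refine Finset.sum_congr ?_ fun _ _ => rfl
    ext j
    simp only [Finset.mem_filter]
    exact ⟨fun h => h.2, fun h => ⟨h2 j h, h⟩⟩

/-- The fractional selection for all rows at once, by compactness of a product of intervals. -/
theorem exists_fractional [DecidableEq I] (w : I → J → ℝ) (hw : ∀ i j, 0 ≤ w i j)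
    (G : I → Finset J)
    {c : ℝ} (hmax : ∀ (F : Finset I) (p : I → ℝ) (m : J → ℝ), (∀ i ∈ F, 0 ≤ p i) → (∀ j, 0 ≤ m j) →
      (∀ i ∈ F, ∀ j ∈ G i, p i * w i j ≤ m j) → c * ∑ i ∈ F, p i ≤ ∑ j ∈ F.biUnion G, m j) :
    ∃ t : I → J → ℝ, (∀ i j, 0 ≤ t i j) ∧ (∀ (F : Finset I) j, ∑ i ∈ F, t i j ≤ 1) ∧
      ∀ i, c ≤ ∑ j ∈ G i, t i j * w i j := by
  classical
  let Q : Set (I → J → ℝ) := Set.univ.pi fun _ => Set.univ.pi fun _ => Set.Icc 0 1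
  have hQ : IsCompact Q := isCompact_univ_pi fun _ => isCompact_univ_pi fun _ => isCompact_Icc
  let Z : Finset I → Set (I → J → ℝ) := fun F =>
    Q ∩ ((⋂ j : J, {t | ∑ i ∈ F, t i j ≤ 1})
      ∩ ⋂ i ∈ F, {t | c ≤ ∑ j ∈ G i, t i j * w i j})
  have hZclosed : ∀ F, IsClosed (Z F) := fun F => by
    refine hQ.isClosed.inter (IsClosed.inter (isClosed_iInter fun j => isClosed_le ?_
      continuous_const) (isClosed_biInter fun i _ => isClosed_le continuous_const ?_))
    · exact continuous_finsetSum _ fun i _ => (continuous_apply j).comp (continuous_apply i)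
    · exact continuous_finsetSum _ fun j _ =>
        (by fun_prop : Continuous fun t : I → J → ℝ => t i j * w i j)
  have hmem : ∀ F t, t ∈ Z F ↔ (∀ i j, 0 ≤ t i j ∧ t i j ≤ 1) ∧ (∀ j, ∑ i ∈ F, t i j ≤ 1) ∧
      ∀ i ∈ F, c ≤ ∑ j ∈ G i, t i j * w i j := fun F t => by
    simp only [Z, Q, Set.mem_inter_iff, Set.mem_pi, Set.mem_univ, Set.mem_Icc, true_imp_iff,
      Set.mem_iInter, Set.mem_ofPred_eq]
  have hanti : ∀ F F', F ⊆ F' → Z F' ⊆ Z F := by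
    intro F F' h t ht
    rw [hmem] at ht ⊢
    exact ⟨ht.1, fun j => (Finset.sum_le_sum_of_subset_of_nonneg h fun i _ _ => (ht.1 i j).1).trans
      (ht.2.1 j), fun i hi => ht.2.2 i (h hi)⟩
  obtain ⟨t, ht⟩ := IsCompact.nonempty_iInter_of_directed_nonempty_isCompact_isClosed Z
    (fun F F' => ⟨F ∪ F', hanti _ _ Finset.subset_union_left, hanti _ _ Finset.subset_union_right⟩)
    (fun F => by
      obtain ⟨t, ht0, ht1, htc⟩ := exists_fractional_finite w hw G hmax F
      refine ⟨fun i j => if i ∈ F then t i j else 0, (hmem _ _).2 ⟨fun i j => ?_, fun j => ?_,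
        fun i hi => ?_⟩⟩
      · split_ifs with hi
        · exact ⟨ht0 i j, (Finset.single_le_sum (f := fun i => t i j) (fun i _ => ht0 i j) hi).trans
            (ht1 j)⟩
        · simp
      · refine le_of_eq_of_le (Finset.sum_congr rfl fun i hi => if_pos hi) (ht1 j)
      · simp only [hi, if_true]; exact htc i hi)
    (fun F => hQ.of_isClosed_subset (hZclosed F) Set.inter_subset_left) hZclosed
  have ht' : ∀ F, t ∈ Z F := fun F => Set.mem_iInter.1 ht F
  refine ⟨t, fun i j => (((hmem _ _).1 (ht' ∅)).1 i j).1, fun F j => ((hmem _ _).1 (ht' F)).2.1 j,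
    fun i => ((hmem _ _).1 (ht' {i})).2.2 i (Finset.mem_singleton_self i)⟩

/-- Rounding the fractional selection: sets `A i` of bounded multiplicity `N`, coloured by `k` so
that sets of the same colour at the same point agree, each carrying a fixed part of row `i`. -/
theorem exists_coloring (w : I → J → ℝ) (hw : ∀ i j, 0 ≤ w i j)
    (G : I → Finset J) {c C : ℝ} (hc : 0 < c) (hC : ∀ i, ∑ j ∈ G i, w i j ≤ C)
    (hmax : ∀ (F : Finset I) (p : I → ℝ) (m : J → ℝ), (∀ i ∈ F, 0 ≤ p i) → (∀ j, 0 ≤ m j) →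
      (∀ i ∈ F, ∀ j ∈ G i, p i * w i j ≤ m j) → c * ∑ i ∈ F, p i ≤ ∑ j ∈ F.biUnion G, m j) :
    ∃ (N : ℕ) (A : I → Finset J) (k : I → J → Fin N), (∀ i, ∀ j ∈ A i, 0 < w i j) ∧
      (∀ i, c / 2 ≤ ∑ j ∈ A i, w i j) ∧
      ∀ i i' j, j ∈ A i → j ∈ A i' → k i j = k i' j → i = i' := by
  classical
  obtain ⟨t, ht0, ht1, htc⟩ := exists_fractional w hw G hmax
  obtain ⟨N, hN⟩ := exists_nat_gt (max 0 (2 * C / c))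
  have hN0 : (0 : ℝ) < N := lt_of_le_of_lt (le_max_left _ _) hN
  have hNC : C ≤ c / 2 * N := by
    have := (le_max_right _ _).trans hN.le
    rw [div_le_iff₀ hc] at this
    linarith
  let A : I → Finset J := fun i => (G i).filter fun j => 1 / (N : ℝ) ≤ t i j ∧ 0 < w i j
  have hAw : ∀ i, c / 2 ≤ ∑ j ∈ A i, w i j := fun i => by
    have h1 : ∀ j ∈ G i, t i j * w i j ≤ (if 1 / (N : ℝ) ≤ t i j ∧ 0 < w i j then w i j else 0)
        + 1 / (N : ℝ) * w i j := fun j _ => by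
      have hwj := hw i j
      have h3 : 0 ≤ 1 / (N : ℝ) * w i j := by positivity
      split_ifs with h
      · have h2 := ht1 {i} j
        rw [Finset.sum_singleton] at h2
        have := mul_le_of_le_one_left hwj h2
        linarith
      · rw [zero_add]
        rcases hwj.eq_or_lt with h0 | h0
        · rw [← h0]; simp
        · have : t i j < 1 / N := by
            by_contra hcon
            exact h ⟨not_lt.1 hcon, h0⟩
          gcongr
    have h2 := (htc i).trans (Finset.sum_le_sum h1)
    rw [Finset.sum_add_distrib, ← Finset.sum_filter, ← Finset.mul_sum] at h2
    have h3 : 1 / (N : ℝ) * ∑ j ∈ G i, w i j ≤ c / 2 := by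
      rw [one_div, inv_mul_le_iff₀ hN0, mul_comm]
      exact (hC i).trans hNC
    change c / 2 ≤ ∑ j ∈ (G i).filter _, w i j
    linarith
  -- at most `N` of the sets contain a given point
  have hmult : ∀ j (F : Finset I), (∀ i ∈ F, j ∈ A i) → F.card ≤ N := by
    intro j F hF
    have h1 : F.card * (1 / (N : ℝ)) ≤ 1 := by
      rw [← nsmul_eq_mul, ← Finset.sum_const]
      exact (Finset.sum_le_sum fun i hi => (Finset.mem_filter.1 (hF i hi)).2.1).trans (ht1 F j)
    rw [mul_one_div, div_le_one hN0] at h1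
    exact_mod_cast h1
  have hfin : ∀ j, {i | j ∈ A i}.Finite := fun j => by
    by_contra hinf
    obtain ⟨F, hF, hcard⟩ := Set.Infinite.exists_subset_card_eq hinf (N + 1)
    have := hmult j F fun i hi => hF hi
    omega
  have hcol : ∀ j, ∃ k : I → Fin N, ∀ i i', j ∈ A i → j ∈ A i' → k i = k i' → i = i' := fun j => by
    have hcard : (hfin j).toFinset.card ≤ N := hmult j _ fun i hi => by simpa using hi
    have hNpos : 0 < N := by exact_mod_cast hN0
    obtain ⟨g⟩ : Nonempty ((hfin j).toFinset ↪ Fin N) :=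
      Function.Embedding.nonempty_of_card_le (by simpa using hcard)
    refine ⟨fun i => if hi : i ∈ (hfin j).toFinset then g ⟨i, hi⟩ else ⟨0, hNpos⟩,
      fun i i' hi hi' h => ?_⟩
    have h1 : i ∈ (hfin j).toFinset := by simpa using hi
    have h2 : i' ∈ (hfin j).toFinset := by simpa using hi'
    simp only [h1, h2, dif_pos] at h
    exact congrArg Subtype.val (g.injective h)
  choose k hk using hcol
  exact ⟨N, A, fun i j => k j i, fun i j hj => (Finset.mem_filter.1 hj).2.2, hAw,
    fun i i' j => hk j i i'⟩

end Fractional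

/-! ### Column maxima under an anti-Euclidean envelope -/

section ColumnMaxima

variable {𝕜 : Type v} [RCLike 𝕜] {X : Type u} [AddCommGroup X] [Module 𝕜 X]
  [UniformSpace X] [IsUniformAddGroup X] [ContinuousSMul 𝕜 X] [Norm X]
  [QuasiBanachSpace 𝕜 X]
  {E : Type u} [NormedAddCommGroup E] [NormedSpace 𝕜 E] [CompleteSpace E] {JX : X →ₗ[𝕜] E}
  {J : Type*} {x : J → X} {e : J → X →L[𝕜] 𝕜} {K : ℝ}
  {I : Type*} {u : I → X} {φ : I → X →L[𝕜] 𝕜}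

theorem IsUncSystem.mono (h : IsUncSystem x e K) {K' : ℝ} (hK : K ≤ K') : IsUncSystem x e K' where
  one_le := h.one_le.trans hK
  apply_self := h.apply_self
  apply_ne := h.apply_ne
  bound F c f hc := (h.bound F c f hc).trans (mul_le_mul_of_nonneg_right hK (qnorm_nonneg 𝕜 _))

omit [IsUniformAddGroup X] [ContinuousSMul 𝕜 X] [QuasiBanachSpace 𝕜 X] in
theorem IsUncSystem.comp (h : IsUncSystem u φ K) {ι : Type*} {g : ι → I}
    (hg : Function.Injective g) : IsUncSystem (fun i => u (g i)) (fun i => φ (g i)) K where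
  one_le := h.one_le
  apply_self i := h.apply_self _
  apply_ne i k hik := h.apply_ne _ _ (hg.ne hik)
  bound F c f hc := by
    classical
    have h1 := h.bound (F.map ⟨g, hg⟩) (Function.extend g c 0) f fun i => by
      by_cases hi : ∃ a, g a = i
      · obtain ⟨a, rfl⟩ := hi
        rw [hg.extend_apply]
        exact hc a
      · rw [Function.extend_apply' _ _ _ hi]
        simp
    rw [Finset.sum_map] at h1
    simpa only [Function.Embedding.coeFn_mk, hg.extend_apply] using h1

/-- The only use of the anti-Euclidean hypothesis: were the column maxima of some weighted families
`p i * |e j (u i)| * |φ i (x j)|` negligible, the envelope would contain complemented copies of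
`ℓ₂ⁿ` uniformly. -/
theorem IsBanachEnvelope.exists_column_bound [DecidableEq J] (hJ : IsBanachEnvelope JX)
    (hE : AntiEuclidean 𝕜 E) (hx : IsUncSystem x e K) (hu : IsUncSystem u φ K) (G : I → Finset J)
    (hlow : ∀ i, 1 / 2 ≤ ∑ j ∈ G i, ‖e j (u i)‖ * ‖φ i (x j)‖) :
    ∃ c : ℝ, 0 < c ∧ ∀ (F : Finset I) (p : I → ℝ) (m : J → ℝ), (∀ i ∈ F, 0 ≤ p i) →
      (∀ j, 0 ≤ m j) → (∀ i ∈ F, ∀ j ∈ G i, p i * (‖e j (u i)‖ * ‖φ i (x j)‖) ≤ m j) →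
        c * ∑ i ∈ F, p i ≤ ∑ j ∈ F.biUnion G, m j := by
  classical
  by_contra! hcon
  have hK := hu.one_le
  have hK0 : 0 < K := by linarith
  refine hE ⟨(8 * (648 ^ 2 * K ^ 3)) * (2 * (8 * (648 ^ 2 * K ^ 4))), by positivity, fun n => ?_⟩
  -- powers of `r = 1 / (n + 1)` make both smallness conditions of the Euclidean factor hold
  set C1 : ℝ := 648 ^ 2 * K ^ 3 with hC1
  have hC1' : 1 ≤ C1 := by
    have : 1 ≤ K ^ 3 := one_le_pow₀ hK
    rw [hC1]; linarith
  obtain ⟨r, hr0, hr1, hnr⟩ : ∃ r : ℝ, 0 < r ∧ r ≤ 1 ∧ n * r ≤ 1 := by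
    have h0 : (0 : ℝ) < n + 1 := by positivity
    refine ⟨1 / (n + 1), by positivity, ?_, ?_⟩
    · rw [div_le_one h0]; linarith [(Nat.cast_nonneg n : (0 : ℝ) ≤ n)]
    · rw [mul_one_div, div_le_one h0]; linarith
  have hn0 : (0 : ℝ) ≤ n := Nat.cast_nonneg n
  set t : ℝ := r ^ 3 / (128 * C1) with htdef
  have ht : 0 < t := by positivity
  have htC : t * C1 = r ^ 3 / 128 := by rw [htdef]; field_simp
  have ht1 : t ≤ 1 := by
    rw [htdef, div_le_one (by positivity)]
    have : r ^ 3 ≤ 1 := pow_le_one₀ hr0.le hr1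
    linarith
  set η : ℝ := t * (r ^ 3 / 256) with hηdef
  have hη : 0 < η := by positivity
  have hηt : η / t = r ^ 3 / 256 := by rw [hηdef]; field_simp
  have hη' : η ≤ r ^ 3 / 256 := mul_le_of_le_one_left (by positivity) ht1
  have hs : 2 * η + 2 * t * C1 ≤ r ^ 3 / 32 := by
    have : 0 < r ^ 3 := by positivity
    rw [mul_assoc 2 t, htC]; linarith
  have hs' : (n : ℝ) ^ 2 * (2 * η + 2 * t * C1) ≤ r / 32 := by
    calc (n : ℝ) ^ 2 * (2 * η + 2 * t * C1) ≤ (n : ℝ) ^ 2 * (r ^ 3 / 32) := by gcongr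
      _ = (n * r) ^ 2 * (r / 32) := by ring
      _ ≤ 1 ^ 2 * (r / 32) := by gcongr
      _ = r / 32 := by ring
  obtain ⟨F, p, m, hp0, hm0, hm, hlt⟩ := hcon η hη
  have hsum0 : 0 < ∑ i ∈ F, p i := by
    have h1 : 0 ≤ ∑ j ∈ F.biUnion G, m j := Finset.sum_nonneg fun j _ => hm0 j
    exact pos_of_mul_pos_right (h1.trans_lt hlt) hη.le
  set s := ∑ i ∈ F, p i with hsdef
  let F' := F.filter fun i => 0 < p i
  have hF' : ∑ i ∈ F', p i = s := Finset.sum_filter_of_ne fun i hi h =>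
    lt_of_le_of_ne (hp0 i hi) h.symm
  have hsmall : Small.{u} 𝕜 := by
    obtain ⟨i, hi, hpi⟩ := Finset.exists_ne_zero_of_sum_ne_zero hsum0.ne'
    have hui : u i ≠ 0 := fun h => by
      have := hu.apply_self i
      rw [h, map_zero] at this
      exact zero_ne_one this
    exact small_of_injective (f := fun c : 𝕜 => c • u i) (smul_left_injective 𝕜 hui)
  refine hJ.exists_euclidean_factor hx (hu.comp (g := fun i : F' => (i : I))
    Subtype.val_injective) n (fun i => p i / s) (fun i => ?_) ?_ (fun i => G i) (F.biUnion G)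
    (fun i => ?_) (fun j => m j / s) (fun j => div_nonneg (hm0 j) hsum0.le) (fun i => hlow i)
    (fun i j hj => ?_) ht (η := η) ?_ ?_ ?_
  · exact div_pos (Finset.mem_filter.1 i.2).2 hsum0
  · rw [← Finset.sum_div, Finset.sum_coe_sort F' p, hF', div_self hsum0.ne']
  · exact Finset.subset_biUnion_of_mem G (Finset.mem_filter.1 i.2).1
  · rw [div_mul_eq_mul_div]
    have := hm i (Finset.mem_filter.1 i.2).1 j hj
    gcongr
  · rw [← Finset.sum_div, div_le_iff₀ hsum0]
    exact hlt.le
  · exact hs'.trans (by linarith)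
  · rw [mul_div_assoc, hηt]
    calc 4 * (n : ℝ) * (2 * (r ^ 3 / 256) + n ^ 2 * (2 * η + 2 * t * C1))
        ≤ 4 * (n : ℝ) * (2 * (r / 256) + r / 32) := by
          have : r ^ 3 ≤ r := pow_le_of_le_one hr0.le hr1 (by norm_num)
          gcongr
      _ = (n * r) * (5 / 32) := by ring
      _ ≤ 1 * (5 / 32) := by gcongr
      _ ≤ 1 / 4 := by norm_num

omit [IsUniformAddGroup X] [ContinuousSMul 𝕜 X] [QuasiBanachSpace 𝕜 X] in
/-- The products of coordinates of `u i` and `φ i` sum to at least `φ i (u i) = 1`. -/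
theorem IsUncSystem.exists_finset_half_le (hu : IsUncSystem u φ K)
    (htot : ∀ f, HasSum (fun j => e j f • x j) f) (i : I) :
    ∃ G : Finset J, 1 / 2 ≤ ∑ j ∈ G, ‖e j (u i)‖ * ‖φ i (x j)‖ := by
  have h1 := (htot (u i)).mapL (φ i)
  rw [hu.apply_self] at h1
  obtain ⟨G, hG⟩ := (h1.norm.eventually (lt_mem_nhds
    (show (1 : ℝ) / 2 < ‖(1 : 𝕜)‖ by rw [norm_one]; norm_num))).exists
  refine ⟨G, hG.le.trans ((_root_.norm_sum_le _ _).trans (le_of_eq ?_))⟩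
  simp

theorem IsUncSystem.norm_apply_le (hu : IsUncSystem u φ K) (i : I) (f : X) :
    ‖φ i f‖ * ‖u i‖ ≤ K * ‖f‖ := by
  have := hu.bound {i} (fun _ => 1) f (by simp)
  rwa [Finset.sum_singleton, one_mul, qnorm_smul 𝕜] at this

/-- The products of coordinates of `u i` and `φ i` are uniformly summable. -/
theorem IsUncSystem.sum_norm_mul_le (hx : IsUncSystem x e K) (hu : IsUncSystem u φ K) (i : I)
    (G : Finset J) : ∑ j ∈ G, ‖e j (u i)‖ * ‖φ i (x j)‖ ≤ K * K := by
  choose c hc hc' using fun j => exists_norm_le_one_mul_eq (e j (u i) * φ i (x j))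
  have h1 : φ i (∑ j ∈ G, (c j * e j (u i)) • x j)
      = ((∑ j ∈ G, ‖e j (u i)‖ * ‖φ i (x j)‖ : ℝ) : 𝕜) := by
    rw [map_sum]
    push_cast
    refine Finset.sum_congr rfl fun j _ => ?_
    rw [map_smul, smul_eq_mul, mul_assoc, hc', norm_mul]
    push_cast
    rfl
  have hui : 0 < ‖u i‖ := qnorm_pos 𝕜 fun h => by
    have := hu.apply_self i
    rw [h, map_zero] at this
    exact zero_ne_one this
  have h2 := hu.norm_apply_le i (∑ j ∈ G, (c j * e j (u i)) • x j)
  have h3 := hx.bound G c (u i) hc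
  rw [h1, RCLike.norm_ofReal] at h2
  have hK : 0 < K := lt_of_lt_of_le one_pos hu.one_le
  refine (le_abs_self _).trans (le_of_mul_le_mul_right ?_ hui)
  refine h2.trans ?_
  rw [mul_assoc]
  gcongr

end ColumnMaxima

/-! ### Equivalence of families through operators -/

section Equivalence

variable {𝕜 : Type v} [RCLike 𝕜] {X : Type u} [AddCommGroup X] [Module 𝕜 X]
  [UniformSpace X] [IsUniformAddGroup X] [ContinuousSMul 𝕜 X]
  {Y : Type w} [AddCommGroup Y] [Module 𝕜 Y]
  [UniformSpace Y] [IsUniformAddGroup Y] [ContinuousSMul 𝕜 Y]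
  {J I I' : Type*}

omit [IsUniformAddGroup Y] [ContinuousSMul 𝕜 Y] in
theorem map_mem_of_mem_closedSpan {x : J → X} {S : Submodule 𝕜 Y} (hS : IsClosed (S : Set Y))
    (L : X →L[𝕜] Y) (hL : ∀ j, L (x j) ∈ S) {f : X} (hf : f ∈ closedSpan 𝕜 x) : L f ∈ S := by
  have h1 : closedSpan 𝕜 x ≤ S.comap (L : X →ₗ[𝕜] Y) := by
    refine Submodule.topologicalClosure_minimal _ (Submodule.span_le.2 ?_)
      (hS.preimage L.continuous)
    rintro _ ⟨j, rfl⟩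
    exact hL j
  exact h1 hf

theorem map_mem_closedSpan {x : J → X} {y : I → Y} (L : X →L[𝕜] Y)
    (hL : ∀ j, L (x j) ∈ closedSpan 𝕜 y) {f : X} (hf : f ∈ closedSpan 𝕜 x) :
    L f ∈ closedSpan 𝕜 y :=
  map_mem_of_mem_closedSpan (Submodule.isClosed_topologicalClosure _) L hL hf

omit [ContinuousSMul 𝕜 Y] in
theorem eq_of_closedSpan [T2Space Y] {x : J → X} (L M : X →L[𝕜] Y) (h : ∀ j, L (x j) = M (x j))
    {f : X} (hf : f ∈ closedSpan 𝕜 x) : L f = M f := by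
  have h1 : (L - M) f ∈ (⊥ : Submodule 𝕜 Y) :=
    map_mem_of_mem_closedSpan (by simp) (L - M) (fun j => by simp [h]) hf
  simpa [sub_eq_zero] using h1

/-- Operators on the whole space that exchange two families restrict to an isomorphism of their
closed spans. -/
theorem PermutativelyEquivalent.of_operators [T2Space X] {x : J → X} {y : I → X} (π : J ≃ I)
    (A B : X →L[𝕜] X) (hA : ∀ j, A (x j) = y (π j)) (hB : ∀ j, B (y (π j)) = x j) :
    PermutativelyEquivalent 𝕜 x y := by
  have hA' : ∀ f ∈ closedSpan 𝕜 x, A f ∈ closedSpan 𝕜 y := fun f =>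
    map_mem_closedSpan A fun j => by rw [hA]; exact mem_closedSpan 𝕜 y _
  have hB1 : ∀ i, B (y i) = x (π.symm i) := fun i => by rw [← hB, Equiv.apply_symm_apply]
  have hB' : ∀ f ∈ closedSpan 𝕜 y, B f ∈ closedSpan 𝕜 x := fun f =>
    map_mem_closedSpan B fun i => by rw [hB1]; exact mem_closedSpan 𝕜 x _
  refine ⟨π, ContinuousLinearEquiv.equivOfInverse
    ((A ∘L (closedSpan 𝕜 x).subtypeL).codRestrict _ fun f => hA' f f.2)
    ((B ∘L (closedSpan 𝕜 y).subtypeL).codRestrict _ fun f => hB' f f.2) (fun f => ?_) (fun f => ?_),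
    fun j => hA j⟩
  · exact Subtype.ext (eq_of_closedSpan (B ∘L A) (ContinuousLinearMap.id 𝕜 X)
      (fun j => by simp [hA, hB]) f.2)
  · exact Subtype.ext (eq_of_closedSpan (A ∘L B) (ContinuousLinearMap.id 𝕜 X)
      (fun i => by simp [hA, hB1]) f.2)

theorem PermutativelyEquivalent.trans {x : J → X} {y : I → X} {z : I' → X}
    (h : PermutativelyEquivalent 𝕜 x y) (h' : PermutativelyEquivalent 𝕜 y z) :
    PermutativelyEquivalent 𝕜 x z := by
  obtain ⟨π, T, hT⟩ := h
  obtain ⟨π', T', hT'⟩ := h'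
  refine ⟨π.trans π', T.trans T', fun j => ?_⟩
  have h1 : T ⟨x j, mem_closedSpan 𝕜 x j⟩ = ⟨y (π j), mem_closedSpan 𝕜 y _⟩ := Subtype.ext (hT j)
  rw [ContinuousLinearEquiv.trans_apply, h1, hT', Equiv.trans_apply]

theorem EquivalentSeq.permutativelyEquivalent {x y : J → X} (h : EquivalentSeq 𝕜 x y) :
    PermutativelyEquivalent 𝕜 x y :=
  ⟨Equiv.refl J, h⟩

variable [Norm X] [QuasiBanachSpace 𝕜 X] {u v : I → X} {φ : I → X →L[𝕜] 𝕜}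

/-- Convergence passes from a family to any family that it dominates. -/
theorem summable_of_norm_sum_le {C : ℝ} (hC : ∀ (F : Finset I) (a : I → 𝕜),
    ‖∑ i ∈ F, a i • v i‖ ≤ C * ‖∑ i ∈ F, a i • u i‖) {a : I → 𝕜}
    (ha : Summable fun i => a i • u i) : Summable fun i => a i • v i := by
  classical
  have := QuasiBanachSpace.complete 𝕜 (X := X)
  rw [summable_iff_vanishing] at ha ⊢
  intro U hU
  obtain ⟨ε, hε, hεU⟩ := (QuasiBanachSpace.nhds_zero_basis (𝕜 := 𝕜) (X := X)).mem_iff.1 hU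
  have hC1 : 0 < |C| + 1 := by positivity
  obtain ⟨s, hs⟩ := ha {f | ‖f‖ < ε / (|C| + 1)}
    ((QuasiBanachSpace.nhds_zero_basis (𝕜 := 𝕜) (X := X)).mem_of_mem (by positivity))
  refine ⟨s, fun t ht => hεU ?_⟩
  have h1 : ‖∑ i ∈ t, a i • u i‖ < ε / (|C| + 1) := hs t ht
  have h2 := qnorm_nonneg 𝕜 (∑ i ∈ t, a i • u i)
  calc ‖∑ i ∈ t, a i • v i‖ ≤ C * ‖∑ i ∈ t, a i • u i‖ := hC t a
    _ ≤ (|C| + 1) * ‖∑ i ∈ t, a i • u i‖ :=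
      mul_le_mul_of_nonneg_right ((le_abs_self C).trans (by linarith)) h2
    _ < (|C| + 1) * (ε / (|C| + 1)) := by gcongr
    _ = ε := by field_simp

/-- If `v` is dominated by `u`, and `u` has projecting functionals, then `u i ↦ v i` extends to a
bounded operator on the whole space. -/
theorem exists_operator_of_norm_sum_le (h1 : ∀ i, φ i (u i) = 1)
    (h2 : ∀ i k, i ≠ k → φ i (u k) = 0) (hs : ∀ f, Summable fun i => φ i f • u i) {C M : ℝ}
    (hC0 : 0 ≤ C)
    (hM : ∀ (F : Finset I) f, ‖∑ i ∈ F, φ i f • u i‖ ≤ M * ‖f‖)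
    (hC : ∀ (F : Finset I) (a : I → 𝕜), ‖∑ i ∈ F, a i • v i‖ ≤ C * ‖∑ i ∈ F, a i • u i‖) :
    ∃ L : X →L[𝕜] X, ∀ i, L (u i) = v i := by
  classical
  have := t2Space 𝕜 (X := X)
  have hκ := quasiConst_pos 𝕜 X
  have hs' : ∀ f, Summable fun i => φ i f • v i := fun f => summable_of_norm_sum_le hC (hs f)
  let L : X →ₗ[𝕜] X :=
    { toFun := fun f => ∑' i, φ i f • v i
      map_add' := fun f g => by
        rw [← (hs' f).tsum_add (hs' g)]
        simp only [map_add, add_smul]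
      map_smul' := fun c f => by
        rw [RingHom.id_apply, ← (hs' f).tsum_const_smul]
        simp only [map_smul, smul_eq_mul, mul_smul] }
  refine ⟨⟨L, continuous_of_qbound 𝕜 L (quasiConst 𝕜 X * (C * M)) fun f => ?_⟩, fun i => ?_⟩
  · rw [mul_assoc]
    refine qnorm_le_of_tendsto 𝕜 (hs' f).hasSum (Filter.Eventually.of_forall fun F => ?_)
    rw [mul_assoc]
    exact (hC F _).trans (mul_le_mul_of_nonneg_left (hM F f) hC0)
  · change ∑' k, φ k (u i) • v k = v i
    rw [tsum_eq_single i fun k hk => by rw [h2 k i hk, zero_smul], h1, one_smul]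

/-- Uniformly bounded partial sums converge everywhere once they are eventually constant on a
total set. -/
theorem summable_of_bounded {x : J → X} (e : J → X →L[𝕜] 𝕜)
    (htot : ∀ f, HasSum (fun j => e j f • x j) f) {M : ℝ}
    (hM : ∀ (F : Finset I) f, ‖∑ i ∈ F, φ i f • u i‖ ≤ M * ‖f‖)
    (hfin : ∀ j, {i | φ i (x j) ≠ 0}.Finite) (f : X) : Summable fun i => φ i f • u i := by
  classical
  have := QuasiBanachSpace.complete 𝕜 (X := X)
  rw [summable_iff_vanishing]
  intro U hU
  obtain ⟨ε, hε, hεU⟩ := (QuasiBanachSpace.nhds_zero_basis (𝕜 := 𝕜) (X := X)).mem_iff.1 hU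
  have hM1 : 0 < |M| + 1 := by positivity
  obtain ⟨D, hD⟩ := (eventually_qnorm_sub_lt 𝕜 (htot f) (ε := ε / (|M| + 1))
    (by positivity)).exists
  set g := ∑ j ∈ D, e j f • x j with hg
  refine ⟨D.biUnion fun j => (hfin j).toFinset, fun t ht => hεU ?_⟩
  have h0 : ∀ i ∈ t, φ i g = 0 := fun i hi => by
    rw [hg, map_sum]
    refine Finset.sum_eq_zero fun j hj => ?_
    have h1 : φ i (x j) = 0 := by
      by_contra h
      exact Finset.disjoint_left.1 ht hi (Finset.mem_biUnion.2 ⟨j, hj, by simpa using h⟩)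
    rw [map_smul, h1, smul_zero]
  have h1 : ∑ i ∈ t, φ i f • u i = ∑ i ∈ t, φ i (f - g) • u i :=
    Finset.sum_congr rfl fun i hi => by rw [map_sub, h0 i hi, sub_zero]
  have h2 := qnorm_nonneg 𝕜 (f - g)
  have h3 : ‖f - g‖ < ε / (|M| + 1) := by
    rw [qnorm_sub_comm 𝕜]
    exact hD
  change ‖∑ i ∈ t, φ i f • u i‖ < ε
  rw [h1]
  calc ‖∑ i ∈ t, φ i (f - g) • u i‖ ≤ M * ‖f - g‖ := hM t _
    _ ≤ (|M| + 1) * ‖f - g‖ :=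
      mul_le_mul_of_nonneg_right ((le_abs_self M).trans (by linarith)) h2
    _ < (|M| + 1) * (ε / (|M| + 1)) := by gcongr
    _ = ε := by field_simp

end Equivalence

/-! ### Copies of the basis inside itself -/

section Copies

variable {𝕜 : Type v} [RCLike 𝕜] {X : Type u} [AddCommGroup X] [Module 𝕜 X]
  [UniformSpace X] [IsUniformAddGroup X] [ContinuousSMul 𝕜 X]
  {J : Type*} {x : J → X} {e : J → X →L[𝕜] 𝕜}

/-- One step of splitting: `x` is the union of two families `x ∘ σ₀`, `x ∘ σ₁` equivalent to `x`. -/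
theorem exists_halves (hspan : closedSpan 𝕜 x = ⊤) (h1 : ∀ j, e j (x j) = 1)
    (h2 : ∀ i k, i ≠ k → e i (x k) = 0) (hsq : PermutativelyEquivalent 𝕜 x (squareSeq x)) :
    ∃ (V₀ V₁ W₀ W₁ : X →L[𝕜] X) (σ₀ σ₁ : J → J), Function.Injective σ₀ ∧ Function.Injective σ₁ ∧
      (∀ i j, σ₀ i ≠ σ₁ j) ∧ (∀ j, V₀ (x j) = x (σ₀ j)) ∧ (∀ j, V₁ (x j) = x (σ₁ j)) ∧
      (∀ j f, e j (W₀ f) = e (σ₀ j) f) ∧ ∀ j f, e j (W₁ f) = e (σ₁ j) f := by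
  obtain ⟨π, T, hT⟩ := hsq
  have hmem : ∀ f, f ∈ closedSpan 𝕜 x := fun f => by rw [hspan]; trivial
  have hinl : ∀ f : X, ContinuousLinearMap.inl 𝕜 X X f ∈ closedSpan 𝕜 (squareSeq x) := fun f =>
    map_mem_closedSpan _ (fun j => mem_closedSpan 𝕜 (squareSeq x) (Sum.inl j)) (hmem f)
  have hinr : ∀ f : X, ContinuousLinearMap.inr 𝕜 X X f ∈ closedSpan 𝕜 (squareSeq x) := fun f =>
    map_mem_closedSpan _ (fun j => mem_closedSpan 𝕜 (squareSeq x) (Sum.inr j)) (hmem f)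
  let R : X →L[𝕜] X × X := (closedSpan 𝕜 (squareSeq x)).subtypeL ∘L
    (T : closedSpan 𝕜 x →L[𝕜] closedSpan 𝕜 (squareSeq x)) ∘L
    (ContinuousLinearMap.id 𝕜 X).codRestrict (closedSpan 𝕜 x) hmem
  have hR : ∀ j, R (x j) = squareSeq x (π j) := hT
  have hTs : ∀ s (hs : squareSeq x s ∈ closedSpan 𝕜 (squareSeq x)),
      ((T.symm ⟨squareSeq x s, hs⟩ : closedSpan 𝕜 x) : X) = x (π.symm s) := fun s hs => by
    have h3 : T ⟨x (π.symm s), mem_closedSpan 𝕜 x _⟩ = ⟨squareSeq x s, hs⟩ := by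
      refine Subtype.ext ?_
      rw [hT, Equiv.apply_symm_apply]
    rw [← h3, ContinuousLinearEquiv.symm_apply_apply]
  refine ⟨(closedSpan 𝕜 x).subtypeL ∘L
      (T.symm : closedSpan 𝕜 (squareSeq x) →L[𝕜] closedSpan 𝕜 x) ∘L
      (ContinuousLinearMap.inl 𝕜 X X).codRestrict _ hinl,
    (closedSpan 𝕜 x).subtypeL ∘L
      (T.symm : closedSpan 𝕜 (squareSeq x) →L[𝕜] closedSpan 𝕜 x) ∘L
      (ContinuousLinearMap.inr 𝕜 X X).codRestrict _ hinr,
    ContinuousLinearMap.fst 𝕜 X X ∘L R, ContinuousLinearMap.snd 𝕜 X X ∘L R,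
    fun j => π.symm (Sum.inl j), fun j => π.symm (Sum.inr j),
    π.symm.injective.comp Sum.inl_injective, π.symm.injective.comp Sum.inr_injective,
    fun i j => π.symm.injective.ne Sum.inl_ne_inr, fun j => hTs (Sum.inl j) _,
    fun j => hTs (Sum.inr j) _, fun j f => ?_, fun j f => ?_⟩
  · refine eq_of_closedSpan (e j ∘L ContinuousLinearMap.fst 𝕜 X X ∘L R) (e (π.symm (Sum.inl j)))
      (fun k => ?_) (hmem f)
    obtain ⟨s, rfl⟩ := π.symm.surjective k
    change e j (R _).1 = _
    rw [hR, Equiv.apply_symm_apply]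
    rcases s with i | i
    · by_cases hij : j = i
      · subst hij; rw [h1]; exact h1 j
      · rw [h2 _ _ (π.symm.injective.ne (Sum.inl_injective.ne hij))]; exact h2 j i hij
    · rw [h2 _ _ (π.symm.injective.ne Sum.inl_ne_inr)]; exact map_zero _
  · refine eq_of_closedSpan (e j ∘L ContinuousLinearMap.snd 𝕜 X X ∘L R) (e (π.symm (Sum.inr j)))
      (fun k => ?_) (hmem f)
    obtain ⟨s, rfl⟩ := π.symm.surjective k
    change e j (R _).2 = _
    rw [hR, Equiv.apply_symm_apply]
    rcases s with i | i
    · rw [h2 _ _ (π.symm.injective.ne Sum.inr_ne_inl)]; exact map_zero _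
    · by_cases hij : j = i
      · subst hij; rw [h1]; exact h1 j
      · rw [h2 _ _ (π.symm.injective.ne (Sum.inr_injective.ne hij))]; exact h2 j i hij

/-- Disjoint copies `x ∘ σ k` of the basis inside itself, with operators onto and from them. -/
theorem exists_copies (hspan : closedSpan 𝕜 x = ⊤) (h1 : ∀ j, e j (x j) = 1)
    (h2 : ∀ i k, i ≠ k → e i (x k) = 0) (hsq : PermutativelyEquivalent 𝕜 x (squareSeq x)) :
    ∃ (V W : ℕ → X →L[𝕜] X) (σ : ℕ → J → J),
      (∀ k l i j, σ k i = σ l j → k = l ∧ i = j) ∧ (∀ k j, V k (x j) = x (σ k j)) ∧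
      ∀ k j f, e j (W k f) = e (σ k j) f := by
  obtain ⟨V₀, V₁, W₀, W₁, σ₀, σ₁, hσ₀, hσ₁, hne, hV₀, hV₁, hW₀, hW₁⟩ :=
    exists_halves hspan h1 h2 hsq
  refine ⟨fun k => V₁ ^ k * V₀, fun k => W₀ * W₁ ^ k, fun k j => σ₁^[k] (σ₀ j), fun k => ?_,
    fun k j => ?_, fun k j f => ?_⟩
  · change ∀ l i j, σ₁^[k] (σ₀ i) = σ₁^[l] (σ₀ j) → k = l ∧ i = j
    induction k with
    | zero =>
      rintro (_ | l) i j h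
      · exact ⟨rfl, hσ₀ h⟩
      · rw [Function.iterate_succ_apply'] at h
        exact absurd h (hne _ _)
    | succ k ih =>
      rintro (_ | l) i j h
      · rw [Function.iterate_succ_apply'] at h
        exact absurd h.symm (hne _ _)
      · rw [Function.iterate_succ_apply', Function.iterate_succ_apply'] at h
        obtain ⟨h3, h4⟩ := ih l i j (hσ₁ h)
        exact ⟨congrArg _ h3, h4⟩
  · change (V₁ ^ k) (V₀ (x j)) = x (σ₁^[k] (σ₀ j))
    rw [hV₀]
    induction k with
    | zero => rfl
    | succ k ih => rw [Function.iterate_succ_apply', ← hV₁, ← ih, pow_succ']; rfl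
  · change e j (W₀ ((W₁ ^ k) f)) = e (σ₁^[k] (σ₀ j)) f
    rw [hW₀]
    induction k generalizing f with
    | zero => rfl
    | succ k ih => rw [Function.iterate_succ_apply', ← hW₁, ← ih, pow_succ]; rfl

end Copies

/-! ### Transfer to blocks of disjoint copies -/

section Blocks

variable {𝕜 : Type v} [RCLike 𝕜] {X : Type u} [AddCommGroup X] [Module 𝕜 X]
  [UniformSpace X] [IsUniformAddGroup X] [ContinuousSMul 𝕜 X]
  {J : Type*} {x : J → X} {e : J → X →L[𝕜] 𝕜} {K : ℝ}
  {I : Type*} {u : I → X} {φ : I → X →L[𝕜] 𝕜}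

omit [IsUniformAddGroup X] [ContinuousSMul 𝕜 X] [UniformSpace X] in
/-- A double sum over disjoint sets, as a sum over their union: `s j` is the set containing `j`. -/
theorem exists_owner [DecidableEq J] [Nonempty I] (B : I → Finset J)
    (hB : ∀ i i' j, j ∈ B i → j ∈ B i' → i = i') (F : Finset I) :
    ∃ s : J → I, (∀ j ∈ F.biUnion B, s j ∈ F ∧ j ∈ B (s j)) ∧
      ∀ y : I → J → X, ∑ i ∈ F, ∑ j ∈ B i, y i j = ∑ j ∈ F.biUnion B, y (s j) j := by
  classical
  have hs : ∀ j ∈ F.biUnion B, (Classical.epsilon fun i => i ∈ F ∧ j ∈ B i) ∈ F ∧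
      j ∈ B (Classical.epsilon fun i => i ∈ F ∧ j ∈ B i) := fun j hj =>
    Classical.epsilon_spec (p := fun i => i ∈ F ∧ j ∈ B i) (Finset.mem_biUnion.1 hj)
  refine ⟨fun j => Classical.epsilon fun i => i ∈ F ∧ j ∈ B i, hs, fun y => ?_⟩
  rw [Finset.sum_biUnion fun i _ i' _ h => Finset.disjoint_left.2 fun j hj hj' =>
    h (hB i i' j hj hj')]
  refine Finset.sum_congr rfl fun i hi => Finset.sum_congr rfl fun j hj => ?_
  rw [hB i _ j hj (hs j (Finset.mem_biUnion.2 ⟨i, hi, hj⟩)).2]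

variable [Norm X] [QuasiBanachSpace 𝕜 X]

theorem exists_bound_sum_endo (V : ℕ → X →L[𝕜] X) (N : ℕ) : ∃ M : ℝ, 0 < M ∧
    ∀ (g : Fin N → X) (t : ℝ), 0 ≤ t → (∀ k, ‖g k‖ ≤ t) → ‖∑ k : Fin N, V k (g k)‖ ≤ M * t := by
  choose M hM0 hM using fun k => exists_bound_endo 𝕜 (V k)
  have h0 : 0 ≤ ∑ k : Fin N, M k := Finset.sum_nonneg fun k _ => (hM0 k).le
  have hκ := quasiConst_pos 𝕜 X
  refine ⟨quasiConst 𝕜 X ^ N * (N * ∑ k : Fin N, M k) + 1, by positivity, fun g t ht0 ht => ?_⟩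
  have h1 := qnorm_sum_le_of_le 𝕜 (Finset.univ : Finset (Fin N)) (fun k => V k (g k))
    (C := (∑ k : Fin N, M k) * t) fun k _ => by
      refine (hM k (g k)).trans ?_
      gcongr
      · exact qnorm_nonneg 𝕜 _
      · exact Finset.single_le_sum (f := fun k : Fin N => M k) (fun i _ => (hM0 i).le)
          (Finset.mem_univ k)
      · exact ht k
  rw [Finset.card_univ, Fintype.card_fin] at h1
  linarith

variable {σ : ℕ → J → J} {N : ℕ} {A : I → Finset J} {k : I → J → Fin N}

/-- Moving the pieces of `u i` to disjoint copies of the basis costs only a constant: copy by copy,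
the pieces form a selection of coordinates. -/
theorem exists_block_norm_le (hx : IsUncSystem x e K) (hL : IsLConvexBasis 𝕜 x)
    (hu : IsUncSystem u φ K) {V : ℕ → X →L[𝕜] X} (hV : ∀ k j, V k (x j) = x (σ k j))
    (hk : ∀ i i' j, j ∈ A i → j ∈ A i' → k i j = k i' j → i = i') :
    ∃ C : ℝ, 0 < C ∧ ∀ (F : Finset I) (a : I → 𝕜),
      ‖∑ i ∈ F, a i • ∑ j ∈ A i, e j (u i) • x (σ (k i j) j)‖ ≤ C * ‖∑ i ∈ F, a i • u i‖ := by
  classical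
  rcases isEmpty_or_nonempty I with hI | hI
  · refine ⟨1, one_pos, fun F a => ?_⟩
    have hF : F = ∅ := Finset.eq_empty_of_isEmpty F
    simp [hF, qnorm_zero 𝕜 (X := X)]
  obtain ⟨C, hC0, hC⟩ := exists_selection_bound hx hL hu
  obtain ⟨M, hM0, hM⟩ := exists_bound_sum_endo V N
  refine ⟨M * C, by positivity, fun F a => ?_⟩
  have h1 : ∑ i ∈ F, a i • ∑ j ∈ A i, e j (u i) • x (σ (k i j) j) = ∑ κ : Fin N, V κ
      (∑ i ∈ F, ∑ j ∈ (A i).filter (fun j => k i j = κ), (a i * e j (u i)) • x j) := by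
    simp only [map_sum, map_smul, hV]
    rw [Finset.sum_comm]
    refine Finset.sum_congr rfl fun i _ => ?_
    rw [Finset.smul_sum, ← Finset.sum_fiberwise (A i) (k i)]
    refine Finset.sum_congr rfl fun κ _ => Finset.sum_congr rfl fun j hj => ?_
    rw [(Finset.mem_filter.1 hj).2, mul_smul]
  rw [h1, mul_assoc]
  refine hM _ _ (mul_nonneg hC0.le (qnorm_nonneg 𝕜 _)) fun κ => ?_
  obtain ⟨s, hs, hsum⟩ := exists_owner (X := X) (fun i => (A i).filter fun j => k i j = κ)
    (fun i i' j hj hj' => by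
      rw [Finset.mem_filter] at hj hj'
      exact hk i i' j hj.1 hj'.1 (hj.2.trans hj'.2.symm)) F
  rw [hsum fun i j => (a i * e j (u i)) • x j]
  refine hC F a _ s _ fun j hj => ⟨(hs j hj).1, ?_⟩
  rw [norm_mul]

/-- The functionals reading off `u i` from its pieces define a bounded operator: copy by copy, this
is a diagonal. -/
theorem exists_block_projection_le (hx : IsUncSystem x e K)
    (htot : ∀ f, HasSum (fun j => e j f • x j) f) (hL : IsLConvexBasis 𝕜 x)
    (hu : IsUncSystem u φ K) {W : ℕ → X →L[𝕜] X} (hW : ∀ k j f, e j (W k f) = e (σ k j) f)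
    (hk : ∀ i i' j, j ∈ A i → j ∈ A i' → k i j = k i' j → i = i') (θ : I → J → 𝕜)
    (hθ : ∀ i j, ‖θ i j‖ ≤ 1) (d : I → 𝕜) (hd : ∀ i, ‖d i‖ ≤ 1) :
    ∃ C : ℝ, 0 < C ∧ ∀ (F : Finset I) (f : X),
      ‖∑ i ∈ F, (d i * ∑ j ∈ A i, θ i j * φ i (x j) * e (σ (k i j) j) f) • u i‖ ≤ C * ‖f‖ := by
  classical
  rcases isEmpty_or_nonempty I with hI | hI
  · refine ⟨1, one_pos, fun F f => ?_⟩
    have hF : F = ∅ := Finset.eq_empty_of_isEmpty F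
    simp [hF, qnorm_zero 𝕜 (X := X), qnorm_nonneg 𝕜 f]
  obtain ⟨C, hC0, hC⟩ := exists_diagonal_bound hx htot hL hu
  choose M hM0 hM using fun k => exists_bound_endo 𝕜 (W k)
  have hκ := quasiConst_pos 𝕜 X
  have hK : 0 < K := lt_of_lt_of_le one_pos hu.one_le
  have h0 : 0 ≤ ∑ κ : Fin N, M κ := Finset.sum_nonneg fun k _ => (hM0 k).le
  refine ⟨quasiConst 𝕜 X ^ N * (N * (C * (K * ∑ κ : Fin N, M κ))) + 1, by positivity,
    fun F f => ?_⟩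
  have hf0 := qnorm_nonneg 𝕜 f
  set g : Fin N → I → X := fun κ i =>
    ∑ j ∈ (A i).filter (fun j => k i j = κ), (θ i j * e j (W κ f)) • x j with hg
  have h1 : ∑ i ∈ F, (d i * ∑ j ∈ A i, θ i j * φ i (x j) * e (σ (k i j) j) f) • u i
      = ∑ κ : Fin N, ∑ i ∈ F, (d i * φ i (g κ i)) • u i := by
    rw [Finset.sum_comm]
    refine Finset.sum_congr rfl fun i _ => ?_
    rw [← Finset.sum_smul, ← Finset.mul_sum, ← Finset.sum_fiberwise (A i) (k i)]
    congr 2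
    refine Finset.sum_congr rfl fun κ _ => ?_
    rw [hg, map_sum]
    refine Finset.sum_congr rfl fun j hj => ?_
    rw [(Finset.mem_filter.1 hj).2, map_smul, hW, smul_eq_mul]
    ring
  rw [h1]
  have h2 := qnorm_sum_le_of_le 𝕜 (Finset.univ : Finset (Fin N))
    (fun κ => ∑ i ∈ F, (d i * φ i (g κ i)) • u i)
    (C := C * (K * ∑ κ : Fin N, M κ) * ‖f‖) fun κ _ => by
      refine (hC F d (g κ) (K * ‖W κ f‖) hd fun ε => ?_).trans ?_
      · obtain ⟨s, hs, hsum⟩ := exists_owner (X := X) (fun i => (A i).filter fun j => k i j = κ)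
          (fun i i' j hj hj' => by
            rw [Finset.mem_filter] at hj hj'
            exact hk i i' j hj.1 hj'.1 (hj.2.trans hj'.2.symm)) F
        have h3 : ∑ i ∈ F, (sgn (ε i) : 𝕜) • g κ i = ∑ i ∈ F,
            ∑ j ∈ (A i).filter (fun j => k i j = κ),
              ((sgn (ε i) : 𝕜) * (θ i j * e j (W κ f))) • x j := by
          refine Finset.sum_congr rfl fun i _ => ?_
          rw [hg, Finset.smul_sum]
          exact Finset.sum_congr rfl fun j _ => (mul_smul _ _ _).symm
        rw [h3, hsum fun i j => ((sgn (ε i) : 𝕜) * (θ i j * e j (W κ f))) • x j]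
        refine hx.norm_sum_le _ _ _ fun j _ => ?_
        rw [norm_mul, norm_mul, norm_sgn, one_mul]
        exact mul_le_of_le_one_left (norm_nonneg _) (hθ _ _)
      · have h4 : M κ ≤ ∑ κ : Fin N, M κ := Finset.single_le_sum (f := fun k : Fin N => M k)
          (fun i _ => (hM0 i).le) (Finset.mem_univ κ)
        calc C * (K * ‖W κ f‖) ≤ C * (K * ((∑ κ : Fin N, M κ) * ‖f‖)) := by
              gcongr
              exact (hM κ f).trans (by gcongr)
          _ = _ := by ring
  rw [Finset.card_univ, Fintype.card_fin] at h2
  linarith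

omit [Norm X] [QuasiBanachSpace 𝕜 X] in
theorem basisCoeff_eq [T2Space X] (hx : IsUnconditionalBasis 𝕜 x)
    (htot : ∀ f, HasSum (fun j => e j f • x j) f) (f : X) : basisCoeff 𝕜 x f = fun j => e j f :=
  (hx.1 f (by rw [hx.2]; trivial)).unique
    (Classical.epsilon_spec (p := fun a : J → 𝕜 => HasSum (fun j => a j • x j) f) ⟨_, htot f⟩)
    (htot f)

/-- The blocks `v i = ∑ j ∈ A i, e j (u i) x (σ (k i j) j)` are well complemented and equivalent to
`u`, provided that the sets `A i` carry a fixed part of the mass of `e j (u i) φ i (x j)`. -/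
theorem exists_equivalent_blocks (hx : IsUncSystem x e K) (hbasis : IsUnconditionalBasis 𝕜 x)
    (htot : ∀ f, HasSum (fun j => e j f • x j) f) (hL : IsLConvexBasis 𝕜 x)
    (hu : IsUncSystem u φ K) (hus : ∀ f, Summable fun i => φ i f • u i) (hun : SemiNormalized u)
    {V W : ℕ → X →L[𝕜] X} (hσ : ∀ k l i j, σ k i = σ l j → k = l ∧ i = j)
    (hV : ∀ k j, V k (x j) = x (σ k j)) (hW : ∀ k j f, e j (W k f) = e (σ k j) f)
    (hk : ∀ i i' j, j ∈ A i → j ∈ A i' → k i j = k i' j → i = i') {c : ℝ} (hc : 0 < c)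
    (hpos : ∀ i, ∀ j ∈ A i, 0 < ‖e j (u i)‖ * ‖φ i (x j)‖)
    (hlow : ∀ i, c ≤ ∑ j ∈ A i, ‖e j (u i)‖ * ‖φ i (x j)‖) :
    ∃ v : I → X, SemiNormalized v ∧ IsWellComplementedBlockBasicSeq 𝕜 x v ∧
      PermutativelyEquivalent 𝕜 u v := by
  classical
  have := t2Space 𝕜 (X := X)
  obtain ⟨C, hC0, hC⟩ := exists_block_norm_le hx hL hu hV hk
  set v : I → X := fun i => ∑ j ∈ A i, e j (u i) • x (σ (k i j) j) with hv
  choose θ hθ hθ' using fun i j => exists_norm_le_one_mul_eq (e j (u i) * φ i (x j))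
  set S : I → ℝ := fun i => ∑ j ∈ A i, ‖e j (u i)‖ * ‖φ i (x j)‖ with hS
  have hS0 : ∀ i, 0 < S i := fun i => hc.trans_le (hlow i)
  have hS' : ∀ i, (S i : 𝕜) ≠ 0 := fun i => RCLike.ofReal_ne_zero.2 (hS0 i).ne'
  have hc' : (c : 𝕜) ≠ 0 := RCLike.ofReal_ne_zero.2 hc.ne'
  -- projecting functionals: the phases `θ` make all terms of `ψ i (v i)` nonnegative
  set ψ : I → X →L[𝕜] 𝕜 := fun i =>
    (S i : 𝕜)⁻¹ • ∑ j ∈ A i, (θ i j * φ i (x j)) • e (σ (k i j) j) with hψ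
  have hψf : ∀ i f, ψ i f = (S i : 𝕜)⁻¹ * ∑ j ∈ A i, θ i j * φ i (x j) * e (σ (k i j) j) f := by
    intro i f
    simp [hψ]
  obtain ⟨C', hC0', hC'⟩ := exists_block_projection_le hx htot hL hu hW hk θ hθ
    (fun i => (c : 𝕜) * (S i : 𝕜)⁻¹) fun i => by
      rw [norm_mul, norm_inv, RCLike.norm_ofReal, RCLike.norm_ofReal, abs_of_pos hc,
        abs_of_pos (hS0 i), ← div_eq_mul_inv]
      exact div_le_one_of_le₀ (hlow i) (hS0 i).le
  have hB : ∀ (F : Finset I) f, ‖∑ i ∈ F, ψ i f • u i‖ ≤ c⁻¹ * C' * ‖f‖ := fun F f => by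
    have h1 : ∑ i ∈ F, ψ i f • u i = (c : 𝕜)⁻¹ • ∑ i ∈ F, ((c : 𝕜) * (S i : 𝕜)⁻¹ *
        ∑ j ∈ A i, θ i j * φ i (x j) * e (σ (k i j) j) f) • u i := by
      rw [Finset.smul_sum]
      refine Finset.sum_congr rfl fun i _ => ?_
      rw [smul_smul, hψf, mul_assoc (c : 𝕜), inv_mul_cancel_left₀ hc']
    rw [h1, qnorm_smul 𝕜, norm_inv, RCLike.norm_ofReal, abs_of_pos hc, mul_assoc]
    exact mul_le_mul_of_nonneg_left (hC' F f) (inv_nonneg.2 hc.le)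
  -- the coordinates of the blocks
  have hxe : ∀ m m', e m (x m') = if m = m' then 1 else 0 := fun m m' => by
    split_ifs with h
    · rw [h, hx.apply_self]
    · exact hx.apply_ne _ _ h
  have hev : ∀ i m, e m (v i) = ∑ j ∈ A i, if m = σ (k i j) j then e j (u i) else 0 := by
    intro i m
    simp [hv, hxe]
  have hinj : ∀ i i' j j', j ∈ A i → j' ∈ A i' → σ (k i j) j = σ (k i' j') j' →
      i = i' ∧ j = j' := by
    intro i i' j j' hj hj' h
    obtain ⟨h1, rfl⟩ := hσ _ _ _ _ h
    exact ⟨hk i i' j hj hj' (Fin.ext h1), rfl⟩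
  have hself : ∀ i, ∀ j ∈ A i, e (σ (k i j) j) (v i) = e j (u i) := fun i j hj => by
    rw [hev, Finset.sum_eq_single_of_mem j hj, if_pos rfl]
    exact fun j' hj' hne => if_neg fun h => hne (hinj i i j j' hj hj' h).2.symm
  have hsupp : ∀ i m, e m (v i) ≠ 0 → ∃ j ∈ A i, m = σ (k i j) j := fun i m h => by
    rw [hev] at h
    obtain ⟨j, hj, hne⟩ := Finset.exists_ne_zero_of_sum_ne_zero h
    exact ⟨j, hj, by by_contra h'; exact hne (if_neg h')⟩
  have hcoeff : ∀ i, vecSupport 𝕜 x (v i) = {m | e m (v i) ≠ 0} := fun i => by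
    rw [vecSupport, basisCoeff_eq hbasis htot]
  have hdisj : ∀ i i', i ≠ i' → ∀ j ∈ A i, e (σ (k i j) j) (v i') = 0 := fun i i' hne j hj => by
    by_contra h
    obtain ⟨j', hj', h'⟩ := hsupp i' _ h
    exact hne (hinj i i' j j' hj hj' h').1
  have hψ1 : ∀ i, ψ i (v i) = 1 := fun i => by
    rw [hψf, inv_mul_eq_one₀ (hS' i), hS]
    push_cast
    refine Finset.sum_congr rfl fun j hj => ?_
    rw [hself i j hj, mul_assoc, mul_comm (φ i (x j)), hθ', norm_mul]
    push_cast
    rfl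
  have hψ0 : ∀ i i', i ≠ i' → ψ i (v i') = 0 := fun i i' hne => by
    rw [hψf, Finset.sum_eq_zero fun j hj => by rw [hdisj i i' hne j hj, mul_zero], mul_zero]
  have hψsupp : ∀ i m, ψ i (x m) ≠ 0 → ∃ j ∈ A i, m = σ (k i j) j := fun i m h => by
    rw [hψf] at h
    obtain ⟨j, hj, hne⟩ := Finset.exists_ne_zero_of_sum_ne_zero (right_ne_zero_of_mul h)
    refine ⟨j, hj, ?_⟩
    by_contra h'
    exact hne (by rw [hxe, if_neg (Ne.symm h'), mul_zero])
  have hne0 : ∀ i, ∀ j ∈ A i, e j (u i) ≠ 0 := fun i j hj h => by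
    have := hpos i j hj
    rw [h, norm_zero, zero_mul] at this
    exact lt_irrefl _ this
  have hψs : ∀ f, Summable fun i => ψ i f • v i := by
    refine summable_of_bounded e htot (M := C * (c⁻¹ * C')) (fun F f => ?_) fun m => ?_
    · rw [mul_assoc]
      exact (hC F _).trans (mul_le_mul_of_nonneg_left (hB F f) hC0.le)
    · refine Set.Subsingleton.finite fun i hi i' hi' => ?_
      obtain ⟨j, hj, h⟩ := hψsupp i m hi
      obtain ⟨j', hj', h'⟩ := hψsupp i' m hi'
      exact (hinj i i' j j' hj hj' (h.symm.trans h')).1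
  -- `v` dominates `u`, by the bound for the functionals `ψ` applied to `∑ a i v i`
  have hvu : ∀ (F : Finset I) (a : I → 𝕜),
      ‖∑ i ∈ F, a i • u i‖ ≤ c⁻¹ * C' * ‖∑ i ∈ F, a i • v i‖ := fun F a => by
    refine le_of_eq_of_le ?_ (hB F _)
    congr 1
    refine Finset.sum_congr rfl fun i hi => ?_
    rw [apply_sum_of_biorth hψ1 hψ0, if_pos hi]
  obtain ⟨T, hT⟩ := exists_operator_of_norm_sum_le hu.apply_self hu.apply_ne hus hC0.le
    (M := K) (fun F f => by simpa using hu.bound F (fun _ => 1) f (by simp)) hC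
  obtain ⟨R, hR⟩ := exists_operator_of_norm_sum_le hψ1 hψ0 hψs
    (mul_nonneg (inv_nonneg.2 hc.le) hC0'.le) (M := C * (c⁻¹ * C')) (fun F f => by
      rw [mul_assoc]
      exact (hC F _).trans (mul_le_mul_of_nonneg_left (hB F f) hC0.le)) hvu
  refine ⟨v, ?_, ⟨⟨fun i h => ?_, fun i => ?_, fun i i' hne => ?_⟩, ψ,
    ⟨hψ1, fun i i' hne => hψ0 i i' hne, hψs⟩, fun i m hm => ?_⟩,
    PermutativelyEquivalent.of_operators (Equiv.refl I) T R hT hR⟩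
  · obtain ⟨a, b, ha, hab⟩ := hun
    obtain ⟨M, hM0, hM⟩ := exists_bound_endo 𝕜 T
    obtain ⟨M', hM0', hM'⟩ := exists_bound_endo 𝕜 R
    refine ⟨a / M', M * b, by positivity, fun i => ⟨?_, ?_⟩⟩
    · rw [div_le_iff₀' hM0']
      have := hM' (v i)
      rw [hR] at this
      exact (hab i).1.trans this
    · rw [← show T (u i) = v i from hT i]
      exact (hM _).trans (mul_le_mul_of_nonneg_left (hab i).2 hM0.le)
  · have := hψ1 i
    rw [h, map_zero] at this
    exact zero_ne_one this
  · rw [hcoeff]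
    refine ((A i).image fun j => σ (k i j) j).finite_toSet.subset fun m hm => ?_
    obtain ⟨j, hj, rfl⟩ := hsupp i m hm
    exact Finset.mem_coe.2 (Finset.mem_image_of_mem (fun j => σ (k i j) j) hj)
  · change Disjoint (vecSupport 𝕜 x (v i)) (vecSupport 𝕜 x (v i'))
    rw [hcoeff, hcoeff]
    refine Set.disjoint_left.2 fun m hm hm' => ?_
    obtain ⟨j, hj, h⟩ := hsupp i m hm
    obtain ⟨j', hj', h'⟩ := hsupp i' m hm'
    exact hne (hinj i i' j j' hj hj' (h.symm.trans h')).1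
  · obtain ⟨j, hj, rfl⟩ := hψsupp i m hm
    rw [hcoeff]
    change e _ (v i) ≠ 0
    rw [hself i j hj]
    exact hne0 i j hj

end Blocks

section Subbasis

variable {𝕜 : Type v} [RCLike 𝕜] {X : Type u} [AddCommGroup X] [Module 𝕜 X]
  [UniformSpace X] [IsUniformAddGroup X] [ContinuousSMul 𝕜 X] [Norm X]
  [QuasiBanachSpace 𝕜 X]
  {E : Type u} [NormedAddCommGroup E] [NormedSpace 𝕜 E] [CompleteSpace E] {JX : X →ₗ[𝕜] E}
  {J : Type*} {x : J → X} {e : J → X →L[𝕜] 𝕜} {K : ℝ}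

/-- A semi-normalized system with projecting functionals is equivalent to well complemented blocks
of the basis, hence, by universality, to a subbasis. The index type lives in `Type` because
universality is only available there. -/
theorem exists_subbasis_of_isUncSystem (hJ : IsBanachEnvelope JX) (hE : AntiEuclidean 𝕜 E)
    (hx : IsUncSystem x e K) (htot : ∀ f, HasSum (fun j => e j f • x j) f)
    (hL : IsLConvexBasis 𝕜 x) (huniv : IsUniversalForWellComplementedBlocks 𝕜 x)
    (hsq : PermutativelyEquivalent 𝕜 x (squareSeq x)) {I : Type} [Countable I] {u : I → X}
    {φ : I → X →L[𝕜] 𝕜} (hu : IsUncSystem u φ K) (hus : ∀ f, Summable fun i => φ i f • u i)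
    (hun : SemiNormalized u) :
    ∃ A : Set J, PermutativelyEquivalent 𝕜 u (fun j : A => x j) := by
  classical
  have := t2Space 𝕜 (X := X)
  choose G hG using fun i => hu.exists_finset_half_le htot i
  obtain ⟨c, hc, hmax⟩ := hJ.exists_column_bound hE hx hu G hG
  obtain ⟨N, A, k, hpos, hlow, hk⟩ := exists_coloring
    (fun i j => ‖e j (u i)‖ * ‖φ i (x j)‖) (fun i j => by positivity) G hc
    (fun i => hx.sum_norm_mul_le hu i (G i)) hmax
  obtain ⟨V, W, σ, hσ, hV, hW⟩ := exists_copies huniv.1.2 hx.apply_self hx.apply_ne hsq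
  obtain ⟨v, hvn, hvb, huv⟩ := exists_equivalent_blocks hx huniv.1 htot hL hu hus hun hσ hV hW hk
    (half_pos hc) hpos hlow
  obtain ⟨π, hπ, -, hvx⟩ := huniv.2.2 I v hvn hvb
  exact ⟨Set.range π, (huv.trans hvx.permutativelyEquivalent).trans
    (.of_operators (Equiv.ofInjective π hπ) (ContinuousLinearMap.id 𝕜 X)
      (ContinuousLinearMap.id 𝕜 X) (fun _ => rfl) fun _ => rfl)⟩

end Subbasis

end QuasiBanach

theorem theorem3p6 {𝕜 : Type v} [RCLike 𝕜] {X : Type u} [AddCommGroup X] [Module 𝕜 X]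
    [UniformSpace X] [IsUniformAddGroup X] [ContinuousSMul 𝕜 X] [Norm X]
    [QuasiBanach.QuasiBanachSpace 𝕜 X]
    {E : Type u} [NormedAddCommGroup E] [NormedSpace 𝕜 E] [CompleteSpace E]
    (JX : X →ₗ[𝕜] E) (hJX : QuasiBanach.IsBanachEnvelope JX)
    (hE : QuasiBanach.AntiEuclidean 𝕜 E)
    {J : Type*} [Countable J] (x : J → X) (hx : QuasiBanach.IsUnconditionalBasis 𝕜 x)
    (hL : QuasiBanach.IsLConvexBasis 𝕜 x)
    (huniv : QuasiBanach.IsUniversalForWellComplementedBlocks 𝕜 x)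
    (hsq : QuasiBanach.PermutativelyEquivalent 𝕜 x (QuasiBanach.squareSeq x))
    {I : Type*} [Countable I] (b : I → X) (hbn : QuasiBanach.SemiNormalized b)
    (hb : QuasiBanach.IsUnconditionalBasicSeq 𝕜 b)
    (hbc : QuasiBanach.IsComplementedSeq 𝕜 b) :
    ∃ A : Set J, QuasiBanach.PermutativelyEquivalent 𝕜 b (fun j : A => x j) := by
  have := QuasiBanach.t2Space 𝕜 (X := X)
  have := QuasiBanach.QuasiBanachSpace.complete 𝕜 (X := X)
  obtain ⟨P, hP⟩ := hbc
  obtain ⟨e, K, he, htot⟩ := QuasiBanach.exists_coordinates hx.1 (ContinuousLinearMap.id 𝕜 X)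
    (fun f => by rw [hx.2]; trivial) fun _ => rfl
  obtain ⟨φ, K', hφ, hs⟩ := QuasiBanach.exists_coordinates hb
    ((QuasiBanach.closedSpan 𝕜 b).subtypeL ∘L P) (fun f => (P f).2) fun i =>
      congrArg Subtype.val (hP ⟨b i, QuasiBanach.mem_closedSpan 𝕜 b i⟩)
  -- a copy of the index set in `Type`
  obtain ⟨g, hg⟩ := exists_injective_nat I
  let π : Set.range g ≃ I := (Equiv.ofInjective g hg).symm
  obtain ⟨A, hA⟩ := QuasiBanach.exists_subbasis_of_isUncSystem hJX hE
    (he.mono (le_max_left K K')) htot hL huniv hsq (u := fun i => b (π i))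
    ((hφ.mono (le_max_right K K')).comp π.injective)
    (fun f => (hs f).summable.comp_injective π.injective)
    (by
      obtain ⟨s, t, h0, h⟩ := hbn
      exact ⟨s, t, h0, fun i => h (π i)⟩)
  exact ⟨A, .trans (.of_operators π.symm (ContinuousLinearMap.id 𝕜 X)
    (ContinuousLinearMap.id 𝕜 X) (fun i => by simp) fun i => by simp) hA⟩
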